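/- **Definitions.** A *graph operation* $g$ is a finite connected bi-rooted multidigraph $(V,E,\mathrm{src},\mathrm{tgt},v_{\mathrm{in}},v_{\mathrm{out}})$, $V\neq\emptyset$, considered up to isomorphism, with one argument for each edge. A *$\mathcal G$-algebra* is a complex vector space $\mathcal A$ on which every graph operation $g$ acts by a multilinear map $Z_g:\mathcal A^{E}\to\mathcal A$, compatibly with substitution (an edge $e$ is replaced by a copy of $g_e$, identifying $\mathrm{src}(e)$ with the input and $\mathrm{tgt}(e)$ with the output of $g_e$), with relabelling of the edges, and such that $\mathrm{out}\leftarrow\mathrm{in}$ acts as the identity. It is a unital algebra with $ab=(\mathrm{out}\xleftarrow{a}\cdot\xleftarrow{b}\mathrm{in})$ and with unit given by the one-vertex operation; the transpose is $a^{\intercal}=(\mathrm{out}\xrightarrow{a}\mathrm{in})$. A *test graph* in $\mathcal S$ is a finite connected multidigraph, up to isomorphism, with edge labels in $\mathcal S$. An *algebraic traffic space* $(\mathcal A,\tau)$ is a $\mathcal G$-algebra with a linear functional $\tau$ on the span of the test graphs in $\mathcal A$ which is $1$ on the isolated vertex, multilinear in the edge labels, and unchanged when an edge labelled $Z_g(a_1,\dots,a_K)$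 is replaced by the graph $g$ with labels $a_1,\dots,a_K$. It induces the unital functional $\varphi(a)=\tau[\text{loop labelled } a]$, and $\kappa_n$ denotes the free cumulants of $(\mathcal A,\varphi)$. The *injective traffic state* is $\tau^0[T]=\sum_{\pi}\mu(0_V,\pi)\,\tau[T^\pi]$, summed over the partitions $\pi$ of the vertex set $V$ of $T$, where $T^\pi$ is the quotient of $T$ by $\pi$ and $\mu$ is the Möbius function of the partition lattice. A connected multidigraph is a *cactus* if every edge belongs to a unique simple undirected cycle (a loop is a cycle of length $1$, two edges joining the same two distinct vertices form a cycle of length $2$); these cycles are its *pads*. It is an *oriented cactus* if moreover all pads are directed cycles. A family $(a_i)_{i\in I}$ in $\mathcal A$ is of *cactus-type* if for every test graph $T$ with labels in $I$, writing $T(\mathbf a)$ for $T$ with each label $i$ replaced by $a_i$, one has $\tau^0[T(\mathbf a)]=0$ when $T$ is not a cactus and $\tau^0[T(\mathbf a)]=\prod_{C\in \mathrm{Pads}(T)}\tau^0[C(\mathbf a)]$ when $T$ is a cactus. For $\mathcal S\subset\mathcal A$, let $\Theta(\mathcal S)$ be the linear span of all $Z_g(s_1,\dots,s_K)$, where $K\ge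 0$, $s_j\in\mathcal S$, and $g$ is a $K$-edge graph operation such that either its input and output coincide or some simple undirected cycle of $g$ visits both of them. Subsets of $\mathcal A$ are *free* if the unital subalgebras that they generate are freely independent with respect to $\varphi$. **Statement.** Let $(\mathcal A,\tau)$ be an algebraic traffic space and let $(a_i)_{i\in I}\subset\mathcal A$ be a family of cactus-type. 1. For all $n\ge1$, all $i(1),\dots,i(n)\in I$, and all choices $\hat\intercal(1),\dots,\hat\intercal(n)\in\{1,\intercal\}$, $$\kappa_n\big[a_{i(1)}^{\hat\intercal(1)},\dots,a_{i(n)}^{\hat\intercal(n)}\big]=\tau^0[C_n],$$ where $C_n$ is the directed cycle with vertices $v_k$, $k\in\mathbb Z/n$, and with edges $e_k$ from $v_{k+1}$ to $v_k$ labelled by $a_{i(k)}^{\hat\intercal(k)}$. 2. Let $\mathcal A_1$ be the unital algebra generated by $(a_i)_{i\in I}$ and let $\mathcal A_1^{\intercal}=\{a^{\intercal}:a\in\mathcal A_1\}$. Then $\mathcal A_1\cup\mathcal A_1^{\intercal}$ and $\Theta(\mathcal A_1)$ are free. 3. If moreover $\tau^0[T(\mathbf a)]=0$ for every test graph $T$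 with labels in $I$ that is not an oriented cactus, then $\mathcal A_1$ and $\mathcal A_1^{\intercal}$ are free. -/

import Mathlib

namespace Traffic

/-! ### Multidigraphs -/

/-- A multidigraph with vertex set `V` and edge set `E` (both finite wherever they are used). -/
structure Multidigraph (V E : Type) where
  src : E → V
  tgt : E → V

namespace Multidigraph

variable {V E : Type}

/-- There is an edge from `v` to `w`. -/
def Adj (G : Multidigraph V E) (v w : V) : Prop := ∃ e, G.src e = v ∧ G.tgt e = w

/-- Connectedness (edge directions are ignored); a connected graph has a vertex. -/
def Connected (G : Multidigraph V E) : Prop :=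
  Nonempty V ∧ ∀ v w, Relation.EqvGen G.Adj v w

/-- `C` is the edge set of a simple undirected cycle
`v₀ -e₀- v₁ -e₁- ⋯ -eₙ- v₀` of length `n + 1 ≥ 1`, with distinct vertices and distinct edges
(addition in `Fin (n + 1)` is cyclic, so a loop is a cycle of length one and two parallel or
antiparallel edges form a cycle of length two). -/
def IsSimpleCycle (G : Multidigraph V E) (C : Set E) : Prop :=
  ∃ (n : ℕ) (v : Fin (n + 1) → V) (e : Fin (n + 1) → E),
    Function.Injective v ∧ Function.Injective e ∧
    (∀ i, s(G.src (e i), G.tgt (e i)) = s(v i, v (i + 1))) ∧ Set.range e = C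

/-- `C` is the edge set of a simple directed cycle. -/
def IsDirectedCycle (G : Multidigraph V E) (C : Set E) : Prop :=
  ∃ (n : ℕ) (v : Fin (n + 1) → V) (e : Fin (n + 1) → E),
    Function.Injective v ∧ Function.Injective e ∧
    (∀ i, G.src (e i) = v i ∧ G.tgt (e i) = v (i + 1)) ∧ Set.range e = C

/-- The vertex `v` is an endpoint of an edge in `C`. -/
def Visits (G : Multidigraph V E) (C : Set E) (v : V) : Prop :=
  ∃ e ∈ C, G.src e = v ∨ G.tgt e = v

end Multidigraph

/-- A connected multidigraph. -/
structure ConnGraph (V E : Type) extends Multidigraph V E where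
  connected : toMultidigraph.Connected

/-- A graph operation: a connected bi-rooted multidigraph. Its arguments are indexed by the edge
set `E` itself; an ordering of the edges would only name the arguments `1, …, K`. -/
structure GraphOp (V E : Type) extends ConnGraph V E where
  vin : V
  vout : V

theorem eqvGen_of_cyclic {α : Type} {r : α → α → Prop} {n : ℕ} (v : Fin (n + 1) → α)
    (h : ∀ i, Relation.EqvGen r (v i) (v (i + 1))) (i j : Fin (n + 1)) :
    Relation.EqvGen r (v i) (v j) := by
  have key : ∀ i, Relation.EqvGen r (v 0) (v i) := by
    intro i
    induction i using Fin.induction with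
    | zero => exact .refl _
    | succ i ih =>
      have := h i.castSucc
      rw [Fin.coeSucc_eq_succ] at this
      exact .trans _ _ _ ih this
  exact .trans _ _ _ (.symm _ _ (key i)) (key j)

theorem eqvGen_map {α β : Type} {r : α → α → Prop} {s : β → β → Prop} (f : α → β)
    (h : ∀ a b, r a b → Relation.EqvGen s (f a) (f b)) {a b : α}
    (hab : Relation.EqvGen r a b) : Relation.EqvGen s (f a) (f b) := by
  induction hab with
  | rel a b hab => exact h a b hab
  | refl a => exact .refl _
  | symm a b _ ih => exact .symm _ _ ih
  | trans a b c _ _ ih₁ ih₂ => exact .trans _ _ _ ih₁ ih₂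

namespace ConnGraph

variable {V E : Type}

/-- The quotient `G^π`, obtained by identifying the vertices within each block of `π`. -/
def quotient (G : ConnGraph V E) (π : Setoid V) : ConnGraph (Quotient π) E where
  src e := Quotient.mk π (G.src e)
  tgt e := Quotient.mk π (G.tgt e)
  connected := by
    refine ⟨G.connected.1.map (Quotient.mk π), fun v w => ?_⟩
    induction v using Quotient.inductionOn with | _ v => ?_
    induction w using Quotient.inductionOn with | _ w => ?_
    refine eqvGen_map (Quotient.mk π) ?_ (G.connected.2 v w)
    rintro a b ⟨e, rfl, rfl⟩
    exact .rel _ _ ⟨e, rfl, rfl⟩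

/-- A cactus: every edge belongs to a unique simple cycle. -/
def IsCactus (G : ConnGraph V E) : Prop := ∀ e, ∃! C, G.IsSimpleCycle C ∧ e ∈ C

/-- An oriented cactus: moreover each simple cycle is directed. -/
def IsOrientedCactus (G : ConnGraph V E) : Prop :=
  G.IsCactus ∧ ∀ C, G.IsSimpleCycle C → G.IsDirectedCycle C

/-- The simple cycles of `G`; for a cactus these are its pads. -/
def Pads (G : ConnGraph V E) : Type := {C : Set E // G.IsSimpleCycle C}

/-- The simple cycle `C` as a graph of its own: its edges and the vertices that it visits. -/
def pad (G : ConnGraph V E) (C : G.Pads) : ConnGraph {v // G.Visits C.1 v} C.1 where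
  src e := ⟨G.src e.1, e.1, e.2, .inl rfl⟩
  tgt e := ⟨G.tgt e.1, e.1, e.2, .inr rfl⟩
  connected := by
    obtain ⟨C, n, v, e, hv, he, hve, rfl⟩ := C
    have hvis : ∀ i, G.Visits (Set.range e) (v i) := by
      intro i
      refine ⟨e i, ⟨i, rfl⟩, ?_⟩
      have := hve i
      rw [Sym2.eq_iff] at this
      rcases this with h | h
      · exact .inl h.1
      · exact .inr h.2
    have hall : ∀ x : {v // G.Visits (Set.range e) v}, ∃ i, (⟨v i, hvis i⟩ : {v // _}) = x := by
      rintro ⟨x, _, ⟨i, rfl⟩, hx⟩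
      have := hve i
      rw [Sym2.eq_iff] at this
      rcases this with h | h <;> rcases hx with rfl | rfl
      · exact ⟨i, Subtype.ext h.1.symm⟩
      · exact ⟨i + 1, Subtype.ext h.2.symm⟩
      · exact ⟨i + 1, Subtype.ext h.1.symm⟩
      · exact ⟨i, Subtype.ext h.2.symm⟩
    refine ⟨⟨v 0, hvis 0⟩, fun x y => ?_⟩
    obtain ⟨i, rfl⟩ := hall x
    obtain ⟨j, rfl⟩ := hall y
    refine eqvGen_of_cyclic (fun i => (⟨v i, hvis i⟩ : {v // G.Visits (Set.range e) v})) ?_ i j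
    intro i
    have := hve i
    rw [Sym2.eq_iff] at this
    rcases this with h | h
    · exact .rel _ _ ⟨⟨e i, i, rfl⟩, Subtype.ext h.1, Subtype.ext h.2⟩
    · exact .symm _ _ (.rel _ _ ⟨⟨e i, i, rfl⟩, Subtype.ext h.1, Subtype.ext h.2⟩)

variable {W F : E → Type}

/-- The identifications made when each edge `e` of `G` is replaced by a copy of the bi-rooted graph
`h e`: the source of `e` is the input of `h e` and the target of `e` is its output. -/
inductive SubstRel (G : ConnGraph V E) (h : ∀ e, GraphOp (W e) (F e)) :
    V ⊕ (Σ e, W e) → V ⊕ (Σ e, W e) → Prop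
  | src (e : E) : SubstRel G h (.inl (G.src e)) (.inr ⟨e, (h e).vin⟩)
  | tgt (e : E) : SubstRel G h (.inl (G.tgt e)) (.inr ⟨e, (h e).vout⟩)

/-- The vertices of the graph obtained by substitution. -/
def SubstVertex (G : ConnGraph V E) (h : ∀ e, GraphOp (W e) (F e)) : Type := Quot (G.SubstRel h)

instance [Finite V] [Finite E] [∀ e, Finite (W e)] (G : ConnGraph V E)
    (h : ∀ e, GraphOp (W e) (F e)) : Finite (G.SubstVertex h) :=
  inferInstanceAs (Finite (Quot _))

/-- The graph obtained from `G` by replacing each edge `e` by a copy of `h e`. -/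
def subst (G : ConnGraph V E) (h : ∀ e, GraphOp (W e) (F e)) :
    ConnGraph (G.SubstVertex h) (Σ e, F e) where
  src x := Quot.mk _ (.inr ⟨x.1, (h x.1).src x.2⟩)
  tgt x := Quot.mk _ (.inr ⟨x.1, (h x.1).tgt x.2⟩)
  connected := by
    let M : Multidigraph (G.SubstVertex h) (Σ e, F e) :=
      ⟨fun x => Quot.mk _ (.inr ⟨x.1, (h x.1).src x.2⟩),
        fun x => Quot.mk _ (.inr ⟨x.1, (h x.1).tgt x.2⟩)⟩
    change M.Connected
    have inner : ∀ e (u w : W e), Relation.EqvGen M.Adj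
        (Quot.mk _ (.inr ⟨e, u⟩)) (Quot.mk _ (.inr ⟨e, w⟩)) := by
      intro e u w
      refine eqvGen_map (fun u => (Quot.mk _ (.inr ⟨e, u⟩) : G.SubstVertex h)) ?_
        ((h e).connected.2 u w)
      rintro a b ⟨f, rfl, rfl⟩
      exact .rel _ _ ⟨⟨e, f⟩, rfl, rfl⟩
    have outer : ∀ v w : V, Relation.EqvGen M.Adj (Quot.mk _ (.inl v)) (Quot.mk _ (.inl w)) := by
      intro v w
      refine eqvGen_map (fun v => (Quot.mk _ (.inl v) : G.SubstVertex h)) ?_ (G.connected.2 v w)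
      rintro a b ⟨e, rfl, rfl⟩
      have h₁ : (Quot.mk _ (.inl (G.src e)) : G.SubstVertex h) = Quot.mk _ (.inr ⟨e, (h e).vin⟩) :=
        Quot.sound (.src e)
      have h₂ : (Quot.mk _ (.inl (G.tgt e)) : G.SubstVertex h) = Quot.mk _ (.inr ⟨e, (h e).vout⟩) :=
        Quot.sound (.tgt e)
      simp only [h₁, h₂]
      exact inner _ _ _
    obtain ⟨v₀⟩ := G.connected.1
    have base : ∀ x : G.SubstVertex h, Relation.EqvGen M.Adj (Quot.mk _ (.inl v₀)) x := by
      intro x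
      induction x using Quot.inductionOn with | _ x => ?_
      rcases x with v | ⟨e, w⟩
      · exact outer _ _
      · have h₁ : (Quot.mk _ (.inl (G.src e)) : G.SubstVertex h)
            = Quot.mk _ (.inr ⟨e, (h e).vin⟩) := Quot.sound (.src e)
        have h₂ := outer v₀ (G.src e)
        rw [h₁] at h₂
        exact .trans _ _ _ h₂ (inner _ _ _)
    exact ⟨⟨Quot.mk _ (.inl v₀)⟩, fun x y => .trans _ _ _ (.symm _ _ (base x)) (base y)⟩

/-- The cycle `C_n` with vertices `v_k` and edges `e_k`, where `e_k` goes from `v_{k+1}` to `v_k`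
(indices modulo `n ≥ 1`). -/
def cycle (n : ℕ) [NeZero n] : ConnGraph (Fin n) (Fin n) where
  src k := k + 1
  tgt k := k
  connected := by
    refine ⟨⟨0⟩, fun v w => ?_⟩
    obtain ⟨m, rfl⟩ : ∃ m, n = m + 1 := ⟨n - 1, by have := NeZero.pos n; omega⟩
    exact eqvGen_of_cyclic id (fun i => .symm _ _ (.rel _ _ ⟨i, rfl, rfl⟩)) v w

end ConnGraph

namespace GraphOp

variable {V E : Type} {W F : E → Type}

/-- The composite graph operation. -/
def subst (g : GraphOp V E) (h : ∀ e, GraphOp (W e) (F e)) :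
    GraphOp (g.SubstVertex h) (Σ e, F e) where
  toConnGraph := g.toConnGraph.subst h
  vin := Quot.mk _ (.inl g.vin)
  vout := Quot.mk _ (.inl g.vout)

/-- The directed path `out ← · ← ⋯ ← in` with `n` edges, numbered from the output to the input.
For `n = 0` it is the trivial graph operation, for `n = 1` the unit of the operad. -/
def path (n : ℕ) : GraphOp (Fin (n + 1)) (Fin n) where
  src i := i.succ
  tgt i := i.castSucc
  connected := by
    have key : ∀ i : Fin (n + 1), Relation.EqvGen
        (Multidigraph.Adj (⟨Fin.succ, Fin.castSucc⟩ : Multidigraph (Fin (n + 1)) (Fin n))) 0 i := by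
      intro i
      induction i using Fin.induction with
      | zero => exact .refl _
      | succ i ih => exact .trans _ _ _ ih (.symm _ _ (.rel _ _ ⟨i, rfl, rfl⟩))
    exact ⟨⟨0⟩, fun v w => .trans _ _ _ (.symm _ _ (key v)) (key w)⟩
  vin := Fin.last n
  vout := 0

/-- The transpose: input and output are interchanged. -/
def transpose (g : GraphOp V E) : GraphOp V E where
  toConnGraph := g.toConnGraph
  vin := g.vout
  vout := g.vin

/-- The class `Θ`: the input and the output lie on a common simple undirected cycle; a single vertex
counts as a cycle here, so that diagonal graph operations (input = output) belong to the class. -/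
def IsTheta (g : GraphOp V E) : Prop :=
  g.vin = g.vout ∨ ∃ C, g.IsSimpleCycle C ∧ g.Visits C g.vin ∧ g.Visits C g.vout

end GraphOp

/-! ### `𝒢`-algebras -/

/-- A `𝒢`-algebra: a complex vector space with an action of the operad of graph operations.
Graph operations are considered up to isomorphism; since arguments are indexed by edges, invariance
under isomorphism contains equivariance under reordering of the edges. -/
class GAlgebra (A : Type*) extends AddCommGroup A, Module ℂ A where
  Z : ∀ {V E : Type} [Finite V] [Finite E], GraphOp V E → MultilinearMap ℂ (fun _ : E => A) A
  Z_iso : ∀ {V E V' E' : Type} [Finite V] [Finite E] [Finite V'] [Finite E']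
    (g : GraphOp V E) (g' : GraphOp V' E') (f : V ≃ V') (k : E ≃ E'),
    (∀ e, g'.src (k e) = f (g.src e)) → (∀ e, g'.tgt (k e) = f (g.tgt e)) →
    g'.vin = f g.vin → g'.vout = f g.vout → ∀ a : E' → A, Z g' a = Z g (fun e => a (k e))
  Z_subst : ∀ {V E : Type} {W F : E → Type} [Finite V] [Finite E] [∀ e, Finite (W e)]
    [∀ e, Finite (F e)] (g : GraphOp V E) (h : ∀ e, GraphOp (W e) (F e)) (a : (Σ e, F e) → A),
    Z (g.subst h) a = Z g (fun e => Z (h e) (fun f => a ⟨e, f⟩))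
  Z_id : ∀ a : A, Z (GraphOp.path 1) (fun _ => a) = a

namespace GAlgebra

/-- The vertices of the concatenation of two paths. -/
def pathVertexEquiv (p q : ℕ) :
    (GraphOp.path 2).SubstVertex (fun e : Fin 2 => GraphOp.path (![p, q] e)) ≃ Fin (p + q + 1) where
  toFun := Quot.lift
    (fun x => match x with
      | .inl 0 => ⟨0, by omega⟩
      | .inl 1 => ⟨p, by omega⟩
      | .inl 2 => ⟨p + q, by omega⟩
      | .inr ⟨0, w⟩ => ⟨w.1, by have := w.2; simp at this; omega⟩
      | .inr ⟨1, w⟩ => ⟨p + w.1, by have := w.2; simp at this; omega⟩)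
    (by
      rintro _ _ (e | e) <;> fin_cases e <;> simp [GraphOp.path])
  invFun i := if h : i.1 ≤ p then Quot.mk _ (.inr ⟨0, ⟨i.1, by simp; omega⟩⟩)
    else Quot.mk _ (.inr ⟨1, ⟨i.1 - p, by simp; omega⟩⟩)
  left_inv := by
    have h₀ := Quot.sound (ConnGraph.SubstRel.src (G := (GraphOp.path 2).toConnGraph)
      (h := fun e : Fin 2 => GraphOp.path (![p, q] e)) 0)
    have h₁ := Quot.sound (ConnGraph.SubstRel.tgt (G := (GraphOp.path 2).toConnGraph)
      (h := fun e : Fin 2 => GraphOp.path (![p, q] e)) 0)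
    have h₂ := Quot.sound (ConnGraph.SubstRel.src (G := (GraphOp.path 2).toConnGraph)
      (h := fun e : Fin 2 => GraphOp.path (![p, q] e)) 1)
    have h₃ := Quot.sound (ConnGraph.SubstRel.tgt (G := (GraphOp.path 2).toConnGraph)
      (h := fun e : Fin 2 => GraphOp.path (![p, q] e)) 1)
    intro x
    induction x using Quot.inductionOn with | _ x => ?_
    rcases x with v | ⟨e, w, hw⟩
    · fin_cases v
      · exact (dif_pos (Nat.zero_le p)).trans h₁.symm
      · exact (dif_pos (le_refl p)).trans h₀.symm
      · by_cases hq : q = 0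
        · subst hq
          exact (dif_pos (le_refl p)).trans (h₀.symm.trans (h₃.trans h₂.symm))
        · have : ¬ p + q ≤ p := by omega
          refine (dif_neg this).trans (Eq.trans ?_ h₂.symm)
          refine congrArg (fun u => Quot.mk _ (Sum.inr (⟨1, u⟩ : Σ e : Fin 2, Fin (![p, q] e + 1)))) ?_
          exact Fin.ext (Nat.add_sub_cancel_left (n := p) (m := q))
    · fin_cases e
      · have hw' : w ≤ p := Nat.lt_succ_iff.1 hw
        exact (dif_pos hw').trans rfl
      · by_cases hq : w = 0
        · subst hq
          exact (dif_pos (le_refl p)).trans (h₀.symm.trans h₃)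
        · have : ¬ p + w ≤ p := by omega
          refine (dif_neg this).trans ?_
          refine congrArg (fun u => Quot.mk _ (Sum.inr (⟨1, u⟩ : Σ e : Fin 2, Fin (![p, q] e + 1)))) ?_
          exact Fin.ext (Nat.add_sub_cancel_left (n := p) (m := w))
  right_inv := by
    intro i
    by_cases h : i.1 ≤ p
    · exact congrArg _ (dif_pos h)
    · refine (congrArg _ (dif_neg h)).trans ?_
      exact Fin.ext (Nat.add_sub_cancel' (by omega : p ≤ i.1))

/-- The edges of the concatenation of two paths. -/
def pathEdgeEquiv (p q : ℕ) : (Σ e : Fin 2, Fin (![p, q] e)) ≃ Fin (p + q) where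
  toFun x := match x with
    | ⟨0, i⟩ => Fin.castAdd q i
    | ⟨1, i⟩ => Fin.natAdd p i
  invFun i := Fin.addCases (fun i => ⟨0, i⟩) (fun i => ⟨1, i⟩) i
  left_inv := by
    rintro ⟨e, i⟩
    fin_cases e
    · exact Fin.addCases_left (m := p) (n := q) i
    · exact Fin.addCases_right (m := p) (n := q) i
  right_inv := by
    intro i
    induction i using Fin.addCases <;> simp

variable {A : Type*} [GAlgebra A]

theorem Z_path_append (p q : ℕ) (x : Fin p → A) (y : Fin q → A) :
    Z (GraphOp.path 2) ![Z (GraphOp.path p) x, Z (GraphOp.path q) y] =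
      Z (GraphOp.path (p + q)) (Fin.append x y) := by
  have h := Z_iso (A := A) ((GraphOp.path 2).subst (fun e : Fin 2 => GraphOp.path (![p, q] e)))
    (GraphOp.path (p + q)) (pathVertexEquiv p q) (pathEdgeEquiv p q)
    (by
      rintro ⟨e, i⟩
      fin_cases e
      · rfl
      · rfl)
    (by
      rintro ⟨e, i⟩
      fin_cases e
      · rfl
      · rfl)
    rfl rfl (Fin.append x y)
  rw [h, Z_subst]
  congr 1
  funext e
  fin_cases e
  · change Z (GraphOp.path p) x = Z (GraphOp.path p) (fun f => Fin.append x y (Fin.castAdd q f))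
    congr 1
    funext f
    simp
  · change Z (GraphOp.path q) y = Z (GraphOp.path q) (fun f => Fin.append x y (Fin.natAdd p f))
    congr 1
    funext f
    simp

/-- The product `out ←a- · ←b- in`. -/
instance : Mul A := ⟨fun a b => Z (GraphOp.path 2) ![a, b]⟩

/-- The unit, given by the trivial graph operation. -/
instance : One A := ⟨Z (GraphOp.path 0) ![]⟩

theorem mul_def (a b : A) : a * b = Z (GraphOp.path 2) ![a, b] := rfl

theorem one_def : (1 : A) = Z (GraphOp.path 0) ![] := rfl

theorem Z_path_one (x : Fin 1 → A) : Z (GraphOp.path 1) x = x 0 := by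
  rw [← Z_id (x 0)]
  congr 1
  funext i
  rw [Subsingleton.elim i 0]

theorem Z_path_two_add_left (a b c : A) : (a + b) * c = a * c + b * c := by
  have h := (Z (GraphOp.path 2)).map_update_add (![a, c] : Fin 2 → A) 0 a b
  have e : ∀ z : A, Function.update (![a, c] : Fin 2 → A) 0 z = ![z, c] := by
    intro z; funext i; fin_cases i <;> simp
  simp only [e] at h
  exact h

theorem Z_path_two_add_right (a b c : A) : a * (b + c) = a * b + a * c := by
  have h := (Z (GraphOp.path 2)).map_update_add (![a, b] : Fin 2 → A) 1 b c
  have e : ∀ z : A, Function.update (![a, b] : Fin 2 → A) 1 z = ![a, z] := by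
    intro z; funext i; fin_cases i <;> simp
  simp only [e] at h
  exact h

theorem Z_path_two_smul_left (r : ℂ) (a b : A) : (r • a) * b = r • (a * b) := by
  have h := (Z (GraphOp.path 2)).map_update_smul (![a, b] : Fin 2 → A) 0 r a
  have e : ∀ z : A, Function.update (![a, b] : Fin 2 → A) 0 z = ![z, b] := by
    intro z; funext i; fin_cases i <;> simp
  simp only [e] at h
  exact h

theorem Z_path_two_smul_right (r : ℂ) (a b : A) : a * (r • b) = r • (a * b) := by
  have h := (Z (GraphOp.path 2)).map_update_smul (![a, b] : Fin 2 → A) 1 r b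
  have e : ∀ z : A, Function.update (![a, b] : Fin 2 → A) 1 z = ![a, z] := by
    intro z; funext i; fin_cases i <;> simp
  simp only [e] at h
  exact h

/-- The ring structure of a `𝒢`-algebra. -/
instance : Ring A :=
  { (inferInstance : AddCommGroup A) with
    mul := (· * ·)
    one := 1
    left_distrib := Z_path_two_add_right
    right_distrib := Z_path_two_add_left
    zero_mul := fun a => by
      have := Z_path_two_smul_left 0 (0 : A) a
      simpa using this
    mul_zero := fun a => by
      have := Z_path_two_smul_right 0 a (0 : A)
      simpa using this
    mul_assoc := fun a b c => by
      have h₁ := Z_path_append 2 1 ![a, b] ![c]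
      have h₂ := Z_path_append 1 2 ![a] ![b, c]
      rw [Z_path_one] at h₁ h₂
      refine h₁.trans (Eq.trans ?_ h₂.symm)
      congr 1
      funext i
      fin_cases i <;> rfl
    one_mul := fun a => by
      have h := Z_path_append 0 1 ![] ![a]
      rw [Z_path_one] at h
      exact h.trans (Z_path_one (A := A) _)
    mul_one := fun a => by
      have h := Z_path_append 1 0 ![a] ![]
      rw [Z_path_one] at h
      exact h.trans (Z_path_one (A := A) _) }

/-- The unital complex algebra structure of a `𝒢`-algebra. -/
instance : Algebra ℂ A := Algebra.ofModule Z_path_two_smul_left Z_path_two_smul_right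

/-- The transpose `a^⊺ = out -a→ in`. -/
def transpose (a : A) : A := Z (GraphOp.path 1).transpose (fun _ => a)

/-- `Θ(S)`: the span of the `Z_g(a₁, …, a_K)` for `g` in the class `Θ` and `a_i ∈ S`. -/
def theta (S : Set A) : Submodule ℂ A :=
  Submodule.span ℂ {x | ∃ (V E : Type) (_ : Finite V) (_ : Finite E) (g : GraphOp V E) (a : E → A),
    g.IsTheta ∧ (∀ e, a e ∈ S) ∧ Z g a = x}

end GAlgebra

/-! ### Non-commutative probability -/

/-- The Möbius function of a finite poset. -/
noncomputable def moebius {α : Type} [PartialOrder α] [Finite α] (x y : α) : ℂ := by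
  classical
  letI := Fintype.ofFinite α
  letI := Fintype.toLocallyFiniteOrder (α := α)
  exact IncidenceAlgebra.mu ℂ x y

instance {α : Type} [Finite α] : Finite (Setoid α) :=
  Finite.of_injective (fun (s : Setoid α) a b => s a b) fun s t h =>
    Setoid.ext fun a b => by rw [show s a b = t a b from congrFun (congrFun h a) b]

/-- Non-crossing partitions of `{0, …, n - 1}`; the order is `σ ≤ π` iff `σ` refines `π`. -/
abbrev NC (n : ℕ) : Type :=
  {π : Setoid (Fin n) // ∀ i j k l, i < j → j < k → k < l → π i k → π j l → π i j}

/-- The partition with a single block. -/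
def NC.one (n : ℕ) : NC n := ⟨⊤, fun _ _ _ _ _ _ _ _ _ => trivial⟩

section Free

variable {R : Type*} [Ring R] [Algebra ℂ R] (φ : R →ₗ[ℂ] ℂ)

open scoped Classical in
/-- `φ_π[a₁, …, a_n] = ∏_{B ∈ π} φ(∏_{i ∈ B} a_i)`, where the inner products are taken in increasing
order of the indices. -/
noncomputable def partitionMoment {n : ℕ} (π : NC n) (a : Fin n → R) : ℂ :=
  ∏ᶠ B : Quotient π.1,
    φ ((((List.finRange n).filter (fun i => Quotient.mk π.1 i = B)).map a).prod)

/-- `κ_π[a₁, …, a_n] = ∑_{σ ∈ NC(n), σ ≤ π} φ_σ[a₁, …, a_n] μ(σ, π)`. -/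
noncomputable def partitionCumulant {n : ℕ} (π : NC n) (a : Fin n → R) : ℂ :=
  ∑ᶠ σ : {σ : NC n // σ ≤ π}, partitionMoment φ σ.1 a * moebius σ.1 π

/-- The free cumulant `κ_n`. -/
noncomputable def freeCumulant {n : ℕ} (a : Fin n → R) : ℂ := partitionCumulant φ (NC.one n) a

/-- Free independence of two subsets: alternating products of centered elements of the unital
subalgebras that they generate are centered. -/
def AreFree (S T : Set R) : Prop :=
  ∀ (n : ℕ) (c : Fin (n + 1) → Bool) (x : Fin (n + 1) → R),
    (∀ k : Fin n, c k.castSucc ≠ c k.succ) →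
    (∀ k, x k ∈ Algebra.adjoin ℂ (if c k then S else T)) →
    (∀ k, φ (x k) = 0) → φ (List.ofFn x).prod = 0

end Free

/-! ### Algebraic traffic spaces -/

/-- A traffic state on a `𝒢`-algebra `A`. A test graph in `A` is a connected multidigraph `G` with
edge labels `a : E → A`, considered up to isomorphism, and `τ G a` is the value of the state on it
(a linear functional on the span of the test graphs is determined by these values). -/
structure TrafficState (A : Type*) [GAlgebra A] where
  τ : ∀ {V E : Type} [Finite V] [Finite E], ConnGraph V E → MultilinearMap ℂ (fun _ : E => A) ℂ
  τ_iso : ∀ {V E V' E' : Type} [Finite V] [Finite E] [Finite V'] [Finite E']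
    (G : ConnGraph V E) (G' : ConnGraph V' E') (f : V ≃ V') (k : E ≃ E'),
    (∀ e, G'.src (k e) = f (G.src e)) → (∀ e, G'.tgt (k e) = f (G.tgt e)) →
    ∀ a : E' → A, τ G' a = τ G (fun e => a (k e))
  τ_unit : τ (GraphOp.path 0).toConnGraph ![] = 1
  τ_subst : ∀ {V E : Type} {W F : E → Type} [Finite V] [Finite E] [∀ e, Finite (W e)]
    [∀ e, Finite (F e)] (G : ConnGraph V E) (h : ∀ e, GraphOp (W e) (F e)) (a : (Σ e, F e) → A),
    τ G (fun e => GAlgebra.Z (h e) (fun f => a ⟨e, f⟩)) = τ (G.subst h) a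

namespace TrafficState

variable {A : Type*} [GAlgebra A] (T : TrafficState A)

/-- The induced functional `φ_τ(a)`, the value of `τ` on a loop labelled by `a`. -/
def φ : A →ₗ[ℂ] ℂ where
  toFun a := T.τ (ConnGraph.cycle 1) (fun _ => a)
  map_add' a b := by
    have h := (T.τ (ConnGraph.cycle 1)).map_update_add (fun _ => a) 0 a b
    have e : ∀ z : A, Function.update (fun _ : Fin 1 => a) 0 z = fun _ => z := by
      intro z; funext i; rw [Subsingleton.elim i 0]; simp
    simpa only [e] using h
  map_smul' r a := by
    have h := (T.τ (ConnGraph.cycle 1)).map_update_smul (fun _ => a) 0 r a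
    have e : ∀ z : A, Function.update (fun _ : Fin 1 => a) 0 z = fun _ => z := by
      intro z; funext i; rw [Subsingleton.elim i 0]; simp
    simp only [e] at h
    exact h

/-- The injective traffic state `τ⁰[T] = ∑_π τ[T^π] μ(0_V, π)`. -/
noncomputable def injective {V E : Type} [Finite V] [Finite E] (G : ConnGraph V E) (a : E → A) : ℂ :=
  ∑ᶠ π : Setoid V, T.τ (G.quotient π) a * moebius ⊥ π

/-- The family `a` is of cactus-type: its injective traffic distribution is supported on cacti and
multiplicative with respect to the pads. A test graph in the indeterminates `(x_i)` is a connected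
multidigraph with edge labels `γ : E → I`. -/
def IsCactusType {I : Type*} (a : I → A) : Prop :=
  ∀ (V E : Type) [Finite V] [Finite E] (G : ConnGraph V E) (γ : E → I),
    (¬ G.IsCactus → T.injective G (fun e => a (γ e)) = 0) ∧
    (G.IsCactus → T.injective G (fun e => a (γ e)) =
      ∏ᶠ C : G.Pads, T.injective (G.pad C) (fun e => a (γ e.1)))

/-- The injective traffic distribution of the family `a` is supported on oriented cacti. -/
def IsSupportedOnOrientedCacti {I : Type*} (a : I → A) : Prop :=
  ∀ (V E : Type) [Finite V] [Finite E] (G : ConnGraph V E) (γ : E → I),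
    ¬ G.IsOrientedCactus → T.injective G (fun e => a (γ e)) = 0

end TrafficState

end Traffic

/-!
For a family of cactus type, everything follows from one identity. Colour the edges of a test graph
`T` so that the pieces of different colours hang together like a tree (`ConnGraph.IsTreeLike`). Then
the product over the colours `q` of the values of `τ` on `T`, where the labels of all other colours
are replaced by units, is the sum of `τ⁰[T^π]` over the quotients `T^π` that are cacti with
monochromatic pads (`IsCactusType.prod_τ_eq`). Indeed a unit label contracts an edge, Möbius inversion
expresses `τ` through `τ⁰`, a choice of one partition for each piece amounts to one partition `π`
of `T` that splits (`IsTreeLike.splitEquiv`), the simple cycles of `T^π` are then those of the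
pieces, and every cactus with monochromatic pads splits (`splits_of_isCactus`).

For the free cumulants, `T` is the cycle `C_n`, with the edges of transposed factors reversed, and the
colours are the blocks of a non-crossing partition `σ`. The pads of a cactus quotient of a cycle form
a non-crossing partition of the edges, so that `φ_σ` is the sum of `τ⁰[C_n^π]` over the cactus
quotients whose pad partition refines `σ`. Möbius inversion on non-crossing partitions leaves those
with a single pad, and only `π = 0` has this property.

For freeness, the algebras in question are spanned by values `Z_g(a_γ)` for graph operations `g` that
are *thin* (each edge is crossed by the passage from the input to the output), *thick* (no edge
separates the input from the output), or *forward* and *backward* (thin, with all edges crossed in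
the same direction). For an alternating product of such elements, `T` is the cyclic product of the
graph operations, and the colourings give the factors in a set `R` a colour of their own.
Inclusion–exclusion over `R` shows that only the cactus quotients in which no factor is *isolated*,
i.e. every factor shares a pad with another one, contribute to the centred moment
(`IsCactusType.centeredMoment_eq_zero`). No such quotient exists (`IsArrangement.exists_isIsolated`).
Two edges of a pad form a cut. Hence a pad cannot join a thin factor to a thick one, whose ends coincide
in a cactus, and a directed pad cannot join a forward factor to a backward one; so pads only join
factors of the same type. Among these links take one between two factors at minimal distance. A factor
strictly between them, of the other type, is linked to a factor outside, and the two pads cross, which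
is impossible since one of the two types is thin.
-/


namespace Traffic

/-! ### Connectivity inside a set of edges -/

/-- Walking along a sequence whose consecutive terms are equivalent. -/
theorem setoid_of_steps {α : Type*} (s : Setoid α) (u : ℕ → α) {i j : ℕ} (hij : i ≤ j)
    (h : ∀ k, i ≤ k → k < j → s (u k) (u (k + 1))) : s (u i) (u j) := by
  induction j, hij using Nat.le_induction with
  | base => exact s.refl _
  | succ j hij ih =>
    exact s.trans (ih fun k h₁ h₂ => h k h₁ (by omega)) (h j hij (by omega))

/-- Two positions of a cyclic sequence are equivalent if all steps on one of the two arcs between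
them are. -/
theorem setoid_of_arc {α : Type*} (s : Setoid α) {n : ℕ} (u : Fin (n + 1) → α)
    {v w : Fin (n + 1)} (hvw : v ≤ w)
    (h : (∀ k, v ≤ k → k < w → s (u k) (u (k + 1))) ∨
      (∀ k, k < v ∨ w ≤ k → s (u k) (u (k + 1)))) : s (u v) (u w) := by
  set x : ℕ → α := fun k => u (Fin.ofNat (n + 1) k) with hx
  have hxu : ∀ k : Fin (n + 1), x k.1 = u k := fun k => by simp [hx]
  have hstep : ∀ k (hk : k < n + 1), s (u ⟨k, hk⟩) (u (⟨k, hk⟩ + 1)) → s (x k) (x (k + 1)) := by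
    intro k hk h
    have e₁ : x k = u ⟨k, hk⟩ := hxu ⟨k, hk⟩
    have e₂ : x (k + 1) = u (⟨k, hk⟩ + 1) := by
      simp only [hx]
      congr 1
      ext
      simp [Fin.val_add]
    rw [e₁, e₂]; exact h
  have hwrap : x (n + 1) = x 0 := by simp [hx]
  have hvw' : v.1 ≤ w.1 := hvw
  have hw := w.2
  rw [← hxu v, ← hxu w]
  rcases h with h | h
  · exact setoid_of_steps s x hvw fun k h₁ h₂ => hstep k (by omega) (h _ h₁ h₂)
  · have a₁ : s (x w.1) (x (n + 1)) :=
      setoid_of_steps s x (by omega) fun k h₁ h₂ => hstep k (by omega) (h _ (.inr h₁))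
    have a₂ : s (x 0) (x v.1) :=
      setoid_of_steps s x (by omega) fun k h₁ h₂ => hstep k (by omega) (h _ (.inl h₂))
    rw [hwrap] at a₁
    exact s.symm (s.trans a₁ a₂)

/-- A cyclic sequence in which consecutive terms are equivalent except possibly at the steps `j` and
`l` falls into the two arcs `(j, l]` and `(l, j]`. For `j = l` the second arc is everything. -/
theorem setoid_of_cyclic_steps {α : Type*} (s : Setoid α) {n : ℕ} (u : Fin (n + 1) → α)
    {j l : Fin (n + 1)} (hjl : j ≤ l) (h : ∀ k, k ≠ j → k ≠ l → s (u k) (u (k + 1))) :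
    (∀ k, j < k → k ≤ l → s (u k) (u l)) ∧ (∀ k, k ≤ j ∨ l < k → s (u k) (u j)) := by
  refine ⟨fun k h₁ h₂ => setoid_of_arc s u h₂ (.inl fun i hi hi' =>
    h i (h₁.trans_le hi).ne' hi'.ne), fun k hk => ?_⟩
  rcases hk with hk | hk
  · exact setoid_of_arc s u hk (.inl fun i _ hi' => h i hi'.ne (hi'.trans_le hjl).ne)
  · refine s.symm (setoid_of_arc s u (hjl.trans hk.le) (.inr fun i hi => ?_))
    rcases hi with hi | hi
    · exact h i hi.ne (hi.trans_le hjl).ne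
    · exact h i (hjl.trans_lt (hk.trans_le hi)).ne' (hk.trans_le hi).ne'

/-- A cyclic sequence in which consecutive terms are equivalent, except possibly at one step, lies in
one class. -/
theorem setoid_of_cyclic_steps_ne {α : Type*} (s : Setoid α) {n : ℕ} (u : Fin (n + 1) → α)
    (j : Fin (n + 1)) (h : ∀ k, k ≠ j → s (u k) (u (k + 1))) (k l : Fin (n + 1)) :
    s (u k) (u l) := by
  have key := (setoid_of_cyclic_steps s u (le_refl j) fun k hk _ => h k hk).2
  exact s.trans (key k (le_or_gt k j)) (s.symm (key l (le_or_gt l j)))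

/-- The directed arc from `i + 1` to `j`. -/
theorem setoid_of_cyclic_arc {α : Type*} (s : Setoid α) {n : ℕ} (u : Fin (n + 1) → α)
    {i j : Fin (n + 1)} (hij : i ≠ j) (h : ∀ k, k ≠ i → k ≠ j → s (u k) (u (k + 1))) :
    s (u (i + 1)) (u j) := by
  have hv : ∀ h : i.1 < n, (i + 1).1 = i.1 + 1 := fun h => by
    rw [Fin.val_add_one_of_lt' (by simpa using h)]
  rcases lt_or_gt_of_ne hij with hlt | hlt
  · have hlt' : i.1 < j.1 := hlt
    have := hv (by omega)
    exact (setoid_of_cyclic_steps s u hlt.le h).1 (i + 1)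
      (by rw [Fin.lt_def]; omega) (by rw [Fin.le_def]; omega)
  · refine (setoid_of_cyclic_steps s u hlt.le fun k h₁ h₂ => h k h₂ h₁).2 (i + 1) ?_
    rcases (Nat.lt_succ_iff.1 i.2).lt_or_eq with hi | hi
    · right
      rw [Fin.lt_def, hv hi]; omega
    · left
      have : i + 1 = 0 := by
        have : i = Fin.last n := Fin.ext hi
        rw [this]; simp
      rw [this]; exact Fin.zero_le _

theorem fin_cyclic_induction {n : ℕ} {P : Fin (n + 1) → Prop} (i : Fin (n + 1)) (hi : P i)
    (h : ∀ k, P k → P (k + 1)) (j : Fin (n + 1)) : P j := by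
  have key : ∀ m : ℕ, P (i + Fin.ofNat (n + 1) m) := by
    intro m
    induction m with
    | zero => simpa using hi
    | succ m ih =>
      have : i + Fin.ofNat (n + 1) (m + 1) = i + Fin.ofNat (n + 1) m + 1 := by
        rw [add_assoc]
        congr 1
        ext
        simp [Fin.val_add]
      rw [this]; exact h _ ih
  have := key (j - i).1
  simpa using this

namespace Multidigraph

variable {V E : Type} (G : Multidigraph V E)

/-- The partition of the vertices into the components of the graph whose edges are those in `F`. -/
def conn (F : Set E) : Setoid V :=
  Relation.EqvGen.setoid fun v w => ∃ e ∈ F, G.src e = v ∧ G.tgt e = w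

variable {G}

theorem conn_of_mem {F : Set E} {e : E} (he : e ∈ F) : G.conn F (G.src e) (G.tgt e) :=
  .rel _ _ ⟨e, he, rfl, rfl⟩

theorem conn_le {F : Set E} {s : Setoid V} (h : ∀ e ∈ F, s (G.src e) (G.tgt e)) :
    G.conn F ≤ s := by
  refine Setoid.eqvGen_le ?_
  rintro _ _ ⟨e, he, rfl, rfl⟩
  exact h e he

theorem conn_mono {F F' : Set E} (h : F ⊆ F') : G.conn F ≤ G.conn F' :=
  conn_le fun _ he => conn_of_mem (h he)

theorem Connected.conn_univ (h : G.Connected) (v w : V) : G.conn Set.univ v w := by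
  have h' := h.2 v w
  refine eqvGen_map (s := fun v w => ∃ e ∈ Set.univ, G.src e = v ∧ G.tgt e = w) id ?_ h'
  rintro _ _ ⟨e, rfl, rfl⟩
  exact .rel _ _ ⟨e, trivial, rfl, rfl⟩

theorem connected_of_conn_univ [Nonempty V] (h : ∀ v w, G.conn Set.univ v w) : G.Connected := by
  refine ⟨inferInstance, fun v w => eqvGen_map id ?_ (h v w)⟩
  rintro _ _ ⟨e, -, rfl, rfl⟩
  exact .rel _ _ ⟨e, rfl, rfl⟩

/-- Connectivity is transported along graph morphisms. -/
theorem conn_map {V' E' : Type} {G' : Multidigraph V' E'} {F : Set E} {F' : Set E'} (f : V → V')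
    (h : ∀ e ∈ F, G'.conn F' (f (G.src e)) (f (G.tgt e))) {v w : V} (hvw : G.conn F v w) :
    G'.conn F' (f v) (f w) := by
  have : G.conn F ≤ Setoid.comap f (G'.conn F') := conn_le h
  exact this hvw

theorem Connected.induct (h : G.Connected) (P : V → Prop)
    (hP : ∀ e, P (G.src e) ↔ P (G.tgt e)) {v : V} (hv : P v) (w : V) : P w := by
  have : G.conn Set.univ ≤ Setoid.ker P := conn_le fun e _ => propext (hP e)
  have h' : P v = P w := this (h.conn_univ v w)
  rwa [← h']

theorem src_mem_sym2 {e : E} {v w : V} (h : s(G.src e, G.tgt e) = s(v, w)) {s : Setoid V}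
    (hs : s (G.src e) (G.tgt e)) : s v w := by
  rcases Sym2.eq_iff.1 h with ⟨rfl, rfl⟩ | ⟨rfl, rfl⟩
  · exact hs
  · exact s.symm hs

theorem src_mem_sym2' {e : E} {v w : V} (h : s(G.src e, G.tgt e) = s(v, w)) {s : Setoid V}
    (hs : s v w) : s (G.src e) (G.tgt e) := by
  rcases Sym2.eq_iff.1 h with ⟨rfl, rfl⟩ | ⟨rfl, rfl⟩
  · exact hs
  · exact s.symm hs

/-- Any two vertices of a simple cycle are joined along the cycle avoiding a given edge. -/
theorem IsSimpleCycle.conn {C : Set E} (hC : G.IsSimpleCycle C) (e : E) {v w : V}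
    (hv : G.Visits C v) (hw : G.Visits C w) : G.conn (C \ {e}) v w := by
  obtain ⟨n, x, f, hx, hf, hxf, rfl⟩ := hC
  have hvis : ∀ {v}, G.Visits (Set.range f) v → ∃ i, v = x i := by
    rintro v ⟨_, ⟨i, rfl⟩, h⟩
    rcases Sym2.eq_iff.1 (hxf i) with h' | h' <;> rcases h with rfl | rfl
    exacts [⟨_, h'.1⟩, ⟨_, h'.2⟩, ⟨_, h'.1⟩, ⟨_, h'.2⟩]
  obtain ⟨i, rfl⟩ := hvis hv
  obtain ⟨j, rfl⟩ := hvis hw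
  have step : ∀ k, f k ≠ e → G.conn (Set.range f \ {e}) (x k) (x (k + 1)) := fun k hk =>
    src_mem_sym2 (hxf k) (conn_of_mem ⟨⟨k, rfl⟩, hk⟩)
  by_cases he : ∃ k, f k = e
  · obtain ⟨k, rfl⟩ := he
    exact setoid_of_cyclic_steps_ne _ x k (fun l hl => step l fun h => hl (hf h)) i j
  · push Not at he
    exact setoid_of_cyclic_steps_ne _ x 0 (fun l hl => step l (he l)) i j

theorem visits_src {C : Set E} {e : E} (he : e ∈ C) : G.Visits C (G.src e) := ⟨e, he, .inl rfl⟩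

/-- Following a directed cycle from the end of `e` to the start of `e'` uses neither `e` nor `e'`. -/
theorem IsDirectedCycle.conn {C : Set E} (hC : G.IsDirectedCycle C) {e e' : E} (he : e ∈ C)
    (he' : e' ∈ C) (hne : e ≠ e') : G.conn {e, e'}ᶜ (G.tgt e) (G.src e') := by
  obtain ⟨n, x, f, hx, hf, hxf, rfl⟩ := hC
  obtain ⟨i, rfl⟩ := he
  obtain ⟨j, rfl⟩ := he'
  rw [(hxf i).2, (hxf j).1]
  refine setoid_of_cyclic_arc _ x (fun h => hne (by rw [h])) fun k hi hj => ?_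
  have : f k ∈ ({f i, f j} : Set E)ᶜ := by
    simp only [Set.mem_compl_iff, Set.mem_insert_iff, Set.mem_singleton_iff, not_or]
    exact ⟨fun h => hi (hf h), fun h => hj (hf h)⟩
  have h := conn_of_mem (G := G) this
  rwa [(hxf k).1, (hxf k).2] at h

/-- An edge whose endpoints are joined through edges of `F` closes up to a simple cycle. -/
theorem exists_simpleCycle {F : Set E} {e : E} (he : e ∉ F)
    (h : G.conn F (G.src e) (G.tgt e)) : ∃ C, G.IsSimpleCycle C ∧ e ∈ C ∧ C ⊆ insert e F := by
  classical
  let S : SimpleGraph V := SimpleGraph.fromRel fun v w => ∃ f ∈ F, G.src f = v ∧ G.tgt f = w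
  have hS : G.conn F ≤ S.reachableSetoid := by
    refine conn_le fun f hf => ?_
    by_cases hl : G.src f = G.tgt f
    · rw [hl]
    · exact SimpleGraph.Adj.reachable ⟨hl, .inl ⟨f, hf, rfl, rfl⟩⟩
  obtain ⟨p, hp⟩ := (hS h : S.Reachable _ _).exists_isPath
  have hedge : ∀ i : Fin p.length, ∃ f ∈ F,
      s(G.src f, G.tgt f) = s(p.getVert i, p.getVert (i + 1)) := by
    intro i
    obtain ⟨-, ⟨f, hf, h₁, h₂⟩ | ⟨f, hf, h₁, h₂⟩⟩ := p.adj_getVert_succ i.2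
    · exact ⟨f, hf, by rw [h₁, h₂]⟩
    · exact ⟨f, hf, by rw [h₁, h₂, Sym2.eq_swap]⟩
  choose f hfF hf using hedge
  have hinj : ∀ i j : ℕ, i ≤ p.length → j ≤ p.length → p.getVert i = p.getVert j → i = j :=
    fun i j hi hj h => hp.getVert_injOn hi hj h
  refine ⟨Set.range (Fin.snoc (α := fun _ => E) f e : Fin (p.length + 1) → E),
    ⟨p.length, fun i => p.getVert i, Fin.snoc (α := fun _ => E) f e, ?_, ?_, ?_, rfl⟩,
    ⟨Fin.last _, by simp⟩, ?_⟩
  · intro i j hij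
    exact Fin.ext (hinj _ _ (by omega) (by omega) hij)
  · intro i j
    induction i using Fin.lastCases with
    | last =>
      induction j using Fin.lastCases with
      | last => simp
      | cast j =>
        simp only [Fin.snoc_last, Fin.snoc_castSucc]
        intro h
        exact absurd (h ▸ hfF j) he
    | cast i =>
      induction j using Fin.lastCases with
      | last =>
        simp only [Fin.snoc_last, Fin.snoc_castSucc]
        intro h
        exact absurd (h ▸ hfF i) he
      | cast j =>
        simp only [Fin.snoc_castSucc]
        intro h
        have h' := hf i
        rw [h, hf j] at h'
        have := i.2
        have := j.2
        congr 1
        apply Fin.ext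
        rcases Sym2.eq_iff.1 h' with ⟨h₁, -⟩ | ⟨h₁, h₂⟩
        · exact (hinj _ _ (by omega) (by omega) h₁).symm
        · have a := hinj _ _ (by omega) (by omega) h₁
          have b := hinj _ _ (by omega) (by omega) h₂
          omega
  · intro i
    induction i using Fin.lastCases with
    | last => simp [Sym2.eq_swap]
    | cast i =>
      simp only [Fin.snoc_castSucc, hf, Fin.val_castSucc]
      rw [Fin.coeSucc_eq_succ]
      simp
  · rintro _ ⟨i, rfl⟩
    induction i using Fin.lastCases with
    | last => simp
    | cast i => simp [hfF]

/-- Either `x` is joined to `v` without using edges at `u`, or some edge leaves `u` towards a vertex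
that is. -/
theorem exists_first_edge (u v : V) (huv : u ≠ v) (h : G.Connected) :
    ∃ e u₁, s(G.src e, G.tgt e) = s(u, u₁) ∧ u ≠ u₁ ∧
      G.conn {f | G.src f ≠ u ∧ G.tgt f ≠ u} u₁ v := by
  by_contra hcon
  push Not at hcon
  -- The component of `v` away from `u` would be closed under all edges.
  have hu : ∀ x, G.conn {f | G.src f ≠ u ∧ G.tgt f ≠ u} u x → u = x := by
    intro x hx
    have : G.conn {f | G.src f ≠ u ∧ G.tgt f ≠ u} ≤ Setoid.ker (fun y => u = y) := by
      refine conn_le fun f hf => ?_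
      simp only [Setoid.ker_def, eq_iff_iff]
      exact ⟨fun h => absurd h.symm hf.1, fun h => absurd h.symm hf.2⟩
    have h' : (u = u) = (u = x) := this hx
    rw [← h']
  have := h.induct (fun x => G.conn {f | G.src f ≠ u ∧ G.tgt f ≠ u} x v) ?_
    (Setoid.refl' _ v) u
  · exact huv (hu v this)
  · intro e
    by_cases h₁ : G.src e = u
    · by_cases h₂ : G.tgt e = u
      · rw [h₁, h₂]
      · constructor
        · intro hc
          rw [h₁] at hc
          exact absurd (hu _ hc) huv
        · intro hc
          exact absurd hc (hcon e (G.tgt e) (by rw [h₁]) (Ne.symm h₂))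
    · by_cases h₂ : G.tgt e = u
      · constructor
        · intro hc
          exact absurd hc (hcon e (G.src e) (by rw [h₂, Sym2.eq_swap]) (Ne.symm h₁))
        · intro hc
          rw [h₂] at hc
          exact absurd (hu _ hc) huv
      · have hst : G.conn {f | G.src f ≠ u ∧ G.tgt f ≠ u} (G.src e) (G.tgt e) :=
          conn_of_mem ⟨h₁, h₂⟩
        exact ⟨fun hc => Setoid.trans' _ (Setoid.symm' _ hst) hc, fun hc => Setoid.trans' _ hst hc⟩

end Multidigraph

namespace ConnGraph

open Multidigraph

variable {V E : Type} {G : ConnGraph V E}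

theorem IsCactus.eq (h : G.IsCactus) {C C' : Set E} (hC : G.IsSimpleCycle C)
    (hC' : G.IsSimpleCycle C') {e : E} (he : e ∈ C) (he' : e ∈ C') : C = C' :=
  (h e).unique ⟨hC, he⟩ ⟨hC', he'⟩

/-- In a cactus, two edges of the same pad form a cut that separates the endpoints of either. -/
theorem IsCactus.not_conn (h : G.IsCactus) {C : Set E} (hC : G.IsSimpleCycle C) {e e' : E}
    (he : e ∈ C) (he' : e' ∈ C) (hne : e ≠ e') : ¬ G.conn {e, e'}ᶜ (G.src e) (G.tgt e) := by
  intro hcon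
  obtain ⟨C', hC', heC', hsub⟩ := exists_simpleCycle (by simp) hcon
  have : e' ∈ C' := h.eq hC hC' he heC' ▸ he'
  rcases hsub this with h | h
  · exact hne h.symm
  · exact h (by simp)

/-- In a cactus, two distinct vertices are separated by two edges of some pad. -/
theorem IsCactus.exists_cut (h : G.IsCactus) {u v : V} (huv : u ≠ v) :
    ∃ C, G.IsSimpleCycle C ∧ ∃ e ∈ C, ∃ e' ∈ C, e ≠ e' ∧ ¬ G.conn {e, e'}ᶜ u v := by
  obtain ⟨e, u₁, he, hu₁, hc⟩ := exists_first_edge u v huv G.connected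
  obtain ⟨C, ⟨hC, heC⟩, -⟩ := h e
  -- The other edge of the pad at `u`.
  have hvu : G.Visits C u := by
    rcases Sym2.eq_iff.1 he with h | h
    exacts [⟨e, heC, .inl h.1⟩, ⟨e, heC, .inr h.2⟩]
  have hvu₁ : G.Visits C u₁ := by
    rcases Sym2.eq_iff.1 he with h | h
    exacts [⟨e, heC, .inr h.2⟩, ⟨e, heC, .inl h.1⟩]
  have hcon := hC.conn e hvu hvu₁
  obtain ⟨e', he'C, hne, he'u⟩ : ∃ e' ∈ C, e ≠ e' ∧ (G.src e' = u ∨ G.tgt e' = u) := by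
    by_contra hno
    push Not at hno
    have : G.conn (C \ {e}) ≤ Setoid.ker (fun y => u = y) := by
      refine conn_le fun f hf => ?_
      have := hno f hf.1 (fun h => hf.2 h.symm)
      simp only [Setoid.ker_def, eq_iff_iff]
      exact ⟨fun h => absurd h.symm this.1, fun h => absurd h.symm this.2⟩
    have h' : (u = u) = (u = u₁) := this hcon
    exact hu₁ (by rw [← h'])
  refine ⟨C, hC, e, heC, e', he'C, hne, fun hcut => ?_⟩
  refine h.not_conn hC heC he'C hne (src_mem_sym2' he (Setoid.trans' _ hcut ?_))
  refine Setoid.symm' _ (conn_mono ?_ hc)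
  rintro f ⟨hf₁, hf₂⟩ (rfl | rfl)
  · rcases Sym2.eq_iff.1 he with h | h
    exacts [hf₁ h.1, hf₂ h.2]
  · rcases he'u with h | h
    exacts [hf₁ h, hf₂ h]

end ConnGraph

/-! ### Quotients that split along a colouring of the edges -/

namespace ConnGraph

open Multidigraph

variable {V E Q : Type} (G : ConnGraph V E) (c : E → Q)

/-- The partition of the vertices obtained by contracting all edges that do not have the colour
`q`. -/
def offColor (q : Q) : Setoid V := G.conn {e | c e ≠ q}

/-- The coloured graph is a tree of its colour classes, after the contraction common to all
colours: seen from the colour `q`, the whole colour class `p` hangs at one vertex, and conversely. -/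
def IsTreeLike : Prop :=
  ∀ p q, p ≠ q → ∃ x y, ∀ v, G.offColor c q v x ∨ G.offColor c p v y

/-- The edges of colour `q`, on the vertices of a quotient in which all other edges are
contracted. -/
def piece (q : Q) (π : Setoid V) (h : G.offColor c q ≤ π) :
    ConnGraph (Quotient π) {e // c e = q} where
  src e := Quotient.mk π (G.src e.1)
  tgt e := Quotient.mk π (G.tgt e.1)
  connected := by
    obtain ⟨v₀⟩ := G.connected.1
    have : Nonempty (Quotient π) := ⟨Quotient.mk π v₀⟩
    refine connected_of_conn_univ fun v w => ?_
    induction v using Quotient.inductionOn with | _ v => ?_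
    induction w using Quotient.inductionOn with | _ w => ?_
    refine conn_map (Quotient.mk π) (fun e _ => ?_) (G.connected.conn_univ v w)
    by_cases he : c e = q
    · exact conn_of_mem (F := Set.univ) (e := (⟨e, he⟩ : {e // c e = q})) trivial
    · have : Quotient.mk π (G.src e) = Quotient.mk π (G.tgt e) :=
        Quotient.sound (h (conn_of_mem he))
      rw [this]

variable {G c} {f : Q → Setoid V}

theorem iInf_setoid {α ι : Type*} {f : ι → Setoid α} {u v : α} :
    (⨅ q, f q) u v ↔ ∀ q, f q u v := by
  rw [iInf, Setoid.sInf_iff]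
  simp

theorem iInf_iff_of_color (hf : ∀ q, G.offColor c q ≤ f q) (e : E) :
    (⨅ q, f q) (G.src e) (G.tgt e) ↔ f (c e) (G.src e) (G.tgt e) := by
  rw [iInf_setoid]
  refine ⟨fun h => h _, fun h p => ?_⟩
  by_cases hp : c e = p
  · exact hp ▸ h
  · exact hf p (conn_of_mem hp)

/-- `z` is an endpoint of an edge of colour `q` that is not contracted by `π`. -/
def IsProperEnd (G : ConnGraph V E) (c : E → Q) (π : Setoid V) (q : Q) (z : V) : Prop :=
  ∃ e, c e = q ∧ ¬ π (G.src e) (G.tgt e) ∧ (G.src e = z ∨ G.tgt e = z)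

/-- The uncontracted edges of colour `q` all have the same position with respect to the other
colours. Their endpoints are therefore determined by their class for the colour `q`. -/
theorem IsTreeLike.eq_of_isProperEnd (hW : G.IsTreeLike c) (hf : ∀ q, G.offColor c q ≤ f q) {q : Q}
    {z z' : V} (hz : IsProperEnd G c (f q) q z) (hz' : IsProperEnd G c (f q) q z')
    (h : f q z z') : (⨅ q, f q) z z' := by
  rw [iInf_setoid]
  intro p
  by_cases hp : p = q
  · exact hp ▸ h
  obtain ⟨x, y, hxy⟩ := hW p q hp
  have key : ∀ z, IsProperEnd G c (f q) q z → G.offColor c p z y := by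
    rintro z ⟨e, rfl, hne, hz⟩
    have hst : G.offColor c p (G.src e) (G.tgt e) := conn_of_mem (Ne.symm hp)
    have hs : G.offColor c p (G.src e) y := by
      rcases hxy (G.src e) with h₁ | h₁
      · rcases hxy (G.tgt e) with h₂ | h₂
        · exact absurd (hf _ (Setoid.trans' _ h₁ (Setoid.symm' _ h₂))) hne
        · exact Setoid.trans' _ hst h₂
      · exact h₁
    rcases hz with rfl | rfl
    · exact hs
    · exact Setoid.trans' _ (Setoid.symm' _ hst) hs
  exact hf p (Setoid.trans' _ (key z hz) (Setoid.symm' _ (key z' hz')))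

/-- For a tree-like colouring, the traces on the colour classes can be recovered from the
intersection of the chosen partitions: every vertex can be moved, within its class and along edges of
other colours, to an uncontracted edge of colour `q`. -/
theorem IsTreeLike.iInf_sup (hW : G.IsTreeLike c) (hf : ∀ q, G.offColor c q ≤ f q) (q : Q) :
    (⨅ q, f q) ⊔ G.offColor c q = f q := by
  refine le_antisymm (sup_le (iInf_le _ _) (hf q)) ?_
  set s := (⨅ q, f q) ⊔ G.offColor c q with hs
  have hs₁ : (⨅ q, f q) ≤ s := le_sup_left
  have hs₂ : G.offColor c q ≤ s := le_sup_right
  have hsf : s ≤ f q := sup_le (iInf_le _ _) (hf q)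
  have hedge : ∀ e, ¬ IsProperEnd G c (f q) q (G.src e) ∨ ¬ IsProperEnd G c (f q) q (G.tgt e) →
      s (G.src e) (G.tgt e) := by
    intro e he
    by_cases hc : c e = q
    · refine hs₁ ((iInf_iff_of_color hf e).2 ?_)
      by_contra hne
      rw [hc] at hne
      rcases he with he | he
      · exact he ⟨e, hc, hne, .inl rfl⟩
      · exact he ⟨e, hc, hne, .inr rfl⟩
    · exact hs₂ (conn_of_mem hc)
  by_cases hex : ∃ z, IsProperEnd G c (f q) q z
  · obtain ⟨z₀, hz₀⟩ := hex
    have hall : ∀ u, ∃ z, IsProperEnd G c (f q) q z ∧ s u z := by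
      refine G.connected.induct _ (fun e => ?_) ⟨z₀, hz₀, Setoid.refl' _ _⟩
      by_cases he : IsProperEnd G c (f q) q (G.src e) ∧ IsProperEnd G c (f q) q (G.tgt e)
      · exact ⟨fun _ => ⟨_, he.2, Setoid.refl' _ _⟩, fun _ => ⟨_, he.1, Setoid.refl' _ _⟩⟩
      · have := hedge e (not_and_or.1 he)
        exact ⟨fun ⟨z, hz, h⟩ => ⟨z, hz, Setoid.trans' _ (Setoid.symm' _ this) h⟩,
          fun ⟨z, hz, h⟩ => ⟨z, hz, Setoid.trans' _ this h⟩⟩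
    intro u v huv
    obtain ⟨z, hz, hu⟩ := hall u
    obtain ⟨z', hz', hv⟩ := hall v
    have hzz : f q z z' :=
      Setoid.trans' _ (Setoid.symm' _ (hsf hu)) (Setoid.trans' _ huv (hsf hv))
    exact Setoid.trans' _ hu (Setoid.trans' _ (hs₁ (hW.eq_of_isProperEnd hf hz hz' hzz))
      (Setoid.symm' _ hv))
  · push Not at hex
    intro u v _
    have : G.conn Set.univ ≤ s := conn_le fun e _ => hedge e (.inl (hex _))
    exact this (G.connected.conn_univ u v)

variable (G c) in
/-- A partition splits along the colouring if it is determined by its traces on the colour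
classes. -/
def Splits (π : Setoid V) : Prop := π = ⨅ q, π ⊔ G.offColor c q

/-- For a tree-like colouring, partitions that split correspond to independent choices of
partitions for the colours. -/
def IsTreeLike.splitEquiv (hW : G.IsTreeLike c) :
    {π : Setoid V // G.Splits c π} ≃ (∀ q, {π : Setoid V // G.offColor c q ≤ π}) where
  toFun π q := ⟨π.1 ⊔ G.offColor c q, le_sup_right⟩
  invFun f := ⟨⨅ q, (f q).1, by
    unfold Splits
    congr 1
    funext q
    exact (hW.iInf_sup (f := fun q => (f q).1) (fun q => (f q).2) q).symm⟩
  left_inv π := Subtype.ext π.2.symm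
  right_inv f := by
    funext q
    exact Subtype.ext (hW.iInf_sup (f := fun q => (f q).1) (fun q => (f q).2) q)

/-- If the simple cycles of a cactus `G^π` are monochromatic, then `π` splits. -/
theorem splits_of_isCactus {π : Setoid V} (hG : (G.quotient π).IsCactus)
    (hmono : ∀ C, (G.quotient π).IsSimpleCycle C → ∀ e ∈ C, ∀ e' ∈ C, c e = c e') :
    G.Splits c π := by
  refine le_antisymm (le_iInf fun q => le_sup_left) ?_
  intro u v huv
  rw [iInf_setoid] at huv
  by_contra hne
  have hne' : Quotient.mk π u ≠ Quotient.mk π v := fun h => hne (Quotient.exact h)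
  obtain ⟨C, hC, e, he, e', he', -, hcut⟩ := hG.exists_cut hne'
  have hle : π ⊔ G.offColor c (c e) ≤
      Setoid.comap (Quotient.mk π) ((G.quotient π).conn {e, e'}ᶜ) := by
    refine sup_le (fun a b hab => ?_) (conn_le fun d hd => ?_)
    · have : Quotient.mk π a = Quotient.mk π b := Quotient.sound hab
      rw [Setoid.comap_rel, this]
    · refine conn_of_mem (G := (G.quotient π).toMultidigraph) (e := d) ?_
      rintro (rfl | rfl)
      · exact hd rfl
      · exact hd (hmono C hC _ he' _ he)
  exact hcut (hle (huv (c e)))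

theorem mk_eq_iff {π : Setoid V} {u v : V} : Quotient.mk π u = Quotient.mk π v ↔ π u v :=
  Quotient.eq

theorem endpoint_lift {π : Setoid V} {e : E} {x y : Quotient π}
    (h : s((G.quotient π).src e, (G.quotient π).tgt e) = s(x, y)) :
    ∃ u v, s(G.src e, G.tgt e) = s(u, v) ∧ Quotient.mk π u = x ∧ Quotient.mk π v = y := by
  rcases Sym2.eq_iff.1 h with h | h
  · exact ⟨_, _, rfl, h.1, h.2⟩
  · exact ⟨_, _, Sym2.eq_swap, h.2, h.1⟩

theorem isProperEnd_of_sym2 {π : Setoid V} {q : Q} {e : E} {u v : V} (hc : c e = q)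
    (h : s(G.src e, G.tgt e) = s(u, v)) (hne : ¬ π u v) :
    IsProperEnd G c π q u ∧ IsProperEnd G c π q v := by
  have hne' : ¬ π (G.src e) (G.tgt e) := fun h' => hne (src_mem_sym2 h h')
  rcases Sym2.eq_iff.1 h with ⟨h₁, h₂⟩ | ⟨h₁, h₂⟩
  · exact ⟨⟨e, hc, hne', .inl h₁⟩, ⟨e, hc, hne', .inr h₂⟩⟩
  · exact ⟨⟨e, hc, hne', .inr h₂⟩, ⟨e, hc, hne', .inl h₁⟩⟩

/-- If `π` splits along a tree-like colouring, then the simple cycles of `G^π` are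
monochromatic. -/
theorem IsTreeLike.color_eq (hW : G.IsTreeLike c) (hf : ∀ q, G.offColor c q ≤ f q) {C : Set E}
    (hC : (G.quotient (⨅ q, f q)).IsSimpleCycle C) {e e' : E} (he : e ∈ C) (he' : e' ∈ C) :
    c e = c e' := by
  obtain ⟨n, x, g, hx, hg, hxg, rfl⟩ := hC
  obtain ⟨i₀, rfl⟩ := he
  obtain ⟨j₀, rfl⟩ := he'
  by_contra hne
  set q := c (g i₀) with hq
  have hn : ∀ i : Fin (n + 1), i + 1 ≠ i := by
    intro i hi
    have h1 : (1 : Fin (n + 1)) = 0 := by simpa using hi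
    have h0 : n = 0 := by simpa using h1
    subst h0
    exact hne (by rw [hq, show i₀ = j₀ from Fin.ext (by omega)])
  have hloop : ∀ i, ¬ (⨅ q, f q) (G.src (g i)) (G.tgt (g i)) := by
    intro i h
    have h' : s(x i, x i) = s(x i, x (i + 1)) := by
      rw [← hxg i]
      obtain ⟨u, v, h₁, h₂, h₃⟩ := endpoint_lift (hxg i)
      rw [hxg i, ← h₂, ← h₃, mk_eq_iff.2 (src_mem_sym2 h₁ h)]
    rcases Sym2.eq_iff.1 h' with ⟨-, h⟩ | ⟨h, -⟩
    · exact hn i (hx h).symm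
    · exact hn i (hx h).symm
  -- The partition `f q`, on the vertices of the quotient.
  let t : Setoid (Quotient (⨅ q, f q)) :=
    Setoid.ker (Quotient.map' (s₂ := f q) id fun a b h => iInf_setoid.1 h q)
  have ht : ∀ u v, t (Quotient.mk _ u) (Quotient.mk _ v) ↔ f q u v := fun u v => by
    simp only [t, Setoid.ker_def]
    exact Quotient.eq
  have hend : ∀ i, c (g i) = q → ∃ u v, Quotient.mk _ u = x i ∧ Quotient.mk _ v = x (i + 1) ∧
      IsProperEnd G c (f q) q u ∧ IsProperEnd G c (f q) q v := by
    intro i hi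
    obtain ⟨u, v, h₁, h₂, h₃⟩ := endpoint_lift (hxg i)
    have hl := hloop i
    rw [iInf_iff_of_color hf, hi] at hl
    have := isProperEnd_of_sym2 hi h₁ fun h => hl (src_mem_sym2' h₁ h)
    exact ⟨u, v, h₂, h₃, this.1, this.2⟩
  obtain ⟨i, hi, hi'⟩ : ∃ i, c (g i) = q ∧ c (g (i + 1)) ≠ q := by
    by_contra hcon
    push Not at hcon
    exact hne (fin_cyclic_induction (P := fun i => c (g i) = q) i₀ rfl hcon j₀).symm
  -- Following the cycle from the end of `g i` to the next edge of colour `q` does not change the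
  -- class for `f q`, so one comes back to the same vertex.
  refine (fin_cyclic_induction (P := fun j => c (g j) ≠ q ∧ t (x (i + 1)) (x j)) (i + 1)
    ⟨hi', Setoid.refl' _ _⟩ (fun j hj => ?_) i).1 hi
  have hstep : t (x (i + 1)) (x (j + 1)) := by
    refine Setoid.trans' _ hj.2 ?_
    obtain ⟨u, v, h₁, h₂, h₃⟩ := endpoint_lift (hxg j)
    rw [← h₂, ← h₃, ht]
    exact src_mem_sym2 h₁ (hf q (conn_of_mem hj.1))
  refine ⟨fun hc => ?_, hstep⟩
  obtain ⟨-, v, -, h₂, -, h₄⟩ := hend i hi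
  obtain ⟨u, -, h₅, -, h₆, -⟩ := hend (j + 1) hc
  have huv : x (i + 1) = x (j + 1) := by
    rw [← h₂, ← h₅] at hstep ⊢
    exact mk_eq_iff.2 (hW.eq_of_isProperEnd hf h₄ h₆ ((ht _ _).1 hstep))
  exact hi' (by rw [hx huv]; exact hc)

/-- The map from `G^π` to the quotient for the colour `q` is injective on the vertices of a
simple cycle of colour `q`. -/
theorem IsTreeLike.injOn_cycle (hW : G.IsTreeLike c) (hf : ∀ q, G.offColor c q ≤ f q) {q : Q}
    {n : ℕ} {x : Fin (n + 1) → Quotient (⨅ q, f q)} {g : Fin (n + 1) → E}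
    (hx : Function.Injective x)
    (hxg : ∀ i, s((G.quotient (⨅ q, f q)).src (g i), (G.quotient (⨅ q, f q)).tgt (g i)) =
      s(x i, x (i + 1))) (hg : ∀ i, c (g i) = q) :
    Function.Injective fun i =>
      Quotient.map' (s₂ := f q) id (fun _ _ h => iInf_setoid.1 h q) (x i) := by
  intro i j hij
  rcases Nat.eq_zero_or_pos n with rfl | hn
  · exact Fin.ext (by omega)
  have hend : ∀ i, ∃ u, Quotient.mk _ u = x i ∧ IsProperEnd G c (f q) q u := by
    intro i
    obtain ⟨u, v, h₁, h₂, h₃⟩ := endpoint_lift (hxg i)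
    refine ⟨u, h₂, (isProperEnd_of_sym2 (hg i) h₁ fun h => ?_).1⟩
    have h' : (⨅ q, f q) u v := by
      refine src_mem_sym2 h₁ ((iInf_iff_of_color hf _).2 ?_)
      rw [hg i]
      exact src_mem_sym2' h₁ h
    have : x i = x (i + 1) := by rw [← h₂, ← h₃]; exact mk_eq_iff.2 h'
    have h1 : (1 : Fin (n + 1)) = 0 := by simpa using (hx this).symm
    have h0 : n = 0 := by simpa using h1
    omega
  obtain ⟨u, hu, hu'⟩ := hend i
  obtain ⟨v, hv, hv'⟩ := hend j
  apply hx
  simp only [← hu, ← hv] at hij ⊢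
  exact mk_eq_iff.2 (hW.eq_of_isProperEnd hf hu' hv' (Quotient.exact hij))

/-- The simple cycles of a piece are the simple cycles of `G^π` of the corresponding colour. -/
theorem IsTreeLike.isSimpleCycle_piece_iff (hW : G.IsTreeLike c)
    (hf : ∀ q, G.offColor c q ≤ f q) {q : Q} {C : Set {e // c e = q}} :
    (G.piece c q (f q) (hf q)).IsSimpleCycle C ↔
      (G.quotient (⨅ q, f q)).IsSimpleCycle (Subtype.val '' C) := by
  constructor
  · rintro ⟨n, x, g, hx, hg, hxg, rfl⟩
    have hlift : ∀ i, ∃ u v, s(G.src (g i).1, G.tgt (g i).1) = s(u, v) ∧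
        Quotient.mk (f q) u = x i ∧ Quotient.mk (f q) v = x (i + 1) := by
      intro i
      exact endpoint_lift (G := G) (hxg i)
    choose u v huv hu hv using hlift
    refine ⟨n, fun i => Quotient.mk _ (u i), fun i => (g i).1, ?_,
      Subtype.val_injective.comp hg, fun i => ?_, (Set.range_comp _ _)⟩
    · intro i j hij
      apply hx
      rw [← hu, ← hu]
      exact mk_eq_iff.2 (iInf_setoid.1 (mk_eq_iff.1 hij) q)
    · have h₁ : s((G.quotient (⨅ q, f q)).src (g i).1, (G.quotient (⨅ q, f q)).tgt (g i).1) =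
          s(Quotient.mk _ (u i), Quotient.mk _ (v i)) := by
        rcases Sym2.eq_iff.1 (huv i) with ⟨h₁, h₂⟩ | ⟨h₁, h₂⟩
        · simp [quotient, h₁, h₂]
        · simp [quotient, h₁, h₂, Sym2.eq_swap]
      rw [h₁]
      have h₂ : Quotient.mk (⨅ q, f q) (v i) = Quotient.mk _ (u (i + 1)) := by
        rw [mk_eq_iff]
        have hfq : f q (v i) (u (i + 1)) := by
          rw [← mk_eq_iff, hv, hu]
        rcases Nat.eq_zero_or_pos n with rfl | hn
        · have hi : i + 1 = i := Fin.ext (by omega)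
          rw [hi] at hfq ⊢
          have := src_mem_sym2' (huv i) (Setoid.symm' _ hfq)
          have h := (iInf_iff_of_color (f := f) hf (g i).1).2 (by rw [(g i).2]; exact this)
          exact Setoid.symm' _ (src_mem_sym2 (huv i) h)
        · have hne : ∀ i, ¬ f q (u i) (v i) := by
            intro i h
            rw [← mk_eq_iff, hu, hv] at h
            have h1 : (1 : Fin (n + 1)) = 0 := by simpa using (hx h).symm
            have h0 : n = 0 := by simpa using h1
            omega
          exact hW.eq_of_isProperEnd hf (isProperEnd_of_sym2 (g i).2 (huv i) (hne i)).2
            (isProperEnd_of_sym2 (g (i + 1)).2 (huv (i + 1)) (hne (i + 1))).1 hfq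
      rw [h₂]
  · rintro ⟨n, x, g, hx, hg, hxg, hC⟩
    have hgC : ∀ i, ∃ d ∈ C, d.1 = g i := fun i => by
      have : g i ∈ Subtype.val '' C := hC ▸ ⟨i, rfl⟩
      exact this
    choose d hd hdg using hgC
    have hinj := hW.injOn_cycle hf (q := q) hx hxg fun i => by rw [← hdg]; exact (d i).2
    refine ⟨n, _, d, hinj, fun i j hij => hg ?_, fun i => ?_, ?_⟩
    · rw [← hdg, ← hdg, hij]
    · have h := congrArg
        (Sym2.map (Quotient.map' (s₂ := f q) id (fun a b h => iInf_setoid.1 h q))) (hxg i)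
      rw [Sym2.map_mk, Sym2.map_mk] at h
      rw [← h]
      simp [piece, quotient, hdg]
    · apply Set.image_injective.2 Subtype.val_injective
      rw [← hC, ← Set.range_comp]
      congr 1
      funext i
      exact hdg i

theorem nonempty_of_isSimpleCycle {V E : Type} {G : Multidigraph V E} {C : Set E}
    (h : G.IsSimpleCycle C) : C.Nonempty := by
  obtain ⟨n, x, g, -, -, -, rfl⟩ := h
  exact ⟨g 0, 0, rfl⟩

/-- A pad of a piece, as a pad of `G^π`. -/
def IsTreeLike.padMap (hW : G.IsTreeLike c) (hf : ∀ q, G.offColor c q ≤ f q)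
    (p : Σ q, (G.piece c q (f q) (hf q)).Pads) : (G.quotient (⨅ q, f q)).Pads :=
  ⟨Subtype.val '' p.2.1, (hW.isSimpleCycle_piece_iff hf).1 p.2.2⟩

/-- The pads of `G^π` are those of the pieces. -/
theorem IsTreeLike.bijective_padMap (hW : G.IsTreeLike c) (hf : ∀ q, G.offColor c q ≤ f q) :
    Function.Bijective (hW.padMap hf) := by
  constructor
  · rintro ⟨q, C⟩ ⟨q', C'⟩ h
    have h' : Subtype.val '' C.1 = Subtype.val '' C'.1 := congrArg Subtype.val h
    obtain ⟨e, he⟩ := nonempty_of_isSimpleCycle C.2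
    have : e.1 ∈ Subtype.val '' C'.1 := h' ▸ ⟨e, he, rfl⟩
    obtain ⟨e', -, he'⟩ := this
    have hq : q = q' := by rw [← e.2, ← e'.2, he']
    subst hq
    congr 1
    exact Subtype.ext (Set.image_injective.2 Subtype.val_injective h')
  · rintro ⟨C, hC⟩
    obtain ⟨e, he⟩ := nonempty_of_isSimpleCycle hC
    have hsub : Subtype.val '' (Subtype.val ⁻¹' C : Set {e' // c e' = c e}) = C := by
      refine (Subtype.image_preimage_coe {e' | c e' = c e} C).trans (Set.inter_eq_right.2 ?_)
      exact fun e' he' => hW.color_eq hf hC he' he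
    refine ⟨⟨c e, Subtype.val ⁻¹' C, ?_⟩, Subtype.ext hsub⟩
    rw [hW.isSimpleCycle_piece_iff hf, hsub]
    exact hC

theorem IsTreeLike.isCactus_iff (hW : G.IsTreeLike c) (hf : ∀ q, G.offColor c q ≤ f q) :
    (G.quotient (⨅ q, f q)).IsCactus ↔ ∀ q, (G.piece c q (f q) (hf q)).IsCactus := by
  constructor
  · intro h q e
    obtain ⟨C, ⟨hC, heC⟩, hu⟩ := h e.1
    obtain ⟨⟨q', C'⟩, hC'⟩ := (hW.bijective_padMap hf).2 ⟨C, hC⟩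
    have hC'' : Subtype.val '' C'.1 = C := congrArg Subtype.val hC'
    rw [← hC''] at heC
    obtain ⟨e', he', hee⟩ := heC
    have hq : q' = q := by rw [← e'.2, ← e.2, hee]
    subst hq
    obtain rfl := Subtype.ext hee
    refine ⟨C'.1, ⟨C'.2, he'⟩, fun D hD => ?_⟩
    apply Set.image_injective.2 Subtype.val_injective
    rw [hC'']
    exact hu _ ⟨(hW.isSimpleCycle_piece_iff hf).1 hD.1, ⟨e', hD.2, rfl⟩⟩
  · intro h e
    obtain ⟨C, ⟨hC, heC⟩, hu⟩ := h (c e) ⟨e, rfl⟩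
    refine ⟨Subtype.val '' C, ⟨(hW.isSimpleCycle_piece_iff hf).1 hC, ⟨_, heC, rfl⟩⟩, ?_⟩
    rintro D ⟨hD, heD⟩
    obtain ⟨⟨q', C'⟩, hC'⟩ := (hW.bijective_padMap hf).2 ⟨D, hD⟩
    have hC'' : Subtype.val '' C'.1 = D := congrArg Subtype.val hC'
    rw [← hC''] at heD
    obtain ⟨e', he', hee⟩ := heD
    have hq : q' = c e := by rw [← e'.2, hee]
    subst hq
    obtain rfl := Subtype.ext (a1 := e') (a2 := ⟨e, rfl⟩) hee
    rw [← hC'', hu C'.1 ⟨C'.2, he'⟩]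

/-- A pad of a piece and the corresponding pad of `G^π` are isomorphic. -/
theorem IsTreeLike.pad_equiv (hW : G.IsTreeLike c) (hf : ∀ q, G.offColor c q ≤ f q) {q : Q}
    (C : (G.piece c q (f q) (hf q)).Pads) (C' : (G.quotient (⨅ q, f q)).Pads)
    (k : C.1 ≃ C'.1) (hk : ∀ e, (k e).1 = e.1.1) :
    ∃ g : {v // (G.piece c q (f q) (hf q)).Visits C.1 v} ≃
        {v // (G.quotient (⨅ q, f q)).Visits C'.1 v},
      (∀ e, ((G.quotient (⨅ q, f q)).pad C').src (k e) =
        g (((G.piece c q (f q) (hf q)).pad C).src e)) ∧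
      (∀ e, ((G.quotient (⨅ q, f q)).pad C').tgt (k e) =
        g (((G.piece c q (f q) (hf q)).pad C).tgt e)) := by
  let m : Quotient (⨅ q, f q) → Quotient (f q) :=
    Quotient.map' (s₂ := f q) id fun a b h => iInf_setoid.1 h q
  have hm : ∀ v, (G.quotient (⨅ q, f q)).Visits C'.1 v →
      (G.piece c q (f q) (hf q)).Visits C.1 (m v) := by
    rintro v ⟨e, he, hv⟩
    refine ⟨(k.symm ⟨e, he⟩).1, (k.symm ⟨e, he⟩).2, ?_⟩
    have : ((k.symm ⟨e, he⟩).1).1 = e := by rw [← hk]; simp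
    rcases hv with rfl | rfl
    · left; simp only [piece, this]; rfl
    · right; simp only [piece, this]; rfl
  let M : {v // (G.quotient (⨅ q, f q)).Visits C'.1 v} →
      {v // (G.piece c q (f q) (hf q)).Visits C.1 v} := fun v => ⟨m v.1, hm v.1 v.2⟩
  have hsrc : ∀ e, M (((G.quotient (⨅ q, f q)).pad C').src (k e)) =
      ((G.piece c q (f q) (hf q)).pad C).src e := by
    intro e
    apply Subtype.ext
    simp only [M, m, pad, quotient, piece, hk]
    rfl
  have htgt : ∀ e, M (((G.quotient (⨅ q, f q)).pad C').tgt (k e)) =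
      ((G.piece c q (f q) (hf q)).pad C).tgt e := by
    intro e
    apply Subtype.ext
    simp only [M, m, pad, quotient, piece, hk]
    rfl
  have hM : Function.Bijective M := by
    constructor
    · have hcol : ∀ e ∈ C'.1, c e = q := fun e he => by
        have := hk (k.symm ⟨e, he⟩)
        rw [Equiv.apply_symm_apply] at this
        simp only at this
        rw [this]
        exact (k.symm ⟨e, he⟩).1.2
      obtain ⟨n, x, g, hx, hg, hxg, hC⟩ := C'.2
      have hinj := hW.injOn_cycle hf (q := q) hx hxg fun i => hcol _ (hC ▸ ⟨i, rfl⟩)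
      have hvis : ∀ {v}, (G.quotient (⨅ q, f q)).Visits C'.1 v → ∃ i, v = x i := by
        rw [← hC]
        rintro v ⟨_, ⟨i, rfl⟩, h⟩
        rcases Sym2.eq_iff.1 (hxg i) with h' | h' <;> rcases h with rfl | rfl
        exacts [⟨_, h'.1⟩, ⟨_, h'.2⟩, ⟨_, h'.1⟩, ⟨_, h'.2⟩]
      rintro ⟨v, hv⟩ ⟨w, hw⟩ hvw
      obtain ⟨i, rfl⟩ := hvis hv
      obtain ⟨j, rfl⟩ := hvis hw
      have : i = j := hinj (congrArg Subtype.val hvw)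
      subst this
      rfl
    · rintro ⟨v, e, he, hv⟩
      rcases hv with rfl | rfl
      · exact ⟨_, hsrc ⟨e, he⟩⟩
      · exact ⟨_, htgt ⟨e, he⟩⟩
  refine ⟨(Equiv.ofBijective M hM).symm, fun e => ?_, fun e => ?_⟩
  · rw [Equiv.eq_symm_apply]
    exact hsrc e
  · rw [Equiv.eq_symm_apply]
    exact htgt e

end ConnGraph

/-! ### Möbius inversion -/

section Moebius

open scoped Classical in
theorem moebius_eq_zero {α : Type} [PartialOrder α] [Finite α] {x y : α} (h : ¬ x ≤ y) :
    moebius x y = 0 := by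
  unfold moebius
  let _ := Fintype.ofFinite α
  let _ := Fintype.toLocallyFiniteOrder (α := α)
  exact IncidenceAlgebra.apply_eq_zero_of_not_le h _

variable {α β : Type} [PartialOrder α] [PartialOrder β] [Fintype α] [Fintype β]

open scoped Classical in
theorem sum_moebius_right (x y : α) :
    ∑ z with z ≤ y, moebius x z = if x = y then 1 else 0 := by
  let _ := Fintype.toLocallyFiniteOrder (α := α)
  have h := IncidenceAlgebra.sum_Icc_mu_right (𝕜 := ℂ) x y
  rw [← h]
  symm
  refine Finset.sum_subset_zero_on_sdiff (fun z hz => ?_) (fun z hz => ?_) (fun z _ => ?_)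
  · exact Finset.mem_filter.2 ⟨Finset.mem_univ _, (Finset.mem_Icc.1 hz).2⟩
  · simp only [Finset.mem_sdiff, Finset.mem_filter, Finset.mem_univ, true_and, Finset.mem_Icc,
      not_and] at hz
    exact moebius_eq_zero fun h => hz.2 h hz.1
  · unfold moebius
    congr!

open scoped Classical in
theorem sum_moebius_left (x y : α) :
    ∑ z with x ≤ z, moebius z y = if x = y then 1 else 0 := by
  let _ := Fintype.toLocallyFiniteOrder (α := α)
  have h := IncidenceAlgebra.sum_Icc_mu_left (𝕜 := ℂ) x y
  rw [← h]
  symm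
  refine Finset.sum_subset_zero_on_sdiff (fun z hz => ?_) (fun z hz => ?_) (fun z _ => ?_)
  · exact Finset.mem_filter.2 ⟨Finset.mem_univ _, (Finset.mem_Icc.1 hz).1⟩
  · simp only [Finset.mem_sdiff, Finset.mem_filter, Finset.mem_univ, true_and, Finset.mem_Icc,
      not_and] at hz
    exact moebius_eq_zero fun h => hz.2 hz.1 h
  · unfold moebius
    congr!

open scoped Classical in
/-- A function on a finite poset is determined by its sums over the lower sets. -/
theorem eq_of_sum_le_eq {F F' : α → ℂ}
    (h : ∀ y, ∑ z with z ≤ y, F z = ∑ z with z ≤ y, F' z) : F = F' := by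
  funext y
  induction y using WellFoundedLT.induction with
  | ind y ih =>
    have hs : (Finset.univ.filter fun z => z ≤ y) =
        insert y (Finset.univ.filter fun z => z < y) := by
      ext z
      simp [le_iff_eq_or_lt]
    have hy := h y
    rw [hs, Finset.sum_insert (by simp), Finset.sum_insert (by simp)] at hy
    have : ∑ z with z < y, F z = ∑ z with z < y, F' z :=
      Finset.sum_congr rfl fun z hz => ih z (Finset.mem_filter.1 hz).2
    rw [this] at hy
    exact add_right_cancel hy

open scoped Classical in
/-- The Möbius function of an upper set is the restriction of the Möbius function. -/
theorem moebius_map (f : β ↪o α) (hf : ∀ b a, f b ≤ a → a ∈ Set.range f) (x y : β) :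
    moebius (f x) (f y) = moebius x y := by
  refine congrFun (eq_of_sum_le_eq (F := fun y => moebius (f x) (f y)) fun y => ?_) y
  rw [sum_moebius_right]
  have h : ∑ z with z ≤ y, moebius (f x) (f z) = ∑ w with w ≤ f y, moebius (f x) w := by
    refine Finset.sum_of_injOn f f.injective.injOn (fun z hz => ?_) (fun w hw hw' => ?_)
      fun _ _ => rfl
    · simp only [Finset.coe_filter, Finset.mem_univ, true_and, Set.mem_ofPred_eq] at hz ⊢
      exact f.monotone hz
    · refine moebius_eq_zero fun hle => ?_
      obtain ⟨z, rfl⟩ := hf _ _ hle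
      refine hw' ⟨z, ?_, rfl⟩
      simp only [Finset.coe_filter, Finset.mem_univ, true_and, Set.mem_ofPred_eq,
        Finset.mem_filter] at hw ⊢
      exact f.le_iff_le.1 hw
  rw [h, sum_moebius_right]
  simp

end Moebius

/-! ### The injective traffic state -/

/-- A surjection compatible with two partitions induces a bijection of the quotients. -/
theorem exists_quotientEquiv {V W : Type} {σ : Setoid V} {ρ : Setoid W} (f : V → W)
    (hf : Function.Surjective f) (h : ∀ u v, σ u v ↔ ρ (f u) (f v)) :
    ∃ g : Quotient σ ≃ Quotient ρ, ∀ v, g (Quotient.mk σ v) = Quotient.mk ρ (f v) := by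
  refine ⟨Equiv.ofBijective (Quotient.map' f fun u v huv => (h u v).1 huv) ⟨?_, ?_⟩, fun v => rfl⟩
  · intro x y hxy
    induction x using Quotient.inductionOn with | _ u => ?_
    induction y using Quotient.inductionOn with | _ v => ?_
    exact Quotient.sound ((h u v).2 (Quotient.exact hxy))
  · intro y
    induction y using Quotient.inductionOn with | _ w => ?_
    obtain ⟨v, rfl⟩ := hf w
    exact ⟨Quotient.mk σ v, rfl⟩

/-- A bijection of the vertex sets acts on partitions. -/
def setoidCongr {V V' : Type} (f : V ≃ V') : Setoid V ≃o Setoid V' where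
  toFun π := Setoid.comap f.symm π
  invFun π := Setoid.comap f π
  left_inv π := Setoid.ext fun u v => by
    change π (f.symm (f u)) (f.symm (f v)) ↔ _
    rw [f.symm_apply_apply, f.symm_apply_apply]
  right_inv π := Setoid.ext fun u v => by
    change π (f (f.symm u)) (f (f.symm v)) ↔ _
    rw [f.apply_symm_apply, f.apply_symm_apply]
  map_rel_iff' {π π'} := by
    refine ⟨fun h u v huv => ?_, fun h u v huv => h huv⟩
    have : π' (f.symm (f u)) (f.symm (f v)) := by
      apply h
      change π (f.symm (f u)) (f.symm (f v))
      rwa [f.symm_apply_apply, f.symm_apply_apply]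
    rwa [f.symm_apply_apply, f.symm_apply_apply] at this

theorem setoidCongr_apply {V V' : Type} (f : V ≃ V') (π : Setoid V) (u v : V') :
    setoidCongr f π u v ↔ π (f.symm u) (f.symm v) := Iff.rfl

theorem ConnGraph.quotient_src {V E : Type} (G : ConnGraph V E) (π : Setoid V) (e : E) :
    (G.quotient π).src e = Quotient.mk π (G.src e) := rfl

theorem ConnGraph.quotient_tgt {V E : Type} (G : ConnGraph V E) (π : Setoid V) (e : E) :
    (G.quotient π).tgt e = Quotient.mk π (G.tgt e) := rfl

namespace TrafficState

open ConnGraph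

variable {A : Type*} [GAlgebra A] (T : TrafficState A)
variable {V E V' E' : Type} [Finite V] [Finite E] [Finite V'] [Finite E']

theorem injective_eq_sum [Fintype (Setoid V)] (G : ConnGraph V E) (a : E → A) :
    T.injective G a = ∑ π : Setoid V, T.τ (G.quotient π) a * moebius ⊥ π :=
  finsum_eq_sum_of_fintype _

/-- The partitions of a quotient as partitions of the original set. -/
def comapMk {V : Type} (π : Setoid V) : Setoid (Quotient π) ↪o Setoid V where
  toFun ρ := Setoid.comap (Quotient.mk π) ρ
  inj' ρ ρ' h := by
    ext x y
    induction x using Quotient.inductionOn with | _ u => ?_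
    induction y using Quotient.inductionOn with | _ v => ?_
    have : Setoid.comap (Quotient.mk π) ρ u v ↔ Setoid.comap (Quotient.mk π) ρ' u v :=
      iff_of_eq (congrArg (fun s : Setoid V => s u v) h)
    exact this
  map_rel_iff' {ρ ρ'} := by
    refine ⟨fun h x y => ?_, fun h u v huv => h huv⟩
    induction x using Quotient.inductionOn with | _ u => ?_
    induction y using Quotient.inductionOn with | _ v => ?_
    exact fun huv => h (show Setoid.comap (Quotient.mk π) ρ u v from huv)

theorem le_comapMk {V : Type} {π : Setoid V} (ρ : Setoid (Quotient π)) : π ≤ comapMk π ρ := by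
  intro u v huv
  have : Quotient.mk π u = Quotient.mk π v := Quotient.sound huv
  change ρ (Quotient.mk π u) (Quotient.mk π v)
  rw [this]

theorem comapMk_bot {V : Type} (π : Setoid V) : comapMk π ⊥ = π := by
  ext u v
  exact Quotient.eq

theorem mem_range_comapMk {V : Type} {π σ : Setoid V} (h : π ≤ σ) :
    σ ∈ Set.range (comapMk π) :=
  ⟨Setoid.correspondence π ⟨σ, h⟩, Setoid.ext fun _ _ => Iff.rfl⟩

theorem τ_quotient_quotient (G : ConnGraph V E) (π : Setoid V) (ρ : Setoid (Quotient π))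
    (a : E → A) : T.τ ((G.quotient π).quotient ρ) a = T.τ (G.quotient (comapMk π ρ)) a := by
  obtain ⟨g, hg⟩ := exists_quotientEquiv (σ := comapMk π ρ) (ρ := ρ) (Quotient.mk π)
    Quotient.mk_surjective fun u v => Iff.rfl
  exact T.τ_iso (G.quotient (comapMk π ρ)) ((G.quotient π).quotient ρ) g (Equiv.refl _)
    (fun e => (hg _).symm) (fun e => (hg _).symm) a

theorem τ_quotient_bot (G : ConnGraph V E) (a : E → A) : T.τ (G.quotient ⊥) a = T.τ G a := by
  obtain ⟨g, hg⟩ : ∃ g : V ≃ Quotient (⊥ : Setoid V), ∀ v, g v = Quotient.mk _ v :=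
    ⟨Equiv.ofBijective (Quotient.mk ⊥) ⟨fun u v h => Quotient.exact h, Quotient.mk_surjective⟩,
      fun v => rfl⟩
  exact T.τ_iso G (G.quotient ⊥) g (Equiv.refl _) (fun e => (hg _).symm) (fun e => (hg _).symm) a

theorem injective_quotient [Fintype (Setoid V)] (G : ConnGraph V E) (π : Setoid V) (a : E → A) :
    T.injective (G.quotient π) a = ∑ ρ : Setoid V, T.τ (G.quotient ρ) a * moebius π ρ := by
  let _ := Fintype.ofFinite (Setoid (Quotient π))
  rw [injective_eq_sum]
  refine Finset.sum_of_injOn (comapMk π) (comapMk π).injective.injOn (fun _ _ => by simp)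
    (fun ρ _ hρ => ?_) (fun ρ _ => ?_)
  · rw [moebius_eq_zero, mul_zero]
    intro h
    obtain ⟨σ, hσ⟩ := mem_range_comapMk h
    exact hρ ⟨σ, by simp, hσ⟩
  · rw [T.τ_quotient_quotient]
    congr 1
    have h := moebius_map (comapMk π)
      (fun b c h => mem_range_comapMk ((le_comapMk b).trans h)) ⊥ ρ
    rw [comapMk_bot] at h
    exact h.symm

/-- Möbius inversion: the traffic state is the sum of the injective traffic states of the
quotients. -/
theorem τ_eq_sum_injective [Fintype (Setoid V)] (G : ConnGraph V E) (a : E → A) :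
    T.τ G a = ∑ π : Setoid V, T.injective (G.quotient π) a := by
  classical
  simp only [T.injective_quotient]
  rw [Finset.sum_comm]
  simp only [← Finset.mul_sum]
  have h : ∀ ρ : Setoid V, ∑ π : Setoid V, moebius π ρ = if ⊥ = ρ then 1 else 0 := by
    intro ρ
    rw [← sum_moebius_left (⊥ : Setoid V) ρ]
    refine Finset.sum_congr ?_ fun _ _ => rfl
    ext π
    simp
  simp only [h, mul_ite, mul_one, mul_zero, Finset.sum_ite_eq, Finset.mem_univ, if_true]
  exact (T.τ_quotient_bot G a).symm

theorem injective_iso (G : ConnGraph V E) (G' : ConnGraph V' E') (f : V ≃ V') (k : E ≃ E')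
    (hs : ∀ e, G'.src (k e) = f (G.src e)) (ht : ∀ e, G'.tgt (k e) = f (G.tgt e)) (a : E' → A) :
    T.injective G' a = T.injective G (fun e => a (k e)) := by
  let _ := Fintype.ofFinite (Setoid V)
  let _ := Fintype.ofFinite (Setoid V')
  let F := setoidCongr f
  rw [injective_eq_sum, injective_eq_sum, ← F.toEquiv.sum_comp]
  refine Finset.sum_congr rfl fun π _ => ?_
  congr 1
  · obtain ⟨g, hg⟩ := exists_quotientEquiv (σ := π) (ρ := F π) f f.surjective fun u v => by
      rw [setoidCongr_apply, f.symm_apply_apply, f.symm_apply_apply]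
    refine T.τ_iso (G.quotient π) (G'.quotient (F π)) g k (fun e => ?_) (fun e => ?_) a
    · rw [quotient_src, quotient_src, hs, hg]
    · rw [quotient_tgt, quotient_tgt, ht, hg]
  · have h := moebius_map F.toOrderEmbedding (fun b c _ => F.surjective c) ⊥ π
    have hb : F.toOrderEmbedding ⊥ = ⊥ := map_bot F
    rw [hb] at h
    exact h

end TrafficState

/-! ### Special substitutions -/

namespace ConnGraph

variable {V E : Type} {W F : E → Type}

/-- A description of the vertices of a substituted graph by maps `fV`, `fW` that are compatible with
the identifications, jointly surjective, and injective up to the identifications. -/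
theorem exists_substEquiv (G : ConnGraph V E) (h : ∀ e, GraphOp (W e) (F e)) {V' : Type}
    (fV : V → V') (fW : ∀ e, W e → V') (hs : ∀ e, fW e (h e).vin = fV (G.src e))
    (ht : ∀ e, fW e (h e).vout = fV (G.tgt e)) (g : V' → G.SubstVertex h)
    (hgV : ∀ v, g (fV v) = Quot.mk _ (.inl v)) (hgW : ∀ e w, g (fW e w) = Quot.mk _ (.inr ⟨e, w⟩))
    (hsurj : ∀ x, (∃ v, fV v = x) ∨ ∃ e w, fW e w = x) :
    ∃ f : G.SubstVertex h ≃ V', (∀ v, f (Quot.mk _ (.inl v)) = fV v) ∧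
      ∀ e w, f (Quot.mk _ (.inr ⟨e, w⟩)) = fW e w := by
  let f : G.SubstVertex h → V' := Quot.lift (fun x => match x with
    | .inl v => fV v
    | .inr ⟨e, w⟩ => fW e w) (by
      rintro _ _ (e | e)
      · exact (hs e).symm
      · exact (ht e).symm)
  refine ⟨Equiv.ofBijective f ⟨?_, fun x => ?_⟩, fun v => rfl, fun e w => rfl⟩
  · refine Function.LeftInverse.injective (g := g) fun x => ?_
    induction x using Quot.inductionOn with | _ x => ?_
    rcases x with v | ⟨e, w⟩
    · exact hgV v
    · exact hgW e w
  · rcases hsurj x with ⟨v, hv⟩ | ⟨e, w, hw⟩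
    · exact ⟨Quot.mk _ (.inl v), hv⟩
    · exact ⟨Quot.mk _ (.inr ⟨e, w⟩), hw⟩

/-- The graph in which the edges selected by `t` are reversed. -/
def reverse (G : ConnGraph V E) (t : E → Bool) : ConnGraph V E where
  src e := if t e then G.tgt e else G.src e
  tgt e := if t e then G.src e else G.tgt e
  connected := by
    refine ⟨G.connected.1, fun v w => eqvGen_map id ?_ (G.connected.2 v w)⟩
    rintro _ _ ⟨e, rfl, rfl⟩
    by_cases he : t e
    · exact .symm _ _ (.rel _ _ ⟨e, by simp [he], by simp [he]⟩)
    · exact .rel _ _ ⟨e, by simp [he], by simp [he]⟩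

end ConnGraph

namespace GAlgebra

variable {A : Type*} [GAlgebra A]

theorem Z_path_zero (x : Fin 0 → A) : Z (GraphOp.path 0) x = 1 := by
  rw [one_def]
  congr 1
  exact Subsingleton.elim _ _

theorem prod_ofFn (n : ℕ) (x : Fin n → A) : (List.ofFn x).prod = Z (GraphOp.path n) x := by
  induction n with
  | zero => simp [Z_path_zero]
  | succ n ih =>
    rw [List.ofFn_succ', List.prod_concat, ih, mul_def]
    have h := Z_path_append n 1 (fun i => x i.castSucc) (fun _ => x (Fin.last n))
    rw [Z_path_one (fun _ => x (Fin.last n))] at h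
    rw [h]
    congr 1
    funext i
    induction i using Fin.lastCases with
    | last => exact Fin.append_right _ _ (0 : Fin 1)
    | cast i => exact Fin.append_left _ _ i

/-- A graph operation evaluated at units is the unit. -/
theorem Z_one {V E : Type} [Finite V] [Finite E] (g : GraphOp V E) :
    Z g (fun _ => (1 : A)) = 1 := by
  have h := Z_subst (A := A) g (fun _ => GraphOp.path 0) fun x => x.2.elim0
  have hF : ∀ e : E, (Z (GraphOp.path 0) fun f => (Fin.elim0 f : A)) = 1 :=
    fun e => Z_path_zero _
  refine Eq.trans (congrArg (Z g) (funext fun e => (hF e).symm)) (h.symm.trans ?_)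
  have hv : ∀ v, (Quot.mk _ (.inl v) : g.SubstVertex fun _ => GraphOp.path 0) =
      Quot.mk _ (.inl g.vout) := by
    intro v
    have hle : g.conn Set.univ ≤ Setoid.ker
        (fun v => (Quot.mk _ (.inl v) : g.SubstVertex fun _ => GraphOp.path 0)) :=
      Multidigraph.conn_le fun e _ => (Quot.sound (.src e)).trans
        (Quot.sound (ConnGraph.SubstRel.tgt (G := g.toConnGraph)
          (h := fun _ => GraphOp.path 0) e)).symm
    exact hle (g.connected.conn_univ v g.vout)
  obtain ⟨f, hfV, -⟩ := g.toConnGraph.exists_substEquiv (fun _ => GraphOp.path 0)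
    (V' := Fin 1) (fun _ => 0) (fun _ _ => 0) (fun _ => rfl) (fun _ => rfl)
    (fun _ => Quot.mk _ (.inl g.vout)) (fun v => (hv v).symm) (fun e w => by
      rw [show w = 0 from Fin.ext (by omega), ← hv (g.tgt e)]
      exact Quot.sound (.tgt e)) (fun x => .inl ⟨g.vin, Subsingleton.elim _ _⟩)
  have : IsEmpty (Σ _ : E, Fin 0) := ⟨fun x => x.2.elim0⟩
  have h' := Z_iso (A := A) (g.subst fun _ => GraphOp.path 0) (GraphOp.path 0) f
    (Equiv.equivOfIsEmpty _ _) (fun e => e.2.elim0) (fun e => e.2.elim0)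
    (Subsingleton.elim (α := Fin 1) _ _) (Subsingleton.elim (α := Fin 1) _ _) (fun i => i.elim0)
  rw [Z_path_zero] at h'
  rw [h']
  congr 1

theorem transpose_one : transpose (1 : A) = 1 := Z_one _

end GAlgebra

namespace TrafficState

open ConnGraph GAlgebra

variable {A : Type*} [GAlgebra A] (T : TrafficState A)
variable {V E : Type} [Finite V] [Finite E]

/-- Edges labelled by units may be contracted. -/
theorem τ_contract {Q : Type} [DecidableEq Q] (G : ConnGraph V E) (c : E → Q) (q : Q) (a : E → A) :
    T.τ G (fun e => if c e = q then a e else 1) =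
      T.τ (G.piece c q (G.offColor c q) le_rfl) (fun e => a e.1) := by
  let n : E → ℕ := fun e => if c e = q then 1 else 0
  have hn : ∀ e, c e = q → n e = 1 := fun e he => if_pos he
  have hn' : ∀ e, c e ≠ q → n e = 0 := fun e he => if_neg he
  have hZ : ∀ e, (if c e = q then a e else 1) = Z (GraphOp.path (n e)) (fun _ => a e) := by
    intro e
    by_cases he : c e = q
    · rw [if_pos he, hn e he, Z_path_one]
    · rw [if_neg he, hn' e he, Z_path_zero]
  simp only [hZ]
  have h₁ := T.τ_subst G (fun e => GraphOp.path (n e)) (fun x => a x.1)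
  rw [h₁]
  set N := G.offColor c q with hN
  have hoff : ∀ e, c e ≠ q → Quotient.mk N (G.tgt e) = Quotient.mk N (G.src e) := fun e he =>
    (Quotient.sound (Multidigraph.conn_of_mem (G := G.toMultidigraph) he)).symm
  have hsrc : ∀ e, (Quot.mk _ (.inl (G.src e)) : G.SubstVertex fun e => GraphOp.path (n e)) =
      Quot.mk _ (.inr ⟨e, Fin.last _⟩) := fun e => Quot.sound (.src e)
  have htgt : ∀ e, (Quot.mk _ (.inl (G.tgt e)) : G.SubstVertex fun e => GraphOp.path (n e)) =
      Quot.mk _ (.inr ⟨e, 0⟩) := fun e => Quot.sound (.tgt e)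
  have hlast : ∀ e, c e ≠ q → Fin.last (n e) = 0 := fun e he => Fin.ext (hn' e he)
  obtain ⟨f, -, hfW⟩ := G.exists_substEquiv (fun e => GraphOp.path (n e)) (V' := Quotient N)
    (fun v => Quotient.mk N v)
    (fun e w => if w = 0 then Quotient.mk N (G.tgt e) else Quotient.mk N (G.src e))
    (fun e => by
      change (if Fin.last (n e) = 0 then _ else _) = _
      split_ifs with hl
      · refine hoff e fun he => ?_
        have := congrArg Fin.val hl
        simp [hn e he] at this
      · rfl)
    (fun e => if_pos rfl)
    (Quotient.lift (fun v => Quot.mk _ (.inl v)) (by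
      have hle : N ≤ Setoid.ker
          (fun v => (Quot.mk _ (.inl v) : G.SubstVertex fun e => GraphOp.path (n e))) :=
        Multidigraph.conn_le fun e he => by
          change Quot.mk _ _ = Quot.mk _ _
          rw [hsrc, htgt, hlast e he]
      exact fun u v huv => hle huv))
    (fun v => rfl)
    (fun e w => by
      split_ifs with hw
      · rw [hw]; exact htgt e
      · have : w = Fin.last (n e) := by
          by_cases he : c e = q
          · have h₁ := hn e he
            have h₂ := w.2
            have h₃ : w.1 ≠ 0 := fun h => hw (Fin.ext h)
            exact Fin.ext (by simp only [Fin.val_last]; omega)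
          · have h₁ := hn' e he
            have h₂ := w.2
            exact Fin.ext (by simp only [Fin.val_last]; omega)
        rw [this]; exact hsrc e)
    (fun x => by
      induction x using Quotient.inductionOn with | _ v => exact .inl ⟨v, rfl⟩)
  let k : (Σ e, Fin (n e)) ≃ {e // c e = q} :=
    { toFun := fun x => ⟨x.1, by
        by_contra he
        have h₁ := x.2.2
        have h₂ := hn' _ he
        omega⟩
      invFun := fun e => ⟨e.1, ⟨0, by rw [hn _ e.2]; omega⟩⟩
      left_inv := by
        rintro ⟨e, i⟩
        have h₁ := i.2
        have h₂ : n e ≤ 1 := by simp only [n]; split_ifs <;> simp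
        have h₃ : (⟨0, by omega⟩ : Fin (n e)) = i := Fin.ext (show 0 = i.1 by omega)
        exact congrArg (Sigma.mk e) h₃
      right_inv := fun e => rfl }
  refine (T.τ_iso (G.subst fun e => GraphOp.path (n e)) (G.piece c q N le_rfl) f k ?_ ?_
    (fun e => a e.1)).symm
  · rintro ⟨e, i⟩
    exact ((hfW e i.succ).trans (if_neg (Fin.succ_ne_zero i))).symm
  · rintro ⟨e, i⟩
    have hi : i.castSucc = 0 := by
      have h₁ := i.2
      have h₂ : n e ≤ 1 := by simp only [n]; split_ifs <;> simp
      exact Fin.ext (by simp only [Fin.val_castSucc, Fin.val_zero]; omega)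
    exact ((hfW e i.castSucc).trans (if_pos hi)).symm

/-- Transposed labels may be replaced by reversed edges. -/
theorem τ_flip (G : ConnGraph V E) (t : E → Bool) (a : E → A) :
    T.τ G (fun e => if t e then transpose (a e) else a e) = T.τ (G.reverse t) a := by
  let h : E → GraphOp (Fin 2) (Fin 1) := fun e =>
    if t e then (GraphOp.path 1).transpose else GraphOp.path 1
  have hZ : ∀ e, (if t e then transpose (a e) else a e) = Z (h e) (fun _ => a e) := by
    intro e
    by_cases he : t e
    · simp only [h, he, if_true]; rfl
    · simp only [h, he]; exact (Z_id _).symm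
  simp only [hZ]
  have h₁ := T.τ_subst G h (fun x => a x.1)
  rw [h₁]
  have hin : ∀ e, (h e).vin = if t e then 0 else 1 := by
    intro e
    by_cases he : t e <;> simp only [h, he] <;> rfl
  have hout : ∀ e, (h e).vout = if t e then 1 else 0 := by
    intro e
    by_cases he : t e <;> simp only [h, he] <;> rfl
  have hsrc : ∀ e i, (h e).src i = 1 := by
    intro e i
    rw [Subsingleton.elim i 0]
    by_cases he : t e <;> simp only [h, he] <;> rfl
  have htgt : ∀ e i, (h e).tgt i = 0 := by
    intro e i
    rw [Subsingleton.elim i 0]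
    by_cases he : t e <;> simp only [h, he] <;> rfl
  have qsrc : ∀ e, (Quot.mk _ (.inl (G.src e)) : G.SubstVertex h) =
      Quot.mk _ (.inr ⟨e, (h e).vin⟩) := fun e => Quot.sound (.src e)
  have qtgt : ∀ e, (Quot.mk _ (.inl (G.tgt e)) : G.SubstVertex h) =
      Quot.mk _ (.inr ⟨e, (h e).vout⟩) := fun e => Quot.sound (.tgt e)
  obtain ⟨f, -, hfW⟩ := G.exists_substEquiv h id
    (fun e w => if w = 0 then (G.reverse t).tgt e else (G.reverse t).src e)
    (fun e => by
      by_cases he : t e <;> simp [hin, he, reverse])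
    (fun e => by
      by_cases he : t e <;> simp [hout, he, reverse])
    (fun v => Quot.mk _ (.inl v)) (fun v => rfl)
    (fun e w => by
      have hw : w = 0 ∨ w = 1 := by omega
      rcases hw with rfl | rfl
      · change Quot.mk (G.SubstRel h) (Sum.inl ((G.reverse t).tgt e)) = _
        by_cases he : t e
        · rw [show (G.reverse t).tgt e = G.src e from if_pos he, qsrc, hin, if_pos he]
        · rw [show (G.reverse t).tgt e = G.tgt e from if_neg he, qtgt, hout, if_neg he]
      · change Quot.mk (G.SubstRel h) (Sum.inl ((G.reverse t).src e)) = _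
        by_cases he : t e
        · rw [show (G.reverse t).src e = G.tgt e from if_pos he, qtgt, hout, if_pos he]
        · rw [show (G.reverse t).src e = G.src e from if_neg he, qsrc, hin, if_neg he])
    (fun v => .inl ⟨v, rfl⟩)
  let k : (Σ _ : E, Fin 1) ≃ E :=
    { toFun := fun x => x.1
      invFun := fun e => ⟨e, 0⟩
      left_inv := fun x => by
        obtain ⟨e, i⟩ := x
        rw [Subsingleton.elim i 0]
      right_inv := fun e => rfl }
  refine (T.τ_iso (G.subst h) (G.reverse t) f k ?_ ?_ a).symm
  · rintro ⟨e, i⟩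
    have h' := hfW e ((h e).src i)
    rw [hsrc] at h'
    change _ = f (Quot.mk _ (.inr ⟨e, (h e).src i⟩))
    rw [hsrc, h']
    rfl
  · rintro ⟨e, i⟩
    have h' := hfW e ((h e).tgt i)
    rw [htgt] at h'
    change _ = f (Quot.mk _ (.inr ⟨e, (h e).tgt i⟩))
    rw [htgt, h']
    rfl

theorem injective_flip (G : ConnGraph V E) (t : E → Bool) (a : E → A) :
    T.injective G (fun e => if t e then transpose (a e) else a e) =
      T.injective (G.reverse t) a := by
  unfold injective
  refine finsum_congr fun π => ?_
  congr 1
  rw [T.τ_flip]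
  have : (G.quotient π).reverse t = (G.reverse t).quotient π := by
    unfold reverse quotient
    simp only [apply_ite (Quotient.mk π)]
  rw [this]

/-- The state of a product is the value of `τ` on the cycle labelled by the factors. -/
theorem φ_prod (n : ℕ) [NeZero n] (x : Fin n → A) :
    T.φ (List.ofFn x).prod = T.τ (cycle n) x := by
  rw [prod_ofFn]
  change T.τ (cycle 1) (fun _ => Z (GraphOp.path n) x) = _
  have h₁ := T.τ_subst (cycle 1) (fun _ => GraphOp.path n) (fun y => x y.2)
  rw [h₁]
  have qsrc : ∀ e, (Quot.mk _ (.inl 0) : (cycle 1).SubstVertex fun _ => GraphOp.path n) =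
      Quot.mk _ (.inr ⟨e, Fin.last n⟩) := fun e => by
    have : (0 : Fin 1) = (cycle 1).src e := Subsingleton.elim _ _
    rw [this]; exact Quot.sound (.src e)
  have qtgt : ∀ e, (Quot.mk _ (.inl 0) : (cycle 1).SubstVertex fun _ => GraphOp.path n) =
      Quot.mk _ (.inr ⟨e, 0⟩) := fun e => by
    have : (0 : Fin 1) = (cycle 1).tgt e := Subsingleton.elim _ _
    rw [this]; exact Quot.sound (.tgt e)
  obtain ⟨f, -, hfW⟩ := (cycle 1).exists_substEquiv (fun _ => GraphOp.path n) (V' := Fin n)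
    (fun _ => 0) (fun _ w => Fin.ofNat n w.1)
    (fun e => by
      change Fin.ofNat n n = 0
      ext; simp)
    (fun e => by
      change Fin.ofNat n 0 = 0
      ext; simp)
    (fun v => Quot.mk _ (.inr ⟨0, v.castSucc⟩))
    (fun v => by
      rw [Subsingleton.elim v 0, qtgt 0]
      congr)
    (fun e w => by
      rw [Subsingleton.elim e 0]
      rcases (Nat.lt_succ_iff.1 w.2).lt_or_eq with hw | hw
      · congr 3
        ext
        simp [Nat.mod_eq_of_lt hw]
      · have h₂ : w = Fin.last n := Fin.ext hw
        have h₃ : (Fin.ofNat n w.1).castSucc = 0 := by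
          ext
          simp [hw]
        rw [h₃, h₂, ← qtgt, ← qsrc])
    (fun v => .inr ⟨0, v.castSucc, by ext; simp⟩)
  let k : (Σ _ : Fin 1, Fin n) ≃ Fin n :=
    { toFun := fun x => x.2
      invFun := fun e => ⟨0, e⟩
      left_inv := fun x => by
        obtain ⟨e, i⟩ := x
        rw [Subsingleton.elim e 0]
      right_inv := fun e => rfl }
  refine (T.τ_iso ((cycle 1).subst fun _ => GraphOp.path n) (cycle n) f k ?_ ?_ x).symm
  · rintro ⟨e, i⟩
    refine Eq.trans ?_ (hfW e i.succ).symm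
    change i + 1 = _
    ext
    simp [Fin.val_add]
  · rintro ⟨e, i⟩
    refine Eq.trans ?_ (hfW e i.castSucc).symm
    change i = _
    ext
    simp

end TrafficState

/-! ### Factorization along tree-like colourings -/

namespace ConnGraph

instance {V E : Type} [Finite E] (G : ConnGraph V E) : Finite G.Pads :=
  inferInstanceAs (Finite {C : Set E // G.IsSimpleCycle C})

/-- All simple cycles of `G^π` are monochromatic. -/
def IsMonochromatic {V E Q : Type} (G : ConnGraph V E) (c : E → Q) (π : Setoid V) : Prop :=
  ∀ C, (G.quotient π).IsSimpleCycle C → ∀ e ∈ C, ∀ e' ∈ C, c e = c e'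

end ConnGraph

namespace TrafficState

open ConnGraph GAlgebra

variable {A : Type*} [GAlgebra A] (T : TrafficState A)
variable {V E Q : Type} [Finite V] [Finite E]

theorem τ_piece {G : ConnGraph V E} {c : E → Q} {q : Q} (a : {e // c e = q} → A)
    [Fintype {π // G.offColor c q ≤ π}] :
    T.τ (G.piece c q (G.offColor c q) le_rfl) a =
      ∑ π : {π // G.offColor c q ≤ π}, T.injective (G.piece c q π.1 π.2) a := by
  let _ := Fintype.ofFinite (Setoid (Quotient (G.offColor c q)))
  rw [τ_eq_sum_injective, ← (Setoid.correspondence (G.offColor c q)).toEquiv.sum_comp]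
  refine Finset.sum_congr rfl fun π _ => ?_
  obtain ⟨g, hg⟩ := exists_quotientEquiv (σ := π.1)
    (ρ := Setoid.correspondence (G.offColor c q) π) (Quotient.mk (G.offColor c q))
    Quotient.mk_surjective fun u v => Iff.rfl
  exact T.injective_iso (G.piece c q π.1 π.2)
    ((G.piece c q (G.offColor c q) le_rfl).quotient (Setoid.correspondence (G.offColor c q) π))
    g (Equiv.refl _) (fun e => (hg _).symm) (fun e => (hg _).symm) a

variable {T} {I : Type*} {a : I → A}

/-- The injective traffic state of a quotient that splits is the product over the colours. -/
theorem IsCactusType.injective_iInf [Fintype Q] (ha : T.IsCactusType a) {G : ConnGraph V E}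
    {c : E → Q} (hW : G.IsTreeLike c) {f : Q → Setoid V} (hf : ∀ q, G.offColor c q ≤ f q)
    (γ : E → I) :
    T.injective (G.quotient (⨅ q, f q)) (fun e => a (γ e)) =
      ∏ q, T.injective (G.piece c q (f q) (hf q)) (fun e => a (γ e.1)) := by
  classical
  by_cases hK : (G.quotient (⨅ q, f q)).IsCactus
  · have hK' := (hW.isCactus_iff hf).1 hK
    let _ := fun q => Fintype.ofFinite (G.piece c q (f q) (hf q)).Pads
    let _ := Fintype.ofFinite (G.quotient (⨅ q, f q)).Pads
    rw [(ha _ _ _ γ).2 hK]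
    have hq : ∀ q, T.injective (G.piece c q (f q) (hf q)) (fun e => a (γ e.1)) =
        ∏ C : (G.piece c q (f q) (hf q)).Pads,
          T.injective ((G.piece c q (f q) (hf q)).pad C) (fun e => a (γ e.1.1)) := by
      intro q
      rw [(ha _ _ (G.piece c q (f q) (hf q)) (fun e => γ e.1)).2 (hK' q),
        finprod_eq_prod_of_fintype]
    simp only [hq]
    rw [finprod_eq_prod_of_fintype, ← Fintype.prod_sigma']
    symm
    refine Fintype.prod_bijective _ (hW.bijective_padMap hf) _ _ fun p => ?_
    obtain ⟨q, C⟩ := p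
    obtain ⟨g, hs, ht⟩ := hW.pad_equiv hf C (hW.padMap hf ⟨q, C⟩)
      (Equiv.Set.image _ C.1 Subtype.val_injective) fun e => rfl
    exact (T.injective_iso _ _ g _ hs ht (fun e => a (γ e.1))).symm
  · rw [(ha _ _ _ γ).1 hK]
    rw [hW.isCactus_iff hf] at hK
    push Not at hK
    obtain ⟨q, hq⟩ := hK
    symm
    exact Finset.prod_eq_zero (Finset.mem_univ q)
      ((ha _ _ (G.piece c q (f q) (hf q)) (fun e => γ e.1)).1 hq)

open scoped Classical in
/-- **Factorization.** For a tree-like colouring of a test graph, the product over the colours `q` of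
the values of `τ`, where all labels of other colours are replaced by units, is the sum of the
injective traffic states over the cactus quotients with monochromatic pads. -/
theorem IsCactusType.prod_τ_eq [Fintype Q] [Fintype (Setoid V)] (ha : T.IsCactusType a)
    {G : ConnGraph V E} {c : E → Q} (hW : G.IsTreeLike c) (γ : E → I) :
    ∏ q, T.τ G (fun e => if c e = q then a (γ e) else 1) =
      ∑ π with (G.quotient π).IsCactus ∧ G.IsMonochromatic c π,
        T.injective (G.quotient π) (fun e => a (γ e)) := by
  simp only [T.τ_contract G c, T.τ_piece]
  rw [Fintype.prod_sum]
  have h₁ : ∀ f : ∀ q, {π : Setoid V // G.offColor c q ≤ π},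
      ∏ q, T.injective (G.piece c q (f q).1 (f q).2) (fun e => a (γ e.1)) =
        T.injective (G.quotient (hW.splitEquiv.symm f).1) (fun e => a (γ e)) :=
    fun f => (ha.injective_iInf hW (f := fun q => (f q).1) (fun q => (f q).2) γ).symm
  simp only [h₁]
  rw [hW.splitEquiv.symm.sum_comp
    (fun π => T.injective (G.quotient π.1) (fun e => a (γ e)))]
  rw [← Finset.sum_subtype (Finset.univ.filter (G.Splits c)) (by simp)
    (fun π => T.injective (G.quotient π) (fun e => a (γ e)))]
  symm
  refine Finset.sum_subset_zero_on_sdiff (fun π hπ => ?_) (fun π hπ => ?_) fun _ _ => rfl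
  · simp only [Finset.mem_filter, Finset.mem_univ, true_and] at hπ ⊢
    exact splits_of_isCactus hπ.1 hπ.2
  · simp only [Finset.mem_sdiff, Finset.mem_filter, Finset.mem_univ, true_and, not_and] at hπ
    refine (ha _ _ _ γ).1 fun hK => hπ.2 hK ?_
    intro C hC e he e' he'
    rw [hπ.1] at hC
    exact hW.color_eq (fun q => le_sup_right) hC he he'

end TrafficState

/-! ### Quotients of cycles and non-crossing partitions -/

namespace ConnGraph

open Multidigraph

variable {V E : Type}

/-- The partition of the edges of a cactus into its pads. -/
def IsCactus.padSetoid {G : ConnGraph V E} (h : G.IsCactus) : Setoid E where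
  r e e' := ∃ C, G.IsSimpleCycle C ∧ e ∈ C ∧ e' ∈ C
  iseqv := by
    refine ⟨fun e => ?_, ?_, ?_⟩
    · obtain ⟨C, ⟨hC, he⟩, -⟩ := h e
      exact ⟨C, hC, he, he⟩
    · rintro e e' ⟨C, hC, he, he'⟩
      exact ⟨C, hC, he', he⟩
    · rintro e₁ e₂ e₃ ⟨C, hC, h₁, h₂⟩ ⟨C', hC', h₂', h₃⟩
      obtain rfl := h.eq hC hC' h₂ h₂'
      exact ⟨C, hC, h₁, h₃⟩

theorem IsCactus.padSetoid_le_iff {G : ConnGraph V E} {π : Setoid V} (h : (G.quotient π).IsCactus)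
    (σ : Setoid E) : h.padSetoid ≤ σ ↔ G.IsMonochromatic (Quotient.mk σ) π := by
  constructor
  · intro hle C hC e he e' he'
    exact Quotient.sound (hle ⟨C, hC, he, he'⟩)
  · rintro hm e e' ⟨C, hC, he, he'⟩
    exact Quotient.exact (hm C hC e he e' he')

/-- `G` is the cycle of length `m + 1` up to the orientation of its edges. -/
def IsCyclic {m : ℕ} (G : ConnGraph (Fin (m + 1)) (Fin (m + 1))) : Prop :=
  ∀ k, s(G.src k, G.tgt k) = s(k, k + 1)

variable {m : ℕ} {G : ConnGraph (Fin (m + 1)) (Fin (m + 1))}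

theorem IsCyclic.conn_step (hG : G.IsCyclic) (π : Setoid (Fin (m + 1))) {F : Set (Fin (m + 1))}
    {k : Fin (m + 1)} (hk : k ∈ F) :
    (G.quotient π).conn F (Quotient.mk π k) (Quotient.mk π (k + 1)) := by
  have h := conn_of_mem (G := (G.quotient π).toMultidigraph) hk
  rw [quotient_src, quotient_tgt] at h
  rcases Sym2.eq_iff.1 (hG k) with ⟨h₁, h₂⟩ | ⟨h₁, h₂⟩
  · rwa [h₁, h₂] at h
  · rw [h₁, h₂] at h; exact Setoid.symm' _ h

theorem IsCyclic.not_conn (hG : G.IsCyclic) {π : Setoid (Fin (m + 1))}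
    (hK : (G.quotient π).IsCactus) {k l : Fin (m + 1)} (hkl : hK.padSetoid k l) (hne : k ≠ l) :
    ¬ (G.quotient π).conn {k, l}ᶜ (Quotient.mk π k) (Quotient.mk π (k + 1)) := by
  obtain ⟨C, hC, hk, hl⟩ := hkl
  intro h
  refine hK.not_conn hC hk hl hne ?_
  rw [quotient_src, quotient_tgt]
  rcases Sym2.eq_iff.1 (hG k) with ⟨h₁, h₂⟩ | ⟨h₁, h₂⟩
  · rwa [h₁, h₂]
  · rw [h₁, h₂]; exact Setoid.symm' _ h

theorem IsCyclic.visits (hG : G.IsCyclic) (π : Setoid (Fin (m + 1))) {C : Set (Fin (m + 1))}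
    {k : Fin (m + 1)} (hk : k ∈ C) : (G.quotient π).Visits C (Quotient.mk π k) := by
  rcases Sym2.eq_iff.1 (hG k) with ⟨h₁, -⟩ | ⟨-, h₂⟩
  · exact ⟨k, hk, .inl (by rw [quotient_src, h₁])⟩
  · exact ⟨k, hk, .inr (by rw [quotient_tgt, h₂])⟩

/-- The pads of a cactus quotient of a cycle form a non-crossing partition. -/
theorem IsCyclic.padSetoid_noncrossing (hG : G.IsCyclic) {π : Setoid (Fin (m + 1))}
    (hK : (G.quotient π).IsCactus) (i j k l : Fin (m + 1)) (hij : i < j) (hjk : j < k) (hkl : k < l)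
    (hik : hK.padSetoid i k) (hjl : hK.padSetoid j l) : hK.padSetoid i j := by
  by_contra hne
  have hcut := hG.not_conn hK hik (hij.trans hjk).ne
  obtain ⟨C, hC, hj, hl⟩ := hjl
  have hiC : i ∉ C := fun hi => hne ⟨C, hC, hi, hj⟩
  have hkC : k ∉ C := fun hk =>
    hne (Setoid.trans' _ hik ⟨C, hC, hk, hj⟩)
  set s := (G.quotient π).conn {i, k}ᶜ
  have hstep : ∀ x, x ≠ i → x ≠ k → s (Quotient.mk π x) (Quotient.mk π (x + 1)) := fun x hx hx' =>
    hG.conn_step π (by simp [hx, hx'])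
  obtain ⟨h₁, h₂⟩ := setoid_of_cyclic_steps s (Quotient.mk π) (hij.trans hjk).le hstep
  have hi1 : i.1 + 1 = (i + 1).1 := (Fin.val_add_one_of_lt' (by omega)).symm
  have a₁ : s (Quotient.mk π (i + 1)) (Quotient.mk π k) :=
    h₁ _ (by rw [Fin.lt_def]; omega) (by rw [Fin.le_def]; omega)
  have a₂ : s (Quotient.mk π j) (Quotient.mk π k) := h₁ _ hij hjk.le
  have a₃ : s (Quotient.mk π l) (Quotient.mk π i) := h₂ _ (.inr hkl)
  have a₄ : s (Quotient.mk π j) (Quotient.mk π l) := by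
    refine conn_mono ?_ (hC.conn i (hG.visits π hj) (hG.visits π hl))
    rintro x ⟨hx, -⟩ (rfl | rfl)
    exacts [hiC hx, hkC hx]
  exact hcut (Setoid.symm' _ (Setoid.trans' _ a₁ (Setoid.trans' _ (Setoid.symm' _ a₂)
    (Setoid.trans' _ a₄ a₃))))

/-- Only the trivial quotient of a cycle is a cactus with a single pad. -/
theorem IsCyclic.padSetoid_eq_top_iff (hG : G.IsCyclic) {π : Setoid (Fin (m + 1))}
    (hK : (G.quotient π).IsCactus) : hK.padSetoid = ⊤ ↔ π = ⊥ := by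
  constructor
  · intro htop
    have key : ∀ v w, v < w → ¬ π v w := by
      intro v w hvw hπ
      have hcut := hG.not_conn hK (k := v) (l := w) (by rw [htop]; trivial) hvw.ne
      set s := (G.quotient π).conn {v, w}ᶜ
      have hstep : ∀ x, x ≠ v → x ≠ w → s (Quotient.mk π x) (Quotient.mk π (x + 1)) :=
        fun x hx hx' => hG.conn_step π (by simp [hx, hx'])
      have h₁ := (setoid_of_cyclic_steps s (Quotient.mk π) hvw.le hstep).1
      have hi1 : v.1 + 1 = (v + 1).1 := (Fin.val_add_one_of_lt' (by omega)).symm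
      have a₁ := h₁ (v + 1) (by rw [Fin.lt_def]; omega) (by rw [Fin.le_def]; omega)
      have h₂ : Quotient.mk π v = Quotient.mk π w := Quotient.sound hπ
      rw [← h₂] at a₁
      exact hcut (Setoid.symm' _ a₁)
    refine le_antisymm (fun v w h => ?_) bot_le
    rcases lt_trichotomy v w with hvw | hvw | hvw
    · exact absurd h (key _ _ hvw)
    · exact hvw
    · exact absurd (Setoid.symm' _ h) (key _ _ hvw)
  · rintro rfl
    have hC : (G.quotient ⊥).IsSimpleCycle Set.univ := by
      refine ⟨m, Quotient.mk ⊥, id, fun v w h => Quotient.exact h, Function.injective_id,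
        fun i => ?_, Set.range_id⟩
      have := congrArg (Sym2.map (Quotient.mk ⊥)) (hG i)
      rwa [Sym2.map_mk, Sym2.map_mk] at this
    exact le_antisymm le_top fun e e' _ => ⟨_, hC, trivial, trivial⟩

theorem IsCyclic.exists_of_not_conn (hG : G.IsCyclic) {F : Set (Fin (m + 1))} {v w : Fin (m + 1)}
    (h : ¬ G.conn F v w) :
    (∃ k, k ∉ F ∧ min v.1 w.1 ≤ k.1 ∧ k.1 < max v.1 w.1) ∧
      ∃ k, k ∉ F ∧ (k.1 < min v.1 w.1 ∨ max v.1 w.1 ≤ k.1) := by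
  have hstep : ∀ k ∈ F, G.conn F k (k + 1) := fun k hk => src_mem_sym2 (hG k) (conn_of_mem hk)
  by_contra hcon
  rw [not_and_or] at hcon
  push Not at hcon
  apply h
  rcases le_total v w with hvw | hvw
  · have hvw' : v.1 ≤ w.1 := hvw
    rw [min_eq_left hvw', max_eq_right hvw'] at hcon
    refine setoid_of_arc _ id hvw ?_
    rcases hcon with hcon | hcon
    · exact .inl fun k h₁ h₂ => hstep k (by
        by_contra hk
        exact absurd h₂ (not_lt.2 (hcon k hk h₁)))
    · exact .inr fun k h₁ => hstep k (by
        by_contra hk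
        have := hcon k hk
        rw [Fin.lt_def, Fin.le_def] at h₁
        omega)
  · have hvw' : w.1 ≤ v.1 := hvw
    rw [min_eq_right hvw', max_eq_left hvw'] at hcon
    refine Setoid.symm' _ (setoid_of_arc _ id hvw ?_)
    rcases hcon with hcon | hcon
    · exact .inl fun k h₁ h₂ => hstep k (by
        by_contra hk
        exact absurd h₂ (not_lt.2 (hcon k hk h₁)))
    · exact .inr fun k h₁ => hstep k (by
        by_contra hk
        have := hcon k hk
        rw [Fin.lt_def, Fin.le_def] at h₁
        omega)

/-- Positions on a cycle: if `g₁` and `g₂` lie on different arcs between `v` and `e`, and `k₁` and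
`k₂` lie on different arcs between `v` and `f`, then some pair from `f`, `g₁`, `g₂` separates `e` from
`k₁` or `k₂`. -/
theorem exists_separating_pair {v e f g₁ g₂ k₁ k₂ : ℕ} (hef : e ≠ f) (heg₂ : e ≠ g₂)
    (hk₁f : k₁ ≠ f) (h₁ : min v e ≤ g₁ ∧ g₁ < max v e) (heg₁ : e ≠ g₁)
    (h₂ : g₂ < min v e ∨ max v e ≤ g₂) (h₃ : min v f ≤ k₁ ∧ k₁ < max v f)
    (h₄ : k₂ < min v f ∨ max v f ≤ k₂)
    (s : ∀ g g', (g = g₁ ∨ g = g₂ ∨ g = f) → (g' = g₁ ∨ g' = g₂ ∨ g' = f) →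
      ∀ k, k = k₁ ∨ k = k₂ → (g < e ∧ e < g' ↔ g < k ∧ k < g')) : False := by
  rcases le_or_gt v e with c₁ | c₁
  · rw [min_eq_left c₁, max_eq_right c₁] at h₁ h₂
    rcases lt_or_gt_of_ne hef with c₂ | c₂
    · have := s g₁ f (by simp) (by simp) k₂ (by simp)
      omega
    rcases le_or_gt v f with c₃ | c₃
    · have a₁ := s f g₂ (by simp) (by simp) k₁ (by simp)
      have a₂ := s g₂ f (by simp) (by simp) k₁ (by simp)
      omega
    · have a₁ := s g₁ g₂ (by simp) (by simp) k₁ (by simp)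
      have a₂ := s f g₁ (by simp) (by simp) k₁ (by simp)
      omega
  · rw [min_eq_right c₁.le, max_eq_left c₁.le] at h₁ h₂
    rcases lt_or_gt_of_ne hef with c₂ | c₂
    · rcases le_or_gt v f with c₃ | c₃
      · have a₁ := s g₂ g₁ (by simp) (by simp) k₁ (by simp)
        have a₂ := s g₁ f (by simp) (by simp) k₁ (by simp)
        omega
      · have a₁ := s g₂ f (by simp) (by simp) k₁ (by simp)
        have a₂ := s f g₂ (by simp) (by simp) k₁ (by simp)
        omega
    · have := s f g₁ (by simp) (by simp) k₂ (by simp)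
      omega

/-- A colouring of a cycle by the blocks of a non-crossing partition is tree-like. -/
theorem IsCyclic.isTreeLike (hG : G.IsCyclic) (σ : NC (m + 1)) :
    G.IsTreeLike (Quotient.mk σ.1) := by
  intro p q hpq
  obtain ⟨e, he⟩ := Quotient.exists_rep p
  obtain ⟨f, hf⟩ := Quotient.exists_rep q
  refine ⟨e, f, fun v => ?_⟩
  by_contra hcon
  rw [not_or] at hcon
  -- A block of one colour does not separate edges of the other colour.
  have sep : ∀ g g' h h' : Fin (m + 1), Quotient.mk σ.1 g = q → Quotient.mk σ.1 g' = q →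
      Quotient.mk σ.1 h = p → Quotient.mk σ.1 h' = p → g.1 < h.1 → h.1 < g'.1 →
      g.1 < h'.1 ∧ h'.1 < g'.1 := by
    intro g g' h h' hg hg' hh hh' h₁ h₂
    have n₁ : h'.1 ≠ g.1 := fun e => hpq (by rw [← hh', ← hg, Fin.ext e])
    have n₂ : h'.1 ≠ g'.1 := fun e => hpq (by rw [← hh', ← hg', Fin.ext e])
    refine ⟨lt_of_le_of_ne (not_lt.1 fun h₃ => ?_) n₁.symm,
      lt_of_le_of_ne (not_lt.1 fun h₃ => ?_) n₂⟩
    · have := σ.2 h' g h g' h₃ h₁ h₂ (Quotient.exact (hh'.trans hh.symm))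
        (Quotient.exact (hg.trans hg'.symm))
      exact hpq (by rw [← hh', ← hg]; exact Quotient.sound this)
    · have := σ.2 g h g' h' h₁ h₂ h₃ (Quotient.exact (hg.trans hg'.symm))
        (Quotient.exact (hh.trans hh'.symm))
      exact hpq (by rw [← hh, ← hg]; exact (Quotient.sound this).symm)
  obtain ⟨⟨g₁, hg₁, h₁⟩, ⟨g₂, hg₂, h₂⟩⟩ := hG.exists_of_not_conn hcon.1
  obtain ⟨⟨k₁, hk₁, h₃⟩, ⟨k₂, hk₂, h₄⟩⟩ := hG.exists_of_not_conn hcon.2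
  simp only [Set.mem_ofPred_eq, not_not] at hg₁ hg₂ hk₁ hk₂
  have hef : e.1 ≠ f.1 := fun h => hpq (by rw [← he, ← hf, Fin.ext h])
  have hfq : ∀ g : Fin (m + 1), g.1 = g₁.1 ∨ g.1 = g₂.1 ∨ g.1 = f.1 → Quotient.mk σ.1 g = q := by
    rintro g (h | h | h)
    · rw [Fin.ext h, hg₁]
    · rw [Fin.ext h, hg₂]
    · rw [Fin.ext h, hf]
  have hne : ∀ k g : Fin (m + 1), Quotient.mk σ.1 k = p → Quotient.mk σ.1 g = q → k.1 ≠ g.1 :=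
    fun k g hk hg h => hpq (by rw [← hk, ← hg, Fin.ext h])
  refine exists_separating_pair hef (hne _ _ he hg₂) (hne _ _ hk₁ hf) h₁ (hne _ _ he hg₁) h₂ h₃ h₄ ?_
  intro g g' hg hg' k hk
  have hgm : g < m + 1 := by omega
  have hgm' : g' < m + 1 := by omega
  have hkm : k < m + 1 := by omega
  have hk' : Quotient.mk σ.1 (⟨k, hkm⟩ : Fin (m + 1)) = p := by
    rcases hk with rfl | rfl
    exacts [hk₁, hk₂]
  exact ⟨fun h => sep ⟨g, hgm⟩ ⟨g', hgm'⟩ e ⟨k, hkm⟩ (hfq _ hg) (hfq _ hg') he hk' h.1 h.2,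
    fun h => sep ⟨g, hgm⟩ ⟨g', hgm'⟩ ⟨k, hkm⟩ e (hfq _ hg) (hfq _ hg') hk' he h.1 h.2⟩

end ConnGraph

/-! ### Free cumulants -/

theorem prod_filter_eq {R : Type*} [Monoid R] {ι : Type*} (l : List ι) (p : ι → Prop)
    [DecidablePred p] (a : ι → R) :
    ((l.filter p).map a).prod = (l.map fun i => if p i then a i else 1).prod := by
  induction l with
  | nil => simp
  | cons i l ih =>
    by_cases h : p i <;> simp [h, ih]

namespace TrafficState

open ConnGraph GAlgebra

variable {A : Type*} [GAlgebra A] {T : TrafficState A} {I : Type*} {a : I → A}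

theorem isCyclic_reverse_cycle {m : ℕ} (t : Fin (m + 1) → Bool) :
    ((cycle (m + 1)).reverse t).IsCyclic := by
  intro k
  by_cases ht : t k
  · simp [reverse, cycle, ht]
  · simp [reverse, cycle, ht, Sym2.eq_swap]

open scoped Classical in
/-- The partitioned moments of a family of cactus type. -/
theorem IsCactusType.partitionMoment_eq (ha : T.IsCactusType a) {m : ℕ} (i : Fin (m + 1) → I)
    (t : Fin (m + 1) → Bool) (σ : NC (m + 1)) [Fintype (Setoid (Fin (m + 1)))] :
    partitionMoment T.φ σ (fun k => if t k then transpose (a (i k)) else a (i k)) =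
      ∑ π with ∃ h : (((cycle (m + 1)).reverse t).quotient π).IsCactus, h.padSetoid ≤ σ.1,
        T.injective (((cycle (m + 1)).reverse t).quotient π) (fun k => a (i k)) := by
  have hG := isCyclic_reverse_cycle t
  let _ := Fintype.ofFinite (Quotient σ.1)
  have h := ha.prod_τ_eq (hG.isTreeLike σ) i
  have hfil : (Finset.univ.filter fun π =>
      ∃ h : (((cycle (m + 1)).reverse t).quotient π).IsCactus, h.padSetoid ≤ σ.1) =
      Finset.univ.filter fun π => (((cycle (m + 1)).reverse t).quotient π).IsCactus ∧
        ((cycle (m + 1)).reverse t).IsMonochromatic (Quotient.mk σ.1) π := by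
    ext π
    simp only [Finset.mem_filter, Finset.mem_univ, true_and]
    exact ⟨fun ⟨h, h'⟩ => ⟨h, (h.padSetoid_le_iff _).1 h'⟩,
      fun ⟨h, h'⟩ => ⟨h, (h.padSetoid_le_iff _).2 h'⟩⟩
  rw [hfil]
  refine Eq.trans ?_ h
  unfold partitionMoment
  rw [finprod_eq_prod_of_fintype]
  refine Finset.prod_congr rfl fun B _ => ?_
  rw [← T.τ_flip, prod_filter_eq, ← List.ofFn_eq_map, T.φ_prod]
  congr 1
  funext k
  by_cases hk : Quotient.mk σ.1 k = B
  · simp only [hk, if_true]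
  · simp only [hk, if_false, transpose_one, ite_self]

instance (n : ℕ) : Finite (NC n) := Subtype.finite

/-- The free cumulants of a family of cactus type, and of its transposes, are the injective traffic
states of the cycles. -/
theorem IsCactusType.freeCumulant_eq (ha : T.IsCactusType a) (n : ℕ) [NeZero n] (i : Fin n → I)
    (t : Fin n → Bool) :
    freeCumulant T.φ (fun k => if t k then transpose (a (i k)) else a (i k)) =
      T.injective (cycle n) (fun k => if t k then transpose (a (i k)) else a (i k)) := by
  classical
  obtain ⟨m, rfl⟩ : ∃ m, n = m + 1 := ⟨n - 1, by have := NeZero.pos n; omega⟩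
  have hG := isCyclic_reverse_cycle t
  let _ := Fintype.ofFinite (Setoid (Fin (m + 1)))
  let _ := Fintype.ofFinite (NC (m + 1))
  rw [T.injective_flip (cycle (m + 1)) t (fun k => a (i k))]
  unfold freeCumulant partitionCumulant
  have hone : ∀ σ : NC (m + 1), σ ≤ NC.one (m + 1) := fun σ => (le_top : σ.1 ≤ ⊤)
  rw [finsum_eq_sum_of_fintype, ← Finset.sum_subtype Finset.univ (by simp [hone])
    (fun σ : NC (m + 1) => partitionMoment T.φ σ
      (fun k => if t k then transpose (a (i k)) else a (i k)) * moebius σ (NC.one (m + 1)))]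
  set G := (cycle (m + 1)).reverse t with hGdef
  set w : Setoid (Fin (m + 1)) → ℂ := fun π => T.injective (G.quotient π) (fun k => a (i k)) with hw
  simp only [ha.partitionMoment_eq, Finset.sum_filter, Finset.sum_mul, ite_mul, zero_mul]
  rw [Finset.sum_comm]
  -- Only the cactus quotients with a single pad survive Möbius inversion.
  have hπ : ∀ π : Setoid (Fin (m + 1)),
      (∑ σ : NC (m + 1), if ∃ h : (G.quotient π).IsCactus, h.padSetoid ≤ σ.1 then
        w π * moebius σ (NC.one (m + 1)) else 0) = if π = ⊥ then w π else 0 := by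
    intro π
    by_cases hK : (G.quotient π).IsCactus
    · let P : NC (m + 1) := ⟨hK.padSetoid, hG.padSetoid_noncrossing hK⟩
      have h₁ : ∀ σ : NC (m + 1), (∃ h : (G.quotient π).IsCactus, h.padSetoid ≤ σ.1) ↔ P ≤ σ :=
        fun σ => ⟨fun ⟨_, h⟩ => h, fun h => ⟨hK, h⟩⟩
      simp only [h₁]
      rw [← Finset.sum_filter, ← Finset.mul_sum, sum_moebius_left]
      have h₂ : P = NC.one (m + 1) ↔ π = ⊥ := by
        rw [← hG.padSetoid_eq_top_iff hK]
        exact ⟨fun h => congrArg Subtype.val h, fun h => Subtype.ext h⟩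
      simp only [h₂, mul_ite, mul_one, mul_zero]
    · have h₁ : w π = 0 := (ha _ _ _ i).1 hK
      simp [h₁]
  rw [Finset.sum_congr rfl fun π _ => hπ π]
  simp only [Finset.sum_ite_eq', Finset.mem_univ, if_true]
  obtain ⟨g, hg⟩ : ∃ g : Fin (m + 1) ≃ Quotient (⊥ : Setoid (Fin (m + 1))),
      ∀ v, g v = Quotient.mk _ v :=
    ⟨Equiv.ofBijective (Quotient.mk ⊥) ⟨fun u v h => Quotient.exact h, Quotient.mk_surjective⟩,
      fun v => rfl⟩
  exact T.injective_iso G (G.quotient ⊥) g (Equiv.refl _) (fun e => (hg _).symm)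
    (fun e => (hg _).symm) _

end TrafficState

/-! ### Cyclic arrangements of factors in a cactus -/

namespace ConnGraph

open Multidigraph

variable {V E : Type} {n : ℕ}

/-- The edges of `K` are distributed over factors arranged in a cycle: the factor `k` joins `u k`
to `u (k + 1)`, and each of its vertices is connected to them inside the factor. -/
structure IsArrangement (K : ConnGraph V E) (c : E → Fin (n + 1)) (u : Fin (n + 1) → V) : Prop where
  step : ∀ k, K.conn {e | c e = k} (u k) (u (k + 1))
  src : ∀ e, K.conn {f | c f = c e} (K.src e) (u (c e))

/-- After removal of the edge `e` of the factor `k`, its source is joined inside the factor to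
`x` and its target to `y`. -/
def Bridges (K : ConnGraph V E) (c : E → Fin (n + 1)) (e : E) (x y : V) : Prop :=
  K.conn ({f | c f = c e} \ {e}) (K.src e) x ∧ K.conn ({f | c f = c e} \ {e}) (K.tgt e) y

/-- Each edge of the factor `k` is crossed by the passage from `u (k + 1)` to `u k`. -/
def IsThin (K : ConnGraph V E) (c : E → Fin (n + 1)) (u : Fin (n + 1) → V) (k : Fin (n + 1)) : Prop :=
  ∀ e, c e = k → K.Bridges c e (u (k + 1)) (u k) ∨ K.Bridges c e (u k) (u (k + 1))

/-- No single edge separates `u k` from `u (k + 1)` inside the factor `k`. -/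
def IsThick (K : ConnGraph V E) (c : E → Fin (n + 1)) (u : Fin (n + 1) → V) (k : Fin (n + 1)) :
    Prop :=
  ∀ e, K.conn ({f | c f = k} \ {e}) (u k) (u (k + 1))

variable {K : ConnGraph V E} {c : E → Fin (n + 1)} {u : Fin (n + 1) → V}

theorem IsArrangement.visits (hA : K.IsArrangement c u) {e : E} {F : Set E}
    (hF : {f | c f = c e} ⊆ F) {C : Set E} (he : e ∈ C) :
    ∃ v, K.Visits C v ∧ K.conn F v (u (c e)) :=
  ⟨K.src e, visits_src he, conn_mono hF (hA.src e)⟩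

theorem subset_compl_pair {k : Fin (n + 1)} {e e' : E} (h : k ≠ c e) (h' : k ≠ c e') :
    {f | c f = k} ⊆ ({e, e'}ᶜ : Set E) := by
  rintro f hf (rfl | rfl)
  exacts [h hf.symm, h' hf.symm]

theorem diff_subset_compl_pair {e e' : E} (h : c e ≠ c e') :
    {f | c f = c e} \ {e} ⊆ ({e, e'}ᶜ : Set E) := by
  rintro f ⟨hf, hf'⟩ (rfl | rfl)
  exacts [hf' rfl, h hf.symm]

/-- Away from `e` and `e'`, the two ends of the factor of `e` are separated if `e` and `e'` are in
the same pad, but in different factors. -/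
theorem IsThin.not_conn (hK : K.IsCactus) {C : Set E} (hC : K.IsSimpleCycle C) {e e' : E}
    (he : e ∈ C) (he' : e' ∈ C) (hne : c e ≠ c e') (ht : K.IsThin c u (c e)) :
    ¬ K.conn {e, e'}ᶜ (u (c e)) (u (c e + 1)) := by
  intro h
  refine hK.not_conn hC he he' (fun h => hne (by rw [h])) ?_
  have hsub := diff_subset_compl_pair hne
  rcases ht e rfl with ⟨h₁, h₂⟩ | ⟨h₁, h₂⟩
  · exact Setoid.trans' _ (conn_mono hsub h₁) (Setoid.trans' _ (Setoid.symm' _ h)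
      (Setoid.symm' _ (conn_mono hsub h₂)))
  · exact Setoid.trans' _ (conn_mono hsub h₁) (Setoid.trans' _ h
      (Setoid.symm' _ (conn_mono hsub h₂)))

theorem IsArrangement.steps (hA : K.IsArrangement c u) {e e' : E} (k : Fin (n + 1))
    (h : k ≠ c e) (h' : k ≠ c e') : K.conn {e, e'}ᶜ (u k) (u (k + 1)) :=
  conn_mono (subset_compl_pair h h') (hA.step k)

/-- Pads are non-crossing: a pad joining two thin factors separates the factors between them from the
others. -/
theorem IsArrangement.noncrossing (hA : K.IsArrangement c u) (hK : K.IsCactus) {C C' : Set E}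
    (hC : K.IsSimpleCycle C) (hC' : K.IsSimpleCycle C') (hne : C ≠ C') {e e' f f' : E}
    (he : e ∈ C) (he' : e' ∈ C) (hf : f ∈ C') (hf' : f' ∈ C') (ht : K.IsThin c u (c e))
    (h₁ : c e < c f) (h₂ : c f < c e') (h₃ : c f' < c e ∨ c e' < c f') : False := by
  have hcut := IsThin.not_conn hK hC he he' (h₁.trans h₂).ne ht
  have heC' : e ∉ C' := fun h => hne (hK.eq hC hC' he h)
  have heC'' : e' ∉ C' := fun h => hne (hK.eq hC hC' he' h)
  set s := K.conn {e, e'}ᶜ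
  obtain ⟨a₁, a₂⟩ := setoid_of_cyclic_steps s u (h₁.trans h₂).le fun k h h' => hA.steps k h h'
  have hi1 : (c e).1 + 1 = (c e + 1).1 := (Fin.val_add_one_of_lt' (by omega)).symm
  have b₁ : s (u (c e + 1)) (u (c e')) := a₁ _ (by rw [Fin.lt_def]; omega) (by rw [Fin.le_def]; omega)
  have b₂ : s (u (c f)) (u (c e')) := a₁ _ h₁ h₂.le
  have b₃ : s (u (c f')) (u (c e)) := a₂ _ (h₃.imp le_of_lt id)
  obtain ⟨v, hv, hvf⟩ := hA.visits (subset_compl_pair (e := e) (e' := e') h₁.ne' h₂.ne) hf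
  obtain ⟨w, hw, hwf⟩ := hA.visits (subset_compl_pair (e := e) (e' := e')
    (h₃.elim LT.lt.ne fun h => ((h₁.trans h₂).trans h).ne')
    (h₃.elim (fun h => (h.trans (h₁.trans h₂)).ne) LT.lt.ne')) hf'
  have b₄ : s v w := by
    refine conn_mono ?_ (hC'.conn e hv hw)
    rintro x ⟨hx, -⟩ (rfl | rfl)
    exacts [heC' hx, heC'' hx]
  have b₅ : s (u (c f)) (u (c f')) :=
    Setoid.trans' _ (Setoid.symm' _ hvf) (Setoid.trans' _ b₄ hwf)
  exact hcut (Setoid.symm' _ (Setoid.trans' _ b₁ (Setoid.trans' _ (Setoid.symm' _ b₂)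
    (Setoid.trans' _ b₅ b₃))))

/-- In a cactus, both ends of a thick factor coincide. -/
theorem IsArrangement.eq_of_isThick (hA : K.IsArrangement c u) (hK : K.IsCactus) {k : Fin (n + 1)}
    (ht : K.IsThick c u k) : u k = u (k + 1) := by
  by_contra hne
  obtain ⟨-, -, e, -, e', -, -, hcut⟩ := hK.exists_cut hne
  by_cases he : c e = k
  · by_cases he' : c e' = k
    · -- Both edges of the cut are in the factor, so that the other factors join its ends.
      exact hcut (setoid_of_cyclic_steps_ne _ u k
        (fun l hl => hA.steps l (he ▸ hl) (he' ▸ hl)) _ _)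
    · refine hcut (conn_mono ?_ (ht e))
      rintro f ⟨hf, hf'⟩ (rfl | rfl)
      exacts [hf' rfl, he' hf]
  · refine hcut (conn_mono ?_ (ht e'))
    rintro f ⟨hf, hf'⟩ (rfl | rfl)
    exacts [he hf, hf' rfl]

/-- A pad does not join a thin factor to a thick one. -/
theorem IsArrangement.not_thin_thick (hA : K.IsArrangement c u) (hK : K.IsCactus) {C : Set E}
    (hC : K.IsSimpleCycle C) {e e' : E} (he : e ∈ C) (he' : e' ∈ C) (hne : c e ≠ c e')
    (ht : K.IsThin c u (c e)) (ht' : K.IsThick c u (c e')) : False := by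
  refine IsThin.not_conn hK hC he he' hne ht
    (setoid_of_cyclic_steps_ne _ u (c e) (fun l hl => ?_) _ _)
  by_cases hl' : l = c e'
  · rw [hl', ← hA.eq_of_isThick hK ht']
  · exact hA.steps l hl hl'

/-- A directed pad does not join two factors whose edges have opposite orientations. -/
theorem IsArrangement.not_opposite (hA : K.IsArrangement c u) (hK : K.IsCactus) {C : Set E}
    (hC : K.IsSimpleCycle C) (hdir : K.IsDirectedCycle C) {e e' : E} (he : e ∈ C) (he' : e' ∈ C)
    (hne : c e ≠ c e') (ht : K.Bridges c e (u (c e + 1)) (u (c e)))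
    (ht' : K.Bridges c e' (u (c e')) (u (c e' + 1))) : False := by
  have hsub := diff_subset_compl_pair hne
  have hsub' : {f | c f = c e'} \ {e'} ⊆ ({e, e'}ᶜ : Set E) := by
    rw [Set.pair_comm]; exact diff_subset_compl_pair hne.symm
  refine hK.not_conn hC he he' (fun h => hne (by rw [h])) ?_
  have a₁ := hdir.conn he he' (fun h => hne (by rw [h]))
  have a₂ := setoid_of_cyclic_arc (K.conn {e, e'}ᶜ) u hne fun k h h' => hA.steps k h h'
  exact Setoid.trans' _ (conn_mono hsub ht.1) (Setoid.trans' _ a₂ (Setoid.trans' _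
    (Setoid.symm' _ (conn_mono hsub' ht'.1)) (Setoid.symm' _ a₁)))

variable (K c) in
/-- Every pad that meets the factor `k` is contained in it; a factor without edges is isolated. -/
def IsIsolated (k : Fin (n + 1)) : Prop :=
  ∀ C, K.IsSimpleCycle C → ∀ e ∈ C, ∀ e' ∈ C, c e = k → c e' = k

/-- If consecutive factors have different types, pads only join factors of the same type, and all
factors of one type are thin, then some factor is isolated. -/
theorem IsArrangement.exists_isIsolated (hA : K.IsArrangement c u) (hK : K.IsCactus)
    (ty : Fin (n + 1) → Bool) (halt : ∀ k : Fin n, ty k.castSucc ≠ ty k.succ)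
    (hty : ∀ C, K.IsSimpleCycle C → ∀ e ∈ C, ∀ e' ∈ C, ty (c e) = ty (c e'))
    (hthin : ∀ k, ty k = true → K.IsThin c u k) : ∃ k, K.IsIsolated c k := by
  by_contra hno
  push Not at hno
  have hlink : ∀ k, ∃ C, K.IsSimpleCycle C ∧ ∃ e ∈ C, ∃ e' ∈ C, c e = k ∧ c e' ≠ k := by
    intro k
    have := hno k
    unfold IsIsolated at this
    push Not at this
    exact this
  -- Two linked factors at minimal distance.
  have hex : ∃ d : ℕ, ∃ C, K.IsSimpleCycle C ∧ ∃ e ∈ C, ∃ e' ∈ C, (c e).1 + d = (c e').1 ∧ d ≠ 0 := by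
    obtain ⟨C, hC, e, he, e', he', h₁, h₂⟩ := hlink 0
    refine ⟨(c e').1, C, hC, e, he, e', he', by rw [h₁]; simp, fun h => h₂ (Fin.ext h)⟩
  classical
  obtain ⟨C, hC, e, he, e', he', hd, hd₀⟩ := Nat.find_spec hex
  set d := Nat.find hex
  have hmin : ∀ C, K.IsSimpleCycle C → ∀ e ∈ C, ∀ e' ∈ C, (c e).1 < (c e').1 →
      (c e).1 + d ≤ (c e').1 := by
    intro C hC e he e' he' hlt
    by_contra hcon
    exact Nat.find_min hex (m := (c e').1 - (c e).1) (show _ < d by omega)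
      ⟨C, hC, e, he, e', he', by omega, by omega⟩
  have hlt := (c e).2
  have hlt' := (c e').2
  have hty₀ : ty (c e) = ty (c e') := hty C hC e he e' he'
  have htys : ∀ k l : Fin (n + 1), k.1 + 1 = l.1 → ty k ≠ ty l := by
    intro k l hkl
    have h := halt ⟨k.1, by omega⟩
    have h₁ : (⟨k.1, by omega⟩ : Fin n).castSucc = k := rfl
    have h₂ : (⟨k.1, by omega⟩ : Fin n).succ = l := Fin.ext hkl
    rwa [h₁, h₂] at h
  have hd₁ : d ≠ 1 := fun h => htys (c e) (c e') (by omega) hty₀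
  obtain ⟨C', hC', f, hf, f', hf', hk, hm⟩ := hlink ⟨(c e).1 + 1, by omega⟩
  have hk' : (c f).1 = (c e).1 + 1 := congrArg Fin.val hk
  have hm' : (c f').1 ≠ (c e).1 + 1 := fun h => hm (Fin.ext h)
  have hty₁ : ty (c e) ≠ ty (c f) := htys _ _ hk'.symm
  have hty₂ : ty (c f) = ty (c f') := hty C' hC' f hf f' hf'
  have hCC : C ≠ C' := fun h => hty₁ (hty C hC e he f (h ▸ hf))
  have hme : (c f').1 ≠ (c e).1 := fun h => hty₁ (by rw [hty₂, Fin.ext h])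
  have hme' : (c f').1 ≠ (c e').1 := fun h => hty₁ (by rw [hty₂, Fin.ext h, hty₀])
  have hout : (c f').1 < (c e).1 ∨ (c e').1 < (c f').1 := by
    rcases lt_or_gt_of_ne hm' with h | h
    · omega
    · have := hmin C' hC' f hf f' hf' (by omega)
      omega
  cases h : ty (c e)
  · -- The inner factor is thin.
    have h' : ty (c f) = true := by
      cases h'' : ty (c f)
      · exact absurd (h.trans h''.symm) hty₁
      · rfl
    rcases hout with h₀ | h₀
    · exact hA.noncrossing hK hC' hC hCC.symm hf' hf he he' (hthin _ (hty₂ ▸ h'))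
        (by rw [Fin.lt_def]; omega) (by rw [Fin.lt_def]; omega) (.inr (by rw [Fin.lt_def]; omega))
    · exact hA.noncrossing hK hC' hC hCC.symm hf hf' he' he (hthin _ h')
        (by rw [Fin.lt_def]; omega) (by rw [Fin.lt_def]; omega) (.inl (by rw [Fin.lt_def]; omega))
  · exact hA.noncrossing hK hC hC' hCC he he' hf hf' (hthin _ h)
      (by rw [Fin.lt_def]; omega) (by rw [Fin.lt_def]; omega) hout

end ConnGraph

/-! ### Classes of graph operations and the subspaces they span -/

namespace ConnGraph

open Multidigraph

variable {V E : Type} {W F : E → Type} (G : ConnGraph V E) (h : ∀ e, GraphOp (W e) (F e))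

/-- A vertex of `G` as a vertex of the substituted graph. -/
def outer (v : V) : G.SubstVertex h := Quot.mk _ (.inl v)

/-- A vertex of the copy of `h e` as a vertex of the substituted graph. -/
def inner (e : E) (w : W e) : G.SubstVertex h := Quot.mk _ (.inr ⟨e, w⟩)

theorem inner_vin (e : E) : G.inner h e (h e).vin = G.outer h (G.src e) :=
  (Quot.sound (.src e)).symm

theorem inner_vout (e : E) : G.inner h e (h e).vout = G.outer h (G.tgt e) :=
  (Quot.sound (.tgt e)).symm

variable {G h}

theorem conn_inner {e : E} {S : Set (F e)} {S' : Set (Σ e, F e)} (hS : ∀ f ∈ S, ⟨e, f⟩ ∈ S')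
    {w w' : W e} (hw : (h e).conn S w w') :
    (G.subst h).conn S' (G.inner h e w) (G.inner h e w') :=
  conn_map (G := (h e).toMultidigraph) (G' := (G.subst h).toMultidigraph) (F := S)
    (G.inner h e) (fun f hf =>
      conn_of_mem (G := (G.subst h).toMultidigraph) (e := ⟨e, f⟩) (hS f hf)) hw

theorem conn_inner_of_fst {e : E} {S' : Set (Σ e, F e)} (hS : {x | x.1 = e} ⊆ S') (w w' : W e) :
    (G.subst h).conn S' (G.inner h e w) (G.inner h e w') :=
  conn_inner (fun _ _ => hS rfl) ((h e).connected.conn_univ w w')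

theorem conn_outer {S : Set E} {S' : Set (Σ e, F e)}
    (hS : ∀ e ∈ S, (G.subst h).conn S' (G.inner h e (h e).vin) (G.inner h e (h e).vout))
    {v v' : V} (hv : G.conn S v v') :
    (G.subst h).conn S' (G.outer h v) (G.outer h v') :=
  conn_map (G.outer h) (fun e he => by
    have := hS e he
    rwa [inner_vin, inner_vout] at this) hv

theorem conn_outer_compl {e : E} {f : F e} {v v' : V} (hv : G.conn {e}ᶜ v v') :
    (G.subst h).conn {⟨e, f⟩}ᶜ (G.outer h v) (G.outer h v') := by
  refine conn_outer (fun e' he' => conn_inner_of_fst ?_ _ _) hv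
  rintro ⟨e'', f'⟩ rfl hx
  exact he' (congrArg Sigma.fst hx)

theorem conn_inner_compl {e : E} {f : F e} {w w' : W e} (hw : (h e).conn {f}ᶜ w w') :
    (G.subst h).conn {⟨e, f⟩}ᶜ (G.inner h e w) (G.inner h e w') := by
  refine conn_inner (S := {f}ᶜ) (S' := {⟨e, f⟩}ᶜ) (fun f' hf' hx => hf' ?_) hw
  simpa using hx

end ConnGraph

namespace GraphOp

open Multidigraph ConnGraph

variable {V E : Type}

/-- The edge `e` is crossed forwards by the passage from the input to the output. -/
def ForwardAt (g : GraphOp V E) (e : E) : Prop :=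
  g.conn {e}ᶜ (g.src e) g.vin ∧ g.conn {e}ᶜ (g.tgt e) g.vout

/-- The edge `e` is crossed backwards by the passage from the input to the output. -/
def BackwardAt (g : GraphOp V E) (e : E) : Prop :=
  g.conn {e}ᶜ (g.src e) g.vout ∧ g.conn {e}ᶜ (g.tgt e) g.vin

/-- All edges are crossed forwards; for example a directed path. -/
def IsForward (g : GraphOp V E) : Prop := ∀ e, g.ForwardAt e

/-- All edges are crossed backwards; for example the transpose of a directed path. -/
def IsBackward (g : GraphOp V E) : Prop := ∀ e, g.BackwardAt e

/-- All edges are crossed by the passage from the input to the output; for example a path. -/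
def IsThin (g : GraphOp V E) : Prop := ∀ e, g.ForwardAt e ∨ g.BackwardAt e

/-- The input and the output are not separated by a single edge. -/
def IsThick (g : GraphOp V E) : Prop := ∀ e, g.conn {e}ᶜ g.vin g.vout

theorem IsTheta.isThick {g : GraphOp V E} (hg : g.IsTheta) : g.IsThick := by
  intro e
  rcases hg with h | ⟨C, hC, h₁, h₂⟩
  · rw [h]
  · exact conn_mono (fun x hx => hx.2) (hC.conn e h₁ h₂)

variable {W F : E → Type} {g : GraphOp V E} {h : ∀ e, GraphOp (W e) (F e)}

theorem conn_subst_src {e : E} {f : F e} {w : W e} {v : V} (h₁ : (h e).conn {f}ᶜ w (h e).vin)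
    (h₂ : g.conn {e}ᶜ (g.src e) v) :
    (g.subst h).conn {⟨e, f⟩}ᶜ (g.inner h e w) (g.outer h v) := by
  have a₁ := conn_inner_compl (G := g.toConnGraph) h₁
  rw [inner_vin] at a₁
  exact Setoid.trans' _ a₁ (conn_outer_compl h₂)

theorem conn_subst_tgt {e : E} {f : F e} {w : W e} {v : V} (h₁ : (h e).conn {f}ᶜ w (h e).vout)
    (h₂ : g.conn {e}ᶜ (g.tgt e) v) :
    (g.subst h).conn {⟨e, f⟩}ᶜ (g.inner h e w) (g.outer h v) := by
  have a₁ := conn_inner_compl (G := g.toConnGraph) h₁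
  rw [inner_vout] at a₁
  exact Setoid.trans' _ a₁ (conn_outer_compl h₂)

theorem ForwardAt.subst_forward {e : E} {f : F e} (hg : g.ForwardAt e) (hh : (h e).ForwardAt f) :
    (g.subst h).ForwardAt ⟨e, f⟩ :=
  ⟨conn_subst_src hh.1 hg.1, conn_subst_tgt hh.2 hg.2⟩

theorem ForwardAt.subst_backward {e : E} {f : F e} (hg : g.ForwardAt e)
    (hh : (h e).BackwardAt f) : (g.subst h).BackwardAt ⟨e, f⟩ :=
  ⟨conn_subst_tgt hh.1 hg.2, conn_subst_src hh.2 hg.1⟩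

theorem BackwardAt.subst_forward {e : E} {f : F e} (hg : g.BackwardAt e) (hh : (h e).ForwardAt f) :
    (g.subst h).BackwardAt ⟨e, f⟩ :=
  ⟨conn_subst_src hh.1 hg.1, conn_subst_tgt hh.2 hg.2⟩

theorem IsForward.subst (hg : g.IsForward) (hh : ∀ e, (h e).IsForward) :
    (g.subst h).IsForward := fun x => (hg x.1).subst_forward (hh x.1 x.2)

theorem IsForward.subst_backward (hg : g.IsForward) (hh : ∀ e, (h e).IsBackward) :
    (g.subst h).IsBackward := fun x => (hg x.1).subst_backward (hh x.1 x.2)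

theorem IsBackward.subst_forward (hg : g.IsBackward) (hh : ∀ e, (h e).IsForward) :
    (g.subst h).IsBackward := fun x => (hg x.1).subst_forward (hh x.1 x.2)

theorem IsForward.subst_thin (hg : g.IsForward) (hh : ∀ e, (h e).IsThin) :
    (g.subst h).IsThin := fun x =>
  (hh x.1 x.2).imp (hg x.1).subst_forward (hg x.1).subst_backward

theorem IsThick.subst (hg : g.IsThick) : (g.subst h).IsThick := fun x => conn_outer_compl (hg x.1)

theorem isThick_subst (hh : ∀ e, (h e).IsThick) : (g.subst h).IsThick := by
  rintro ⟨e, f⟩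
  refine conn_outer (S := Set.univ) (fun e' _ => ?_) (g.connected.conn_univ _ _)
  by_cases he : e' = e
  · subst he
    exact conn_inner_compl (hh e' f)
  · refine conn_inner_of_fst ?_ _ _
    rintro ⟨e'', f'⟩ rfl hx
    exact he (congrArg Sigma.fst hx)

theorem IsForward.transpose (hg : g.IsForward) : g.transpose.IsBackward := fun e => hg e

theorem isForward_path (n : ℕ) : (path n).IsForward := by
  intro e
  let G := (path n).toMultidigraph
  have hstep : ∀ k : Fin n, k ≠ e → G.conn {e}ᶜ k.castSucc k.succ := fun k hk =>
    Setoid.symm' _ (conn_of_mem (G := G) (F := {e}ᶜ) (e := k) hk)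
  let x : ℕ → Fin (n + 1) := fun k => Fin.ofNat (n + 1) k
  have hx : ∀ k, k < n → k ≠ e.1 → G.conn {e}ᶜ (x k) (x (k + 1)) := by
    intro k hk hne
    have h₁ : x k = (⟨k, hk⟩ : Fin n).castSucc := by
      ext; simp [x, Nat.mod_eq_of_lt (show k < n + 1 by omega)]
    have h₂ : x (k + 1) = (⟨k, hk⟩ : Fin n).succ := by
      ext; simp [x, Nat.mod_eq_of_lt (show k + 1 < n + 1 by omega)]
    rw [h₁, h₂]
    exact hstep _ fun h => hne (congrArg Fin.val h)
  have he := e.2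
  constructor
  · have h₁ : e.succ = x (e.1 + 1) := by
      ext; simp [x, Nat.mod_eq_of_lt (show e.1 + 1 < n + 1 by omega)]
    have h₂ : Fin.last n = x n := by ext; simp [x]
    change G.conn {e}ᶜ e.succ (Fin.last n)
    rw [h₁, h₂]
    exact setoid_of_steps _ x (by omega) fun k hk hk' => hx k hk' (by omega)
  · have h₁ : e.castSucc = x e.1 := by
      ext; simp [x]
    have h₂ : (0 : Fin (n + 1)) = x 0 := by ext; simp [x]
    change G.conn {e}ᶜ e.castSucc 0
    rw [h₁, h₂]
    exact Setoid.symm' _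
      (setoid_of_steps _ x (by omega) fun k hk hk' => hx k (by omega) (by omega))

end GraphOp

/-- A multilinear map sends spans into a submodule as soon as it sends generators there. -/
theorem multilinear_mem_of_mem_span {ι M N : Type*} [Finite ι] [AddCommGroup M] [Module ℂ M]
    [AddCommGroup N] [Module ℂ N] (f : MultilinearMap ℂ (fun _ : ι => M) N) (B : ι → Set M)
    (S : Submodule ℂ N) (h : ∀ x, (∀ i, x i ∈ B i) → f x ∈ S) (x : ι → M)
    (hx : ∀ i, x i ∈ Submodule.span ℂ (B i)) : f x ∈ S := by
  classical
  have := Fintype.ofFinite ι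
  have key : ∀ s : Finset ι, ∀ x : ι → M, (∀ i ∈ s, x i ∈ Submodule.span ℂ (B i)) →
      (∀ i ∉ s, x i ∈ B i) → f x ∈ S := by
    intro s
    induction s using Finset.induction with
    | empty => exact fun x _ hx => h x fun i => hx i (by simp)
    | insert j s hj ih =>
      intro x hx hx'
      have hj' : x j ∈ Submodule.span ℂ (B j) := hx j (by simp)
      have hupd : ∀ z ∈ Submodule.span ℂ (B j), f (Function.update x j z) ∈ S := by
        intro z hz
        induction hz using Submodule.span_induction with
        | mem z hz =>
          refine ih _ (fun i hi => ?_) (fun i hi => ?_)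
          · have hij : i ≠ j := fun h => hj (h ▸ hi)
            rw [Function.update_of_ne hij]
            exact hx i (by simp [hi])
          · by_cases hij : i = j
            · subst hij
              rwa [Function.update_self]
            · rw [Function.update_of_ne hij]
              exact hx' i (by simp [hi, hij])
        | zero => rw [f.map_update_zero]; exact S.zero_mem
        | add y z _ _ hy hz => rw [f.map_update_add]; exact S.add_mem hy hz
        | smul r y _ hy => rw [f.map_update_smul]; exact S.smul_mem r hy
      simpa using hupd _ hj'
  exact key Finset.univ x (fun i _ => hx i) fun i hi => absurd (Finset.mem_univ i) hi

namespace GAlgebra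

variable {A : Type*} [GAlgebra A] {I : Type*}

/-- The elements `Z_g(a_γ)` for graph operations `g` in the class `P`. -/
def opValues (P : ∀ ⦃V E : Type⦄, GraphOp V E → Prop) (a : I → A) : Set A :=
  {x | ∃ (V E : Type) (_ : Finite V) (_ : Finite E) (g : GraphOp V E) (γ : E → I),
    P g ∧ Z g (fun e => a (γ e)) = x}

/-- The span of the elements `Z_g(a_γ)` for graph operations `g` in the class `P`. -/
def opSpan (P : ∀ ⦃V E : Type⦄, GraphOp V E → Prop) (a : I → A) : Submodule ℂ A :=
  Submodule.span ℂ (opValues P a)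

variable {P P' : ∀ ⦃V E : Type⦄, GraphOp V E → Prop} {a : I → A}

theorem opSpan_mono (h : ∀ ⦃V E : Type⦄ (g : GraphOp V E), P g → P' g) :
    opSpan P a ≤ opSpan P' a := by
  refine Submodule.span_mono ?_
  rintro x ⟨V, E, _, _, g, γ, hg, rfl⟩
  exact ⟨V, E, ‹_›, ‹_›, g, γ, h g hg, rfl⟩

/-- A graph operation maps the span of the class `P` to that of `P'` if substituting members of `P`
into it yields members of `P'`. -/
theorem Z_mem_opSpan {V E : Type} [Finite V] [Finite E] (g : GraphOp V E)
    (h : ∀ (W F : E → Type) (h : ∀ e, GraphOp (W e) (F e)), (∀ e, P (h e)) → P' (g.subst h))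
    (x : E → A) (hx : ∀ e, x e ∈ opSpan P a) : Z g x ∈ opSpan P' a := by
  refine multilinear_mem_of_mem_span (Z g) (fun _ => opValues P a) _ (fun y hy => ?_) x hx
  choose W F hW hF k γ hk hy using hy
  have : y = fun e => Z (k e) (fun f => a (γ e f)) := funext fun e => (hy e).symm
  rw [this, ← Z_subst g k (fun z => a (γ z.1 z.2))]
  exact Submodule.subset_span
    ⟨g.SubstVertex k, Σ e, F e, inferInstance, inferInstance, g.subst k, fun z => γ z.1 z.2,
      h W F k hk, rfl⟩

/-- The span of a class of graph operations that is closed under concatenation contains the algebras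
generated by its subsets. -/
theorem adjoin_le_opSpan (h₀ : P (GraphOp.path 0))
    (h₂ : ∀ (W F : Fin 2 → Type) (h : ∀ e, GraphOp (W e) (F e)), (∀ e, P (h e)) →
      P ((GraphOp.path 2).subst h)) {S : Set A} (hS : ∀ x ∈ S, x ∈ opSpan P a) {x : A}
    (hx : x ∈ Algebra.adjoin ℂ S) : x ∈ opSpan P a := by
  induction hx using Algebra.adjoin_induction with
  | mem x hx => exact hS x hx
  | algebraMap r =>
    rw [Algebra.algebraMap_eq_smul_one]
    refine Submodule.smul_mem _ r (Submodule.subset_span ?_)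
    exact ⟨Fin 1, Fin 0, inferInstance, inferInstance, GraphOp.path 0, Fin.elim0, h₀,
      Z_path_zero _⟩
  | add x y _ _ hx hy => exact Submodule.add_mem _ hx hy
  | mul x y _ _ hx hy =>
    rw [mul_def]
    refine Z_mem_opSpan (GraphOp.path 2) h₂ _ fun e => ?_
    fin_cases e
    · exact hx
    · exact hy

theorem adjoin_range_le {x : A} (hx : x ∈ Algebra.adjoin ℂ (Set.range a)) :
    x ∈ opSpan (fun _ _ g => g.IsForward) a := by
  refine adjoin_le_opSpan (GraphOp.isForward_path 0)
    (fun _ _ _ hh => (GraphOp.isForward_path 2).subst hh) ?_ hx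
  rintro _ ⟨i, rfl⟩
  exact Submodule.subset_span ⟨Fin 2, Fin 1, inferInstance, inferInstance, GraphOp.path 1,
    fun _ => i, GraphOp.isForward_path 1, Z_id _⟩

theorem transpose_mem {x : A} (hx : x ∈ opSpan (fun _ _ g => g.IsForward) a) :
    transpose x ∈ opSpan (fun _ _ g => g.IsBackward) a :=
  Z_mem_opSpan (GraphOp.path 1).transpose
    (fun _ _ _ hh => (GraphOp.isForward_path 1).transpose.subst_forward hh) _ fun _ => hx

theorem adjoin_transpose_le {S : Set A} (hS : S ⊆ Algebra.adjoin ℂ (Set.range a)) {x : A}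
    (hx : x ∈ Algebra.adjoin ℂ (transpose '' S)) : x ∈ opSpan (fun _ _ g => g.IsBackward) a := by
  refine adjoin_le_opSpan (fun e => e.elim0)
    (fun _ _ _ hh => (GraphOp.isForward_path 2).subst_backward hh) ?_ hx
  rintro _ ⟨y, hy, rfl⟩
  exact transpose_mem (adjoin_range_le (hS hy))

theorem adjoin_union_transpose_le {S : Set A} (hS : S ⊆ Algebra.adjoin ℂ (Set.range a)) {x : A}
    (hx : x ∈ Algebra.adjoin ℂ (S ∪ transpose '' S)) :
    x ∈ opSpan (fun _ _ g => g.IsThin) a := by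
  refine adjoin_le_opSpan (fun e => e.elim0)
    (fun _ _ _ hh => (GraphOp.isForward_path 2).subst_thin hh) ?_ hx
  rintro x (hx | ⟨y, hy, rfl⟩)
  · exact opSpan_mono (fun V E g hg e => .inl (hg e)) (adjoin_range_le (hS hx))
  · exact opSpan_mono (fun V E g hg e => .inr (hg e)) (transpose_mem (adjoin_range_le (hS hy)))

theorem adjoin_theta_le {S : Set A} (hS : S ⊆ Algebra.adjoin ℂ (Set.range a)) {x : A}
    (hx : x ∈ Algebra.adjoin ℂ (theta S : Set A)) : x ∈ opSpan (fun _ _ g => g.IsThick) a := by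
  refine adjoin_le_opSpan (fun e => e.elim0) (fun _ _ _ hh => GraphOp.isThick_subst hh)
    (fun y hy => ?_) hx
  refine (Submodule.span_le (p := opSpan (fun _ _ g => g.IsThick) a)).2 ?_ hy
  rintro _ ⟨V, E, _, _, g, b, hg, hb, rfl⟩
  exact Z_mem_opSpan g (fun _ _ _ _ => hg.isThick.subst) b fun e => adjoin_range_le (hS (hb e))

end GAlgebra

/-! ### Cyclic products of graph operations -/

namespace ConnGraph

open Multidigraph

variable {n : ℕ} {W F : Fin (n + 1) → Type} (g : ∀ k, GraphOp (W k) (F k))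

/-- The graph obtained by closing up the product of the graph operations `g 0, …, g n`. -/
abbrev necklace : ConnGraph ((cycle (n + 1)).SubstVertex g) (Σ k, F k) := (cycle (n + 1)).subst g

/-- The output of `g k`, which is the input of `g (k - 1)`. -/
abbrev node (k : Fin (n + 1)) : (cycle (n + 1)).SubstVertex g := (cycle (n + 1)).outer g k

theorem necklace_step (k : Fin (n + 1)) :
    (necklace g).conn {x | x.1 = k} (node g k) (node g (k + 1)) := by
  have h := conn_inner_of_fst (G := cycle (n + 1)) (h := g) (e := k) (S' := {x | x.1 = k})
    subset_rfl (g k).vout (g k).vin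
  rwa [inner_vin, inner_vout] at h

theorem necklace_conn_inner (k : Fin (n + 1)) (w : W k) :
    (necklace g).conn {x | x.1 = k} ((cycle (n + 1)).inner g k w) (node g k) := by
  have h := conn_inner_of_fst (G := cycle (n + 1)) (h := g) (e := k) (S' := {x | x.1 = k})
    subset_rfl w (g k).vout
  rwa [inner_vout] at h

theorem exists_necklace_conn (v : (cycle (n + 1)).SubstVertex g) :
    ∃ k, (necklace g).conn {x | x.1 = k} v (node g k) := by
  induction v using Quot.inductionOn with | _ v => ?_
  rcases v with k | ⟨k, w⟩
  · exact ⟨k, Setoid.refl' _ _⟩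
  · exact ⟨k, necklace_conn_inner g k w⟩

/-- The colouring of the edges of a necklace in which the factors `k ∈ R` have a colour of their
own, and all other factors share the colour `none`. -/
def factorColor (R : Finset (Fin (n + 1))) (x : Σ k, F k) : Option (Fin (n + 1)) :=
  if x.1 ∈ R then some x.1 else none

theorem factorColor_eq_some {R : Finset (Fin (n + 1))} {x : Σ k, F k} {k : Fin (n + 1)} :
    factorColor R x = some k ↔ x.1 = k ∧ k ∈ R := by
  unfold factorColor
  split
  · simp only [Option.some.injEq]
    exact ⟨fun h => ⟨h, h ▸ ‹_›⟩, fun h => h.1⟩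
  · simp only [reduceCtorEq, false_iff]
    rintro ⟨h, h'⟩
    exact absurd (h ▸ h') ‹_›

theorem factorColor_eq_none {R : Finset (Fin (n + 1))} {x : Σ k, F k} :
    factorColor R x = none ↔ x.1 ∉ R := by
  simp [factorColor]

/-- Away from the factor `k`, all nodes are joined to each other, so the rest of the necklace hangs at
`node g k`; and each vertex of the factor `k` is joined to `node g k` inside the factor. -/
theorem isTreeLike_factorColor (R : Finset (Fin (n + 1))) :
    (necklace g).IsTreeLike (factorColor R) := by
  have key : ∀ (p : Option (Fin (n + 1))) (k : Fin (n + 1)), p ≠ some k → ∀ v,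
      (necklace g).offColor (factorColor R) (some k) v (node g k) ∨
        (necklace g).offColor (factorColor R) p v (node g k) := by
    intro p k hpk v
    have hsub : ∀ l, l ≠ k →
        ({x | x.1 = l} : Set (Σ k, F k)) ⊆ {x | factorColor R x ≠ some k} := by
      rintro l hl x hx h
      exact hl (hx.symm.trans (factorColor_eq_some.1 h).1)
    obtain ⟨l, hl⟩ := exists_necklace_conn g v
    by_cases hlk : l = k
    · subst hlk
      by_cases hR : l ∈ R
      · refine .inr (conn_mono ?_ hl)
        rintro x hx h
        exact hpk (h.symm.trans (factorColor_eq_some.2 ⟨hx, hR⟩))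
      · refine .inl (conn_mono ?_ hl)
        rintro x - h
        exact hR (factorColor_eq_some.1 h).2
    · exact .inl (Setoid.trans' _ (conn_mono (hsub l hlk) hl)
        (setoid_of_cyclic_steps_ne _ (node g) k
          (fun m hm => conn_mono (hsub m hm) (necklace_step g m)) _ _))
  intro p q hpq
  cases q with
  | some k => exact ⟨node g k, node g k, key p k hpq⟩
  | none =>
    cases p with
    | some k => exact ⟨node g k, node g k, fun v => (key none k hpq.symm v).symm⟩
    | none => exact absurd rfl hpq

theorem isMonochromatic_factorColor_iff {R : Finset (Fin (n + 1))}
    {π : Setoid ((cycle (n + 1)).SubstVertex g)} :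
    (necklace g).IsMonochromatic (factorColor R) π ↔
      ∀ k ∈ R, ((necklace g).quotient π).IsIsolated Sigma.fst k := by
  constructor
  · intro h k hk C hC e he e' he' hek
    have := h C hC e he e' he'
    rw [factorColor_eq_some.2 ⟨hek, hk⟩] at this
    exact (factorColor_eq_some.1 this.symm).1
  · intro h C hC e he e' he'
    by_cases h₁ : e.1 ∈ R
    · have := h _ h₁ C hC e he e' he' rfl
      rw [factorColor_eq_some.2 ⟨rfl, h₁⟩, factorColor_eq_some.2 ⟨this, h₁⟩]
    · have h₂ : e'.1 ∉ R := fun h₂ => h₁ (h _ h₂ C hC e' he' e he rfl ▸ h₂)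
      rw [factorColor_eq_none.2 h₁, factorColor_eq_none.2 h₂]

theorem conn_quotient {V E : Type} {G : ConnGraph V E} (π : Setoid V) {S : Set E} {v w : V}
    (h : G.conn S v w) : (G.quotient π).conn S (Quotient.mk π v) (Quotient.mk π w) :=
  conn_map (G := G.toMultidigraph) (G' := (G.quotient π).toMultidigraph) (Quotient.mk π)
    (fun _ he => conn_of_mem (G := (G.quotient π).toMultidigraph) he) h

variable (π : Setoid ((cycle (n + 1)).SubstVertex g))

theorem isArrangement_quotient :
    ((necklace g).quotient π).IsArrangement Sigma.fst (fun k => Quotient.mk π (node g k)) where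
  step k := conn_quotient π (necklace_step g k)
  src e := conn_quotient π (necklace_conn_inner g e.1 _)

variable {g}

theorem conn_factor {k : Fin (n + 1)} {f : F k} {w w' : W k} (h : (g k).conn {f}ᶜ w w') :
    ((necklace g).quotient π).conn ({x | x.1 = k} \ {⟨k, f⟩})
      (Quotient.mk π ((cycle (n + 1)).inner g k w))
      (Quotient.mk π ((cycle (n + 1)).inner g k w')) := by
  refine conn_quotient π (conn_inner (S := {f}ᶜ) (S' := {x | x.1 = k} \ {⟨k, f⟩})
    (fun f' hf' => ⟨rfl, fun hx => hf' ?_⟩) h)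
  simpa using hx

theorem bridges_of_forwardAt {k : Fin (n + 1)} {f : F k} (h : (g k).ForwardAt f) :
    ((necklace g).quotient π).Bridges Sigma.fst ⟨k, f⟩
      (Quotient.mk π (node g (k + 1))) (Quotient.mk π (node g k)) := by
  have h₁ := conn_factor π h.1
  have h₂ := conn_factor π h.2
  rw [inner_vin] at h₁
  rw [inner_vout] at h₂
  exact ⟨h₁, h₂⟩

theorem bridges_of_backwardAt {k : Fin (n + 1)} {f : F k} (h : (g k).BackwardAt f) :
    ((necklace g).quotient π).Bridges Sigma.fst ⟨k, f⟩
      (Quotient.mk π (node g k)) (Quotient.mk π (node g (k + 1))) := by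
  have h₁ := conn_factor π h.1
  have h₂ := conn_factor π h.2
  rw [inner_vout] at h₁
  rw [inner_vin] at h₂
  exact ⟨h₁, h₂⟩

theorem isThin_quotient {k : Fin (n + 1)} (h : (g k).IsThin) :
    ((necklace g).quotient π).IsThin Sigma.fst (fun k => Quotient.mk π (node g k)) k := by
  rintro ⟨k, f⟩ rfl
  exact (h f).imp (bridges_of_forwardAt π) (bridges_of_backwardAt π)

theorem isThick_quotient {k : Fin (n + 1)} (h : (g k).IsThick) :
    ((necklace g).quotient π).IsThick Sigma.fst (fun k => Quotient.mk π (node g k)) k := by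
  rintro ⟨l, f⟩
  by_cases hl : l = k
  · subst hl
    have h₁ := conn_factor π (h f)
    rw [inner_vin, inner_vout] at h₁
    exact Setoid.symm' _ h₁
  · refine conn_mono ?_ ((isArrangement_quotient g π).step k)
    exact fun x hx => ⟨hx, fun h => hl ((congrArg Sigma.fst h).symm.trans hx)⟩

end ConnGraph

/-! ### Freeness -/

theorem prod_ofFn_ite_eq {R : Type*} [Monoid R] {n : ℕ} (x : Fin n → R) (j : Fin n) :
    (List.ofFn fun k => if k = j then x k else 1).prod = x j := by
  rw [List.ofFn_eq_map, ← prod_filter_eq, List.filter_eq,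
    List.count_eq_one_of_mem (List.nodup_finRange n) (List.mem_finRange j)]
  simp

namespace TrafficState

open ConnGraph GAlgebra

variable {A : Type*} [GAlgebra A] (T : TrafficState A)

theorem φ_one : T.φ 1 = 1 := by
  let h : Fin 1 → GraphOp (Fin 1) (Fin 0) := fun _ => GraphOp.path 0
  have hsub : ∀ x : (cycle 1).SubstVertex h, x = (cycle 1).outer h 0 := by
    intro x
    induction x using Quot.inductionOn with | _ x => ?_
    rcases x with v | ⟨e, w⟩
    · rw [Subsingleton.elim v 0]; rfl
    · have h₁ := inner_vout (G := cycle 1) h e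
      have h₂ : w = (h e).vout := Fin.ext (by omega)
      rw [h₂]
      exact h₁.trans (by rw [Subsingleton.elim ((cycle 1).tgt e) 0])
  have h₁ := T.τ_subst (cycle 1) h (fun x => x.2.elim0)
  have h₂ := T.τ_iso ((cycle 1).subst h) (GraphOp.path 0).toConnGraph
    ⟨fun _ => 0, fun _ => (cycle 1).outer h 0, fun x => (hsub x).symm,
      fun x => Fin.ext (by omega)⟩
    ⟨fun x => x.2, fun x => x.elim0, fun x => x.2.elim0, fun x => x.elim0⟩
    (fun x => x.2.elim0) (fun x => x.2.elim0) ![]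
  rw [T.τ_unit] at h₂
  refine Eq.trans ?_ (h₁.trans (Eq.trans ?_ h₂.symm))
  · change T.τ (cycle 1) (fun _ => 1) = _
    exact congrArg _ (funext fun _ => (Z_path_zero _).symm)
  · exact congrArg _ (funext fun x => x.2.elim0)

/-- The linear projection onto the kernel of `φ`. -/
noncomputable def center : A →ₗ[ℂ] A := LinearMap.id - T.φ.smulRight 1

theorem center_apply (x : A) : T.center x = -T.φ x • 1 + x := by
  simp [center, sub_eq_neg_add]

/-- The value of `φ` on the product of the centred factors. -/
noncomputable def centeredMoment (n : ℕ) : MultilinearMap ℂ (fun _ : Fin n => A) ℂ :=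
  (T.φ.compMultilinearMap (MultilinearMap.mkPiAlgebraFin ℂ n A)).compLinearMap fun _ => T.center

theorem centeredMoment_of_φ_eq_zero {n : ℕ} (x : Fin n → A) (hx : ∀ k, T.φ (x k) = 0) :
    T.centeredMoment n x = T.φ (List.ofFn x).prod := by
  simp [centeredMoment, center_apply, hx]

/-- Expansion of the centred factors; `R` is the set of the factors replaced by their
expectations. -/
theorem centeredMoment_eq_sum {n : ℕ} (x : Fin n → A) :
    T.centeredMoment n x = ∑ R : Finset (Fin n), (-1) ^ R.card *
      ((∏ k ∈ R, T.φ (x k)) * T.φ (List.ofFn fun k => if k ∉ R then x k else 1).prod) := by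
  let M := T.φ.compMultilinearMap (MultilinearMap.mkPiAlgebraFin ℂ n A)
  have h₁ : T.centeredMoment n x = M ((fun k => -T.φ (x k) • 1) + x) := by
    change M _ = M _
    congr 1
    funext k
    exact T.center_apply (x k)
  rw [h₁, M.map_add_univ]
  refine Finset.sum_congr rfl fun R _ => ?_
  let y : Fin n → A := fun k => if k ∉ R then x k else 1
  have h₂ : R.piecewise (fun k => -T.φ (x k) • (1 : A)) x =
      R.piecewise (fun k => -T.φ (x k) • y k) y := by
    funext k
    by_cases hk : k ∈ R <;> simp [y, hk]
  rw [h₂, M.map_piecewise_smul, Finset.prod_neg, smul_eq_mul, mul_assoc]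
  simp [M, y]

variable {T} {n : ℕ} {W F : Fin (n + 1) → Type} [∀ k, Finite (W k)] [∀ k, Finite (F k)]

theorem τ_necklace (g : ∀ k, GraphOp (W k) (F k)) (a : (Σ k, F k) → A) (p : Fin (n + 1) → Prop)
    [DecidablePred p] :
    T.τ (necklace g) (fun x => if p x.1 then a x else 1) =
      T.φ (List.ofFn fun k => if p k then Z (g k) (fun f => a ⟨k, f⟩) else 1).prod := by
  rw [T.φ_prod, ← T.τ_subst]
  congr 1
  funext k
  by_cases hk : p k
  · simp only [hk, if_true]
  · simp only [hk, if_false, Z_one]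

variable {I : Type*} {a : I → A}

open scoped Classical in
/-- Factorization for a necklace, where the factors `k ∈ R` are cut off: exactly the cactus quotients
in which these factors are isolated contribute. -/
theorem IsCactusType.prod_φ_eq (ha : T.IsCactusType a) (g : ∀ k, GraphOp (W k) (F k))
    [Fintype (Setoid ((cycle (n + 1)).SubstVertex g))] (γ : (Σ k, F k) → I)
    (R : Finset (Fin (n + 1))) :
    (∏ k ∈ R, T.φ (Z (g k) fun f => a (γ ⟨k, f⟩))) *
        T.φ (List.ofFn fun k => if k ∉ R then Z (g k) (fun f => a (γ ⟨k, f⟩)) else 1).prod =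
      ∑ π with ((necklace g).quotient π).IsCactus ∧
          ∀ k ∈ R, ((necklace g).quotient π).IsIsolated Sigma.fst k,
        T.injective ((necklace g).quotient π) (fun e => a (γ e)) := by
  have h := ha.prod_τ_eq (isTreeLike_factorColor g R) γ
  simp only [isMonochromatic_factorColor_iff] at h
  rw [← h, Fintype.prod_option, mul_comm]
  simp only [factorColor_eq_none, factorColor_eq_some]
  rw [T.τ_necklace g (fun x => a (γ x)) (fun k => k ∉ R)]
  congr 1
  rw [← Finset.prod_subset (Finset.subset_univ R)]
  · refine Finset.prod_congr rfl fun j hj => ?_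
    simp only [hj, and_true]
    rw [T.τ_necklace g (fun x => a (γ x)) (fun k => k = j), prod_ofFn_ite_eq]
  · intro j _ hj
    simp only [hj, and_false, if_false]
    have := T.τ_necklace g (fun x => a (γ x)) (fun _ => False)
    simpa [T.φ_one] using this

/-- Inclusion–exclusion over the sets of factors that are replaced by their expectations: only the
cactus quotients without isolated factors contribute to a centred moment. -/
theorem IsCactusType.centeredMoment_eq_zero (ha : T.IsCactusType a)
    (g : ∀ k, GraphOp (W k) (F k)) (γ : (Σ k, F k) → I)
    (hiso : ∀ π, ((necklace g).quotient π).IsCactus →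
      T.injective ((necklace g).quotient π) (fun e => a (γ e)) ≠ 0 →
      ∃ k, ((necklace g).quotient π).IsIsolated Sigma.fst k) :
    T.centeredMoment (n + 1) (fun k => Z (g k) fun f => a (γ ⟨k, f⟩)) = 0 := by
  classical
  let _ := Fintype.ofFinite (Setoid ((cycle (n + 1)).SubstVertex g))
  rw [T.centeredMoment_eq_sum]
  simp only [ha.prod_φ_eq g γ, Finset.sum_filter, Finset.mul_sum]
  rw [Finset.sum_comm]
  refine Finset.sum_eq_zero fun π _ => ?_
  set K := (necklace g).quotient π
  by_cases h : K.IsCactus ∧ T.injective K (fun e => a (γ e)) ≠ 0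
  · obtain ⟨j, hj⟩ := hiso π h.1 h.2
    let D : Finset (Fin (n + 1)) := Finset.univ.filter fun k => K.IsIsolated Sigma.fst k
    have hD : ∀ R : Finset (Fin (n + 1)),
        (K.IsCactus ∧ ∀ k ∈ R, K.IsIsolated Sigma.fst k) ↔ R ∈ D.powerset := fun R => by
      simp [D, h.1, Finset.subset_iff]
    simp only [mul_ite, mul_zero]
    rw [← Finset.sum_filter, show Finset.filter _ Finset.univ = D.powerset from Finset.ext fun R =>
      Finset.mem_filter.trans ((and_iff_right (Finset.mem_univ R)).trans (hD R)), ← Finset.sum_mul]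
    have := Finset.sum_powerset_neg_one_pow_card_of_nonempty (x := D) ⟨j, by simpa [D] using hj⟩
    have h' : ∑ R ∈ D.powerset, (-1 : ℂ) ^ R.card = 0 := by exact_mod_cast this
    rw [h', zero_mul]
  · refine Finset.sum_eq_zero fun R _ => ?_
    split
    · rename_i h'
      rw [not_and_not_right] at h
      rw [h h'.1, mul_zero]
    · rw [mul_zero]

/-- Freeness can be tested on generating classes of graph operations. -/
theorem areFree_of_centeredMoment {P Q : ∀ ⦃V E : Type⦄, GraphOp V E → Prop}
    (h : ∀ (n : ℕ) (c : Fin (n + 1) → Bool) (W F : Fin (n + 1) → Type) [∀ k, Finite (W k)]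
      [∀ k, Finite (F k)] (g : ∀ k, GraphOp (W k) (F k)) (γ : (Σ k, F k) → I),
      (∀ k : Fin n, c k.castSucc ≠ c k.succ) → (∀ k, c k = true → P (g k)) →
      (∀ k, c k = false → Q (g k)) →
      T.centeredMoment (n + 1) (fun k => Z (g k) fun f => a (γ ⟨k, f⟩)) = 0)
    {S S' : Set A} (hS : ∀ x ∈ Algebra.adjoin ℂ S, x ∈ opSpan P a)
    (hS' : ∀ x ∈ Algebra.adjoin ℂ S', x ∈ opSpan Q a) : AreFree T.φ S S' := by
  intro n c x hc hx hφ
  rw [← T.centeredMoment_of_φ_eq_zero x hφ, ← Submodule.mem_bot ℂ]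
  refine multilinear_mem_of_mem_span _ (fun k => opValues
    (fun _ _ g => (c k = true → P g) ∧ (c k = false → Q g)) a) _ (fun y hy => ?_) x fun k => ?_
  · choose W F hW hF g γ hg hy using hy
    have : y = fun k => Z (g k) (fun f => a (γ k f)) := funext fun k => (hy k).symm
    rw [this, Submodule.mem_bot]
    exact h n c W F g (fun z => γ z.1 z.2) hc (fun k => (hg k).1) (fun k => (hg k).2)
  · have hk := hx k
    change x k ∈ opSpan _ a
    cases hck : c k
    · rw [hck] at hk
      exact opSpan_mono (fun _ _ g hg => ⟨fun h => by simp at h, fun _ => hg⟩) (hS' _ hk)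
    · rw [hck] at hk
      exact opSpan_mono (fun _ _ g hg => ⟨fun _ => hg, fun h => by simp at h⟩) (hS _ hk)

theorem IsCactusType.areFree_theta (ha : T.IsCactusType a) {S : Set A}
    (hS : S ⊆ Algebra.adjoin ℂ (Set.range a)) :
    AreFree T.φ (S ∪ transpose '' S) (theta S : Set A) := by
  refine areFree_of_centeredMoment (P := fun _ _ g => g.IsThin) (Q := fun _ _ g => g.IsThick)
    (a := a) (fun n c W F _ _ g γ hc hP hQ => ?_) (fun x hx => adjoin_union_transpose_le hS hx)
    (fun x hx => adjoin_theta_le hS hx)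
  refine ha.centeredMoment_eq_zero g γ fun π hK _ => ?_
  have hA := isArrangement_quotient g π
  refine hA.exists_isIsolated hK c hc (fun C hC e he e' he' => ?_)
    fun k hk => isThin_quotient π (hP k hk)
  by_contra hne
  have hne' : e.1 ≠ e'.1 := fun h => hne (by rw [h])
  cases h : c e.1
  · have h' : c e'.1 = true := by
      cases h' : c e'.1
      · exact absurd (h.trans h'.symm) hne
      · rfl
    exact hA.not_thin_thick hK hC he' he hne'.symm (isThin_quotient π (hP _ h'))
      (isThick_quotient π (hQ _ h))
  · have h' : c e'.1 = false := by
      cases h' : c e'.1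
      · rfl
      · exact absurd (h.trans h'.symm) hne
    exact hA.not_thin_thick hK hC he he' hne' (isThin_quotient π (hP _ h))
      (isThick_quotient π (hQ _ h'))

theorem IsCactusType.areFree_transpose (ha : T.IsCactusType a)
    (ho : T.IsSupportedOnOrientedCacti a) {S : Set A}
    (hS : S ⊆ Algebra.adjoin ℂ (Set.range a)) : AreFree T.φ S (transpose '' S) := by
  refine areFree_of_centeredMoment (P := fun _ _ g => g.IsForward)
    (Q := fun _ _ g => g.IsBackward) (a := a) (fun n c W F _ _ g γ hc hP hQ => ?_)
    (fun x hx => adjoin_range_le (Algebra.adjoin_le hS hx))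
    (fun x hx => adjoin_transpose_le hS hx)
  refine ha.centeredMoment_eq_zero g γ fun π hK hw => ?_
  have hO : ((necklace g).quotient π).IsOrientedCactus := by
    by_contra hO
    exact hw (ho _ _ _ γ hO)
  have hA := isArrangement_quotient g π
  refine hA.exists_isIsolated hK c hc (fun C hC e he e' he' => ?_)
    fun k hk => isThin_quotient π fun f => .inl (hP k hk f)
  by_contra hne
  have hne' : e.1 ≠ e'.1 := fun h => hne (by rw [h])
  cases h : c e.1
  · have h' : c e'.1 = true := by
      cases h' : c e'.1
      · exact absurd (h.trans h'.symm) hne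
      · rfl
    exact hA.not_opposite hK hC (hO.2 C hC) he' he hne'.symm
      (bridges_of_forwardAt π (hP _ h' _)) (bridges_of_backwardAt π (hQ _ h _))
  · have h' : c e'.1 = false := by
      cases h' : c e'.1
      · rfl
      · exact absurd (h.trans h'.symm) hne
    exact hA.not_opposite hK hC (hO.2 C hC) he he' hne'
      (bridges_of_forwardAt π (hP _ h _)) (bridges_of_backwardAt π (hQ _ h' _))

end TrafficState

end Traffic

theorem mainTheorem6 {A : Type*} [Traffic.GAlgebra A] (T : Traffic.TrafficState A)
    {I : Type*} (a : I → A) (ha : T.IsCactusType a) :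
    (∀ (n : ℕ) [NeZero n] (i : Fin n → I) (t : Fin n → Bool),
      Traffic.freeCumulant T.φ
          (fun k => if t k then Traffic.GAlgebra.transpose (a (i k)) else a (i k)) =
        T.injective (Traffic.ConnGraph.cycle n)
          (fun k => if t k then Traffic.GAlgebra.transpose (a (i k)) else a (i k))) ∧
    (∀ A₁ : Subalgebra ℂ A, A₁ = Algebra.adjoin ℂ (Set.range a) →
      Traffic.AreFree T.φ ((A₁ : Set A) ∪ Traffic.GAlgebra.transpose '' (A₁ : Set A))
        (Traffic.GAlgebra.theta (A₁ : Set A)) ∧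
      (T.IsSupportedOnOrientedCacti a →
        Traffic.AreFree T.φ (A₁ : Set A) (Traffic.GAlgebra.transpose '' (A₁ : Set A)))) := by
  refine ⟨fun n _ i t => ha.freeCumulant_eq n i t, ?_⟩
  rintro _ rfl
  exact ⟨ha.areFree_theta subset_rfl, fun ho => ha.areFree_transpose ho subset_rfl⟩
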